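/- Let $d,d_1\ge 1$ be integers, $\delta\in(0,1)$ and $L>0$, and let $D_v$, $\operatorname{div}_v$ denote the gradient and the divergence in $v$. Points of $\mathbb R^{1+d+d_1}$ are written $z=(t,x,v)$ with $t\in\mathbb R$, $x\in\mathbb R^d$, $v\in\mathbb R^{d_1}$, and $\mathbb R^{1+d+d_1}_T=(-\infty,T)\times\mathbb R^{d+d_1}$ for $T\in(-\infty,\infty]$. All functions are real- or vector-valued, and functions equal almost everywhere are identified. Assume that: - $\alpha:\mathbb R^{d_1}\to\mathbb R^d$ satisfies $\sup_{v\ne v'}|\alpha(v)-\alpha(v')|/|v-v'|^{\theta}<\infty$ for some $\theta\in(0,1]$; - $a=(a^{ij}(z))_{i,j=1}^{d_1}$ is measurable on $\mathbb R^{1+d+d_1}$, with $\delta|\xi|^2\le a^{ij}(z)\xi_i\xi_j$ and $|a^{ij}(z)|\le\delta^{-1}$ for all $z$ and all $\xi\in\mathbb R^{d_1}$; - $b$, $\bar b$ ($\mathbb R^{d_1}$-valued) and $c$ (real-valued) are measurable on $\mathbb R^{1+d+d_1}$ with $|b|+|\bar b|+|c|\le L$. For an open set $G\subset\mathbb R^{1+d+d_1}$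 let $\mathbb H^{-1}_2(G)$ be the set of distributions on $G$ of the form $\operatorname{div}_v\vec f+g$ with $\vec f,g\in L_2(G)$, and let $\mathfrak S_2(G,\alpha)$ be the set of $u\in L_2(G)$ whose weak gradient $D_vu$ belongs to $L_2(G)$ and for which $\partial_tu+\alpha(v)\cdot D_xu\in\mathbb H^{-1}_2(G)$. For $\lambda\in\mathbb R$ consider the equation $$\partial_tu+\alpha(v)\cdot D_xu-D_{v_i}(a^{ij}D_{v_j}u)+\operatorname{div}_v(\bar b u)+b\cdot D_vu+(c+\lambda)u=\operatorname{div}_v\vec f+g.\qquad(*)_\lambda$$ A function $u\in\mathfrak S_2(G,\alpha)$ solves $(*)_\lambda$ on $G$ if the identity holds in $\mathbb H^{-1}_2(G)$, i.e. in the sense of distributions on $G$. (i) There exist constants $\lambda_0=\lambda_0(d,d_1,\delta,L)>0$ and $N=N(d,d_1,\delta)$ such that for every $T\in(-\infty,\infty]$, every $\lambda\ge\lambda_0$ and all $\vec f,g\in L_2(\mathbb R^{1+d+d_1}_T)$: every solution $u\in\mathfrak S_2(\mathbb R^{1+d+d_1}_T,\alpha)$ of $(*)_\lambda$ on $\mathbb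 R^{1+d+d_1}_T$ satisfies $$\lambda^{1/2}\|u\|+\|D_vu\|\le N\|\vec f\|+N\lambda^{-1/2}\|g\|,\qquad \|\cdot\|=\|\cdot\|_{L_2(\mathbb R^{1+d+d_1}_T)},$$ and $(*)_\lambda$ has a unique solution $u\in\mathfrak S_2(\mathbb R^{1+d+d_1}_T,\alpha)$. (ii) For all real numbers $S<T$ and all $\vec f,g\in L_2((S,T)\times\mathbb R^{d+d_1})$, the Cauchy problem for $(*)_0$ on $(S,T)\times\mathbb R^{d+d_1}$ with $u(S,\cdot)=0$ has a unique solution $u\in\mathfrak S_2((S,T)\times\mathbb R^{d+d_1},\alpha)$. Here $u$ is a solution of the Cauchy problem if it solves $(*)_0$ on $(S,T)\times\mathbb R^{d+d_1}$ and there is $\widetilde u\in\mathfrak S_2(\mathbb R^{1+d+d_1}_T,\alpha)$ with $\widetilde u=u$ on $(S,T)\times\mathbb R^{d+d_1}$ and $\widetilde u=0$ on $(-\infty,S)\times\mathbb R^{d+d_1}$. Moreover, $$\|u\|+\|D_vu\|\le N\|\vec f\|+N\|g\|,\qquad \|\cdot\|=\|\cdot\|_{L_2((S,T)\times\mathbb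 R^{d+d_1})},$$ where $N=N(d,d_1,\delta,L,T-S)$. -/

import Mathlib

open MeasureTheory Set TopologicalSpace
open scoped NNReal ENNReal Distributions

noncomputable section

namespace KineticL2

/-- Space-time `ℝ^{1+d+d₁}`, whose points are `z = (t, x, v)`, `t ∈ ℝ`, `x ∈ ℝ^d`, `v ∈ ℝ^{d₁}`. -/
abbrev Pt (d d₁ : ℕ) : Type := ℝ × EuclideanSpace ℝ (Fin d) × EuclideanSpace ℝ (Fin d₁)

/-- The open slab `(S, T) × ℝ^{d+d₁}` with `S, T ∈ [-∞, ∞]`. In particular,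
`slab d d₁ ⊥ T` is `ℝ^{1+d+d₁}_T = (-∞, T) × ℝ^{d+d₁}`. -/
def slab (d d₁ : ℕ) (S T : EReal) : Opens (Pt d d₁) :=
  ⟨{z | S < (z.1 : EReal) ∧ (z.1 : EReal) < T},
    (isOpen_lt continuous_const (continuous_coe_real_ereal.comp continuous_fst)).inter
      (isOpen_lt (continuous_coe_real_ereal.comp continuous_fst) continuous_const)⟩

variable {d d₁ : ℕ}

/-- Lebesgue measure on the open set `Ω`. -/
abbrev vol (Ω : Opens (Pt d d₁)) : Measure (Pt d d₁) := volume.restrict (Ω : Set (Pt d d₁))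

/-- `w · D_v φ (z)`. -/
def dV (φ : Pt d d₁ → ℝ) (z : Pt d d₁) (w : EuclideanSpace ℝ (Fin d₁)) : ℝ :=
  fderiv ℝ φ z (0, 0, w)

/-- `(∂_t φ + α(v) · D_x φ)(z)`, `z = (t, x, v)`. -/
def transportDeriv (α : EuclideanSpace ℝ (Fin d₁) → EuclideanSpace ℝ (Fin d))
    (φ : Pt d d₁ → ℝ) (z : Pt d d₁) : ℝ :=
  fderiv ℝ φ z (1, α z.2.2, 0)

/-- `w` belongs to `L₂(Ω)` and is the weak gradient `D_v u` on `Ω`. -/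
def IsGradV (Ω : Opens (Pt d d₁)) (u : Pt d d₁ → ℝ)
    (w : Pt d d₁ → EuclideanSpace ℝ (Fin d₁)) : Prop :=
  MemLp w 2 (vol Ω) ∧
    ∀ (i : Fin d₁) (φ : 𝓓(Ω, ℝ)),
      ∫ z in Ω, u z * dV φ z (EuclideanSpace.single i 1) = -∫ z in Ω, w z i * φ z

/-- The distribution `∂_t u + α(v) · D_x u` on `Ω`. -/
def transport (Ω : Opens (Pt d d₁))
    (α : EuclideanSpace ℝ (Fin d₁) → EuclideanSpace ℝ (Fin d)) (u : Pt d d₁ → ℝ)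
    (φ : 𝓓(Ω, ℝ)) : ℝ :=
  -∫ z in Ω, u z * transportDeriv α φ z

/-- The distribution `div_v f + g` on `Ω`. -/
def divAdd (Ω : Opens (Pt d d₁)) (f : Pt d d₁ → EuclideanSpace ℝ (Fin d₁)) (g : Pt d d₁ → ℝ)
    (φ : 𝓓(Ω, ℝ)) : ℝ :=
  ∫ z in Ω, (-dV φ z (f z) + g z * φ z)

/-- The distribution `Λ` on `Ω` belongs to `ℍ⁻¹₂(Ω)`: it equals `div_v f + g` for some
`f, g ∈ L₂(Ω)`. -/
def MemHNegOne (Ω : Opens (Pt d d₁)) (Λ : 𝓓(Ω, ℝ) → ℝ) : Prop :=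
  ∃ (f : Pt d d₁ → EuclideanSpace ℝ (Fin d₁)) (g : Pt d d₁ → ℝ),
    MemLp f 2 (vol Ω) ∧ MemLp g 2 (vol Ω) ∧ ∀ φ : 𝓓(Ω, ℝ), Λ φ = divAdd Ω f g φ

/-- `u ∈ 𝔖₂(Ω, α)`: `u, D_v u ∈ L₂(Ω)` and `∂_t u + α(v) · D_x u ∈ ℍ⁻¹₂(Ω)`. -/
def MemS2 (Ω : Opens (Pt d d₁))
    (α : EuclideanSpace ℝ (Fin d₁) → EuclideanSpace ℝ (Fin d)) (u : Pt d d₁ → ℝ) : Prop :=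
  MemLp u 2 (vol Ω) ∧ (∃ w, IsGradV Ω u w) ∧ MemHNegOne Ω (transport Ω α u)

/-- The coefficients of the equation. -/
structure Coeffs (d d₁ : ℕ) where
  /-- the drift `α` in the position variable -/
  α : EuclideanSpace ℝ (Fin d₁) → EuclideanSpace ℝ (Fin d)
  /-- the diffusion matrix `a` -/
  a : Pt d d₁ → Matrix (Fin d₁) (Fin d₁) ℝ
  /-- the coefficient `b̄` of `div_v (b̄ u)` -/
  bbar : Pt d d₁ → EuclideanSpace ℝ (Fin d₁)
  /-- the coefficient `b` of `b · D_v u` -/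
  b : Pt d d₁ → EuclideanSpace ℝ (Fin d₁)
  /-- the coefficient `c` of `c u` -/
  c : Pt d d₁ → ℝ

/-- Standing assumptions: `α` is globally `θ`-Hölder for some `θ ∈ (0, 1]`, `a` is measurable,
bounded by `δ⁻¹` and uniformly elliptic with constant `δ`, and `b`, `b̄`, `c` are measurable
with `|b| + |b̄| + |c| ≤ L`. -/
structure Coeffs.Admissible (C : Coeffs d d₁) (δ L : ℝ) : Prop where
  holder : ∃ θ K : ℝ≥0, 0 < θ ∧ θ ≤ 1 ∧ HolderWith K θ C.α
  a_meas : ∀ i j, AEMeasurable (fun z => C.a z i j) volume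
  a_elliptic : ∀ z (ξ : EuclideanSpace ℝ (Fin d₁)),
    δ * ‖ξ‖ ^ 2 ≤ ∑ i, ∑ j, C.a z i j * ξ i * ξ j
  a_bdd : ∀ z i j, |C.a z i j| ≤ δ⁻¹
  bbar_meas : AEMeasurable C.bbar volume
  b_meas : AEMeasurable C.b volume
  c_meas : AEMeasurable C.c volume
  lower_bdd : ∀ z, ‖C.b z‖ + ‖C.bbar z‖ + |C.c z| ≤ L

/-- The distribution
`∂_t u + α(v) · D_x u - D_{v_i}(a^{ij} D_{v_j} u) + div_v (b̄ u) + b · D_v u + (c + lam) u`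
on `Ω`, where `w = D_v u`. -/
def operator (Ω : Opens (Pt d d₁)) (C : Coeffs d d₁) (lam : ℝ) (u : Pt d d₁ → ℝ)
    (w : Pt d d₁ → EuclideanSpace ℝ (Fin d₁)) (φ : 𝓓(Ω, ℝ)) : ℝ :=
  transport Ω C.α u φ +
    ∫ z in Ω, ((∑ i, ∑ j, C.a z i j * w z j * dV φ z (EuclideanSpace.single i 1))
      - u z * dV φ z (C.bbar z)
      + (∑ i, C.b z i * w z i) * φ z
      + (C.c z + lam) * u z * φ z)

/-- The identity
`∂_t u + α(v) · D_x u - D_{v_i}(a^{ij} D_{v_j} u) + div_v (b̄ u) + b · D_v u + (c + lam) u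
  = div_v f + g` on `Ω`. -/
def SolvesEq (Ω : Opens (Pt d d₁)) (C : Coeffs d d₁) (lam : ℝ)
    (f : Pt d d₁ → EuclideanSpace ℝ (Fin d₁)) (g : Pt d d₁ → ℝ) (u : Pt d d₁ → ℝ) : Prop :=
  ∃ w, IsGradV Ω u w ∧ ∀ φ : 𝓓(Ω, ℝ), operator Ω C lam u w φ = divAdd Ω f g φ

/-- `u ∈ 𝔖₂(Ω, α)` is a solution of the equation on `Ω`. -/
def IsSolution (Ω : Opens (Pt d d₁)) (C : Coeffs d d₁) (lam : ℝ)
    (f : Pt d d₁ → EuclideanSpace ℝ (Fin d₁)) (g : Pt d d₁ → ℝ) (u : Pt d d₁ → ℝ) : Prop :=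
  MemS2 Ω C.α u ∧ SolvesEq Ω C lam f g u

/-- `u ∈ 𝔖₂((S, T) × ℝ^{d+d₁}, α)` is a solution of the equation with `lam = 0` on
`(S, T) × ℝ^{d+d₁}` with the initial condition `u(S, ·) = 0`: the extension of `u` by zero to
`t < S` belongs to `𝔖₂(ℝ^{1+d+d₁}_T, α)`. -/
def IsCauchySolution (S T : ℝ) (C : Coeffs d d₁)
    (f : Pt d d₁ → EuclideanSpace ℝ (Fin d₁)) (g : Pt d d₁ → ℝ) (u : Pt d d₁ → ℝ) : Prop :=
  IsSolution (slab d d₁ S T) C 0 f g u ∧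
    ∃ U : Pt d d₁ → ℝ, MemS2 (slab d d₁ ⊥ T) C.α U ∧
      U =ᵐ[vol (slab d d₁ S T)] u ∧ U =ᵐ[vol (slab d d₁ ⊥ S)] 0

end KineticL2

end

section

open Filter Topology
open scoped ContDiff

noncomputable section

namespace KineticL2

variable {d d₁ : ℕ}

/-! Everything rests on the energy balance. Write the equation as ∂_t u + α(v)·D_x u = div_v F + G,
where F and G collect the data and all elliptic and lower order terms. Pairing formally with u on t
< T gives ∫ (-F·D_v u + G u) = ½ ∫ u(T)² ≥ 0. For large λ the elliptic form is coercive, so the a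
priori estimate and uniqueness follow (`Coeffs.Admissible.apriori`).

The pairing needs a proof, because u has no regularity in t and x separately. For compactly
supported u the test function is u * ρ, with ρ even. Symmetrization turns ∫ u (∂_t + α·D_x)(u * ρ)
into a double integral with kernel ½ D_xρ(z - z')·(α(v) - α(v')). By Schur's test it is controlled
by the L₁ norm of this kernel in z'. If the radius of ρ in v is taken small enough after the radius
in x is fixed, this norm is as small as desired, and any Hölder exponent of α suffices
(`exists_isMollifier`, `abs_integral_mul_transport_le`, `energy_identity_of_compact`). Cutoffs
adapted to the transport remove the compactness. The cutoff near t = T is decreasing, so its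
contribution has a sign, and the inequality 0 ≤ ∫ (-F·D_v u + G u) remains
(`Kinetic.energy_inequality`).

Existence comes from Lions' projection theorem (`exists_weak_solution`), applied to the formal
adjoint on test functions embedded by φ ↦ (φ, D_v φ) in L₂ × L₂. Transport is skew-symmetric on test
functions, so the adjoint is as coercive as the elliptic form, and no regularity of u is needed.

For the Cauchy problem the factor exp(-λ(t - S)) raises the parameter from 0 to λ. A solution
extended by zero solves the equation on all of t < T, since the transport derivative of the
extension is in ℍ⁻¹₂ and cannot charge the hyperplane t = S (`Kinetic.glue`). Conversely, data
vanishing before S produce a solution vanishing there, by uniqueness on t < S. -/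

instance isAddHaarMeasure_volume_prod :
    (volume : Measure (EuclideanSpace ℝ (Fin d) × EuclideanSpace ℝ (Fin d₁))).IsAddHaarMeasure :=
  Measure.prod.instIsAddHaarMeasure _ _

instance isAddHaarMeasure_volume : (volume : Measure (Pt d d₁)).IsAddHaarMeasure :=
  Measure.prod.instIsAddHaarMeasure _ _

/-! ### Calculus of test functions and integrability. -/

/-- The gradient in `v` of a function, as a Euclidean vector. -/
def gradV (φ : Pt d d₁ → ℝ) (z : Pt d d₁) : EuclideanSpace ℝ (Fin d₁) :=
  WithLp.toLp 2 fun i => dV φ z (EuclideanSpace.single i 1)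

theorem dV_eq_sum (φ : Pt d d₁ → ℝ) (z : Pt d d₁) (w : EuclideanSpace ℝ (Fin d₁)) :
    dV φ z w = ∑ i, w i * dV φ z (EuclideanSpace.single i 1) := by
  have h : (fderiv ℝ φ z).comp ((ContinuousLinearMap.inr ℝ ℝ _).comp
      (ContinuousLinearMap.inr ℝ (EuclideanSpace ℝ (Fin d)) (EuclideanSpace ℝ (Fin d₁)))) w
      = dV φ z w := by simp [dV]
  rw [← h]
  conv_lhs => rw [← (EuclideanSpace.basisFun (Fin d₁) ℝ).sum_repr w]
  rw [map_sum]
  refine Finset.sum_congr rfl fun i _ => ?_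
  rw [map_smul]
  simp [dV]

theorem dV_eq_inner (φ : Pt d d₁ → ℝ) (z : Pt d d₁) (w : EuclideanSpace ℝ (Fin d₁)) :
    dV φ z w = inner ℝ (gradV φ z) w := by
  rw [dV_eq_sum, PiLp.inner_apply]
  simp [gradV]

theorem dV_add (φ : Pt d d₁ → ℝ) (z : Pt d d₁) (w w' : EuclideanSpace ℝ (Fin d₁)) :
    dV φ z (w + w') = dV φ z w + dV φ z w' := by
  simp only [dV_eq_inner, inner_add_right]

theorem dV_sub (φ : Pt d d₁ → ℝ) (z : Pt d d₁) (w w' : EuclideanSpace ℝ (Fin d₁)) :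
    dV φ z (w - w') = dV φ z w - dV φ z w' := by
  simp only [dV_eq_inner, inner_sub_right]

theorem dV_smul (φ : Pt d d₁ → ℝ) (z : Pt d d₁) (c : ℝ) (w : EuclideanSpace ℝ (Fin d₁)) :
    dV φ z (c • w) = c * dV φ z w := by
  simp only [dV_eq_inner, inner_smul_right]

@[simp]
theorem dV_zero (φ : Pt d d₁ → ℝ) (z : Pt d d₁) : dV φ z 0 = 0 := by
  simp only [dV_eq_inner, inner_zero_right]

/-- Smooth functions with compact support in `Ω`. -/
structure IsTest (Ω : Opens (Pt d d₁)) (φ : Pt d d₁ → ℝ) : Prop where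
  smooth : ContDiff ℝ ∞ φ
  compact : HasCompactSupport φ
  subset : tsupport φ ⊆ Ω

theorem isTest_coe {Ω : Opens (Pt d d₁)} (φ : 𝓓(Ω, ℝ)) : IsTest Ω φ :=
  ⟨φ.contDiff, φ.hasCompactSupport, φ.tsupport_subset⟩

theorem IsTest.mono {Ω Ω' : Opens (Pt d d₁)} {φ : Pt d d₁ → ℝ} (h : IsTest Ω φ) (hΩ : Ω ≤ Ω') :
    IsTest Ω' φ :=
  ⟨h.smooth, h.compact, h.subset.trans hΩ⟩

section Smooth

variable {φ ζ : Pt d d₁ → ℝ}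
  {α : EuclideanSpace ℝ (Fin d₁) → EuclideanSpace ℝ (Fin d)}

theorem differentiable_of_smooth (hφ : ContDiff ℝ ∞ φ) : Differentiable ℝ φ :=
  hφ.differentiable (by simp)

theorem continuous_fderiv_of_smooth (hφ : ContDiff ℝ ∞ φ) : Continuous (fderiv ℝ φ) :=
  hφ.continuous_fderiv (by simp)

theorem continuous_dV (hφ : ContDiff ℝ ∞ φ) (w : EuclideanSpace ℝ (Fin d₁)) :
    Continuous fun z => dV φ z w :=
  (continuous_fderiv_of_smooth hφ).clm_apply continuous_const

theorem hasCompactSupport_dV (hφ : HasCompactSupport φ) (w : EuclideanSpace ℝ (Fin d₁)) :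
    HasCompactSupport fun z => dV φ z w :=
  hφ.fderiv_apply (𝕜 := ℝ) (v := ((0, 0, w) : Pt d d₁))

theorem continuous_gradV (hφ : ContDiff ℝ ∞ φ) : Continuous (gradV φ) :=
  (PiLp.continuous_toLp 2 _).comp (continuous_pi fun _ => continuous_dV hφ _)

theorem gradV_eq_zero {z : Pt d d₁} (h : fderiv ℝ φ z = 0) : gradV φ z = 0 := by
  ext i; simp [gradV, dV, h]

theorem hasCompactSupport_gradV (hφ : HasCompactSupport φ) : HasCompactSupport (gradV φ) :=
  (hφ.fderiv (𝕜 := ℝ)).mono fun _ hz h => hz (gradV_eq_zero h)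

theorem continuous_transportDeriv (hφ : ContDiff ℝ ∞ φ) (hα : Continuous α) :
    Continuous (transportDeriv α φ) :=
  (continuous_fderiv_of_smooth hφ).clm_apply (by fun_prop)

theorem transportDeriv_eq_zero {z : Pt d d₁} (h : fderiv ℝ φ z = 0) :
    transportDeriv α φ z = 0 := by
  simp [transportDeriv, h]

theorem hasCompactSupport_transportDeriv (hφ : HasCompactSupport φ) :
    HasCompactSupport (transportDeriv α φ) :=
  (hφ.fderiv (𝕜 := ℝ)).mono fun _ hz h => hz (transportDeriv_eq_zero h)

theorem fderiv_mul_apply (hζ : ContDiff ℝ ∞ ζ) (hφ : ContDiff ℝ ∞ φ) (z e : Pt d d₁) :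
    fderiv ℝ (fun z => ζ z * φ z) z e = ζ z * fderiv ℝ φ z e + φ z * fderiv ℝ ζ z e := by
  rw [fderiv_fun_mul (differentiable_of_smooth hζ z) (differentiable_of_smooth hφ z)]
  simp

theorem dV_mul (hζ : ContDiff ℝ ∞ ζ) (hφ : ContDiff ℝ ∞ φ) (z : Pt d d₁)
    (w : EuclideanSpace ℝ (Fin d₁)) :
    dV (fun z => ζ z * φ z) z w = ζ z * dV φ z w + φ z * dV ζ z w :=
  fderiv_mul_apply hζ hφ z _

theorem transportDeriv_mul (hζ : ContDiff ℝ ∞ ζ) (hφ : ContDiff ℝ ∞ φ) (z : Pt d d₁) :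
    transportDeriv α (fun z => ζ z * φ z) z
      = ζ z * transportDeriv α φ z + φ z * transportDeriv α ζ z :=
  fderiv_mul_apply hζ hφ z _

end Smooth

section Integrability

variable {μ : Measure (Pt d d₁)} [IsFiniteMeasureOnCompacts μ]

theorem integrable_mul_of_compact {h ψ : Pt d d₁ → ℝ} (hh : MemLp h 2 μ) (hψ : Continuous ψ)
    (hψc : HasCompactSupport ψ) : Integrable (fun z => h z * ψ z) μ :=
  hh.integrable_mul (hψ.memLp_of_hasCompactSupport (p := 2) hψc)

theorem memLp_apply {w : Pt d d₁ → EuclideanSpace ℝ (Fin d₁)} {μ : Measure (Pt d d₁)}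
    (hw : MemLp w 2 μ) (i : Fin d₁) : MemLp (fun z => w z i) 2 μ :=
  (EuclideanSpace.proj (𝕜 := ℝ) i).comp_memLp' hw

theorem integrable_inner {f g : Pt d d₁ → EuclideanSpace ℝ (Fin d₁)} {μ : Measure (Pt d d₁)}
    (hf : MemLp f 2 μ) (hg : MemLp g 2 μ) : Integrable (fun z => inner ℝ (f z) (g z)) μ := by
  simp only [PiLp.inner_apply, RCLike.inner_apply, conj_trivial]
  exact integrable_finsetSum _ fun i _ => (memLp_apply hg i).integrable_mul (memLp_apply hf i)

theorem integrable_dV {φ : Pt d d₁ → ℝ} {F : Pt d d₁ → EuclideanSpace ℝ (Fin d₁)}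
    (hF : MemLp F 2 μ) (hφ : ContDiff ℝ ∞ φ) (hφc : HasCompactSupport φ) :
    Integrable (fun z => dV φ z (F z)) μ := by
  simp only [dV_eq_inner]
  exact integrable_inner ((continuous_gradV hφ).memLp_of_hasCompactSupport
    (hasCompactSupport_gradV hφc)) hF

theorem integrable_divAdd {φ g : Pt d d₁ → ℝ} {F : Pt d d₁ → EuclideanSpace ℝ (Fin d₁)}
    (hF : MemLp F 2 μ) (hg : MemLp g 2 μ) (hφ : ContDiff ℝ ∞ φ) (hφc : HasCompactSupport φ) :
    Integrable (fun z => -dV φ z (F z) + g z * φ z) μ :=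
  (integrable_dV hF hφ hφc).neg.add (integrable_mul_of_compact hg hφ.continuous hφc)

end Integrability

/-! ### Kinetic equations with right-hand side div_v F + G. -/

/-- `u ∈ L₂(Ω)` has the weak gradient `w ∈ L₂(Ω)` in `v`, and `∂_t u + α(v) · D_x u = div_v F + G`
on `Ω` with `F, G ∈ L₂(Ω)`. -/
structure Kinetic (Ω : Opens (Pt d d₁)) (α : EuclideanSpace ℝ (Fin d₁) → EuclideanSpace ℝ (Fin d))
    (u : Pt d d₁ → ℝ) (w F : Pt d d₁ → EuclideanSpace ℝ (Fin d₁)) (G : Pt d d₁ → ℝ) : Prop where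
  u_mem : MemLp u 2 (vol Ω)
  w_mem : MemLp w 2 (vol Ω)
  F_mem : MemLp F 2 (vol Ω)
  G_mem : MemLp G 2 (vol Ω)
  grad : ∀ φ, IsTest Ω φ → ∀ i : Fin d₁,
    ∫ z in Ω, u z * dV φ z (EuclideanSpace.single i 1) = -∫ z in Ω, w z i * φ z
  eq : ∀ φ, IsTest Ω φ →
    -∫ z in Ω, u z * transportDeriv α φ z = ∫ z in Ω, (-dV φ z (F z) + G z * φ z)

section Kinetic

variable {Ω : Opens (Pt d d₁)} {α : EuclideanSpace ℝ (Fin d₁) → EuclideanSpace ℝ (Fin d)}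
  {u u' G G' : Pt d d₁ → ℝ} {w w' F F' : Pt d d₁ → EuclideanSpace ℝ (Fin d₁)}

theorem Kinetic.isGradV (h : Kinetic Ω α u w F G) : IsGradV Ω u w :=
  ⟨h.w_mem, fun i φ => h.grad φ (isTest_coe φ) i⟩

theorem Kinetic.memS2 (h : Kinetic Ω α u w F G) : MemS2 Ω α u :=
  ⟨h.u_mem, ⟨w, h.isGradV⟩, F, G, h.F_mem, h.G_mem, fun φ => h.eq φ (isTest_coe φ)⟩

theorem MemS2.exists_kinetic (h : MemS2 Ω α u) : ∃ w F G, Kinetic Ω α u w F G := by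
  obtain ⟨hu, ⟨w, hw, hw'⟩, F, G, hF, hG, h⟩ := h
  refine ⟨w, F, G, hu, hw, hF, hG, fun φ hφ i => ?_, fun φ hφ => ?_⟩
  · exact hw' i ⟨φ, hφ.smooth, hφ.compact, hφ.subset⟩
  · exact h ⟨φ, hφ.smooth, hφ.compact, hφ.subset⟩

theorem Kinetic.congr (h : Kinetic Ω α u w F G) (hu : u =ᵐ[vol Ω] u') (hw : w =ᵐ[vol Ω] w')
    (hF : F =ᵐ[vol Ω] F') (hG : G =ᵐ[vol Ω] G') : Kinetic Ω α u' w' F' G' := by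
  refine ⟨h.u_mem.ae_eq hu, h.w_mem.ae_eq hw, h.F_mem.ae_eq hF, h.G_mem.ae_eq hG,
    fun φ hφ i => ?_, fun φ hφ => ?_⟩
  · rw [← integral_congr_ae (f := fun z => u z * dV φ z (EuclideanSpace.single i 1))
      (by filter_upwards [hu] with z hz; rw [hz]), h.grad φ hφ i,
      integral_congr_ae (by filter_upwards [hw] with z hz; rw [hz])]
  · rw [← integral_congr_ae (f := fun z => u z * transportDeriv α φ z)
      (by filter_upwards [hu] with z hz; rw [hz]), h.eq φ hφ,
      integral_congr_ae (by filter_upwards [hF, hG] with z hz hz'; rw [hz, hz'])]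

theorem Kinetic.sub (hα : Continuous α) (h : Kinetic Ω α u w F G) (h' : Kinetic Ω α u' w' F' G') :
    Kinetic Ω α (fun z => u z - u' z) (fun z => w z - w' z) (fun z => F z - F' z)
      (fun z => G z - G' z) := by
  refine ⟨h.u_mem.sub h'.u_mem, h.w_mem.sub h'.w_mem, h.F_mem.sub h'.F_mem, h.G_mem.sub h'.G_mem,
    fun φ hφ i => ?_, fun φ hφ => ?_⟩
  · have hc := continuous_dV hφ.smooth (EuclideanSpace.single i (1 : ℝ))
    have hs := hasCompactSupport_dV hφ.compact (EuclideanSpace.single i (1 : ℝ))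
    simp only [sub_mul, PiLp.sub_apply]
    rw [integral_sub (integrable_mul_of_compact h.u_mem hc hs)
      (integrable_mul_of_compact h'.u_mem hc hs), integral_sub
      (integrable_mul_of_compact (memLp_apply h.w_mem i) hφ.smooth.continuous hφ.compact)
      (integrable_mul_of_compact (memLp_apply h'.w_mem i) hφ.smooth.continuous hφ.compact),
      h.grad φ hφ i, h'.grad φ hφ i]
    ring
  · have hc := continuous_transportDeriv hφ.smooth hα
    have hs := hasCompactSupport_transportDeriv (α := α) hφ.compact
    have e : ∀ z, -dV φ z (F z - F' z) + (G z - G' z) * φ z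
        = (-dV φ z (F z) + G z * φ z) - (-dV φ z (F' z) + G' z * φ z) := fun z => by
      rw [dV_sub]; ring
    simp only [e]
    simp only [sub_mul (u _)]
    rw [integral_sub (integrable_mul_of_compact h.u_mem hc hs)
      (integrable_mul_of_compact h'.u_mem hc hs), integral_sub
      (integrable_divAdd h.F_mem h.G_mem hφ.smooth hφ.compact)
      (integrable_divAdd h'.F_mem h'.G_mem hφ.smooth hφ.compact), ← h.eq φ hφ, ← h'.eq φ hφ]
    ring

theorem setIntegral_of_tsupport_subset {Ω Ω' : Opens (Pt d d₁)} (hΩ : Ω' ≤ Ω) {φ : Pt d d₁ → ℝ}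
    (hφ : tsupport φ ⊆ Ω') {f : Pt d d₁ → ℝ} (hf : ∀ z ∉ tsupport φ, f z = 0) :
    ∫ z in Ω', f z = ∫ z in Ω, f z := by
  rw [setIntegral_eq_integral_of_forall_compl_eq_zero fun z hz => hf z fun h => hz (hφ h),
    setIntegral_eq_integral_of_forall_compl_eq_zero fun z hz => hf z fun h => hz (hΩ (hφ h))]

theorem fderiv_eq_zero_of_notMem_tsupport {φ : Pt d d₁ → ℝ} {z : Pt d d₁} (hz : z ∉ tsupport φ) :
    fderiv ℝ φ z = 0 := by
  by_contra h
  exact hz (support_fderiv_subset ℝ h)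

theorem Kinetic.mono (h : Kinetic Ω α u w F G) {Ω' : Opens (Pt d d₁)} (hΩ : Ω' ≤ Ω) :
    Kinetic Ω' α u w F G := by
  have hm : vol Ω' ≤ vol Ω := Measure.restrict_mono hΩ le_rfl
  refine ⟨h.u_mem.mono_measure hm, h.w_mem.mono_measure hm, h.F_mem.mono_measure hm,
    h.G_mem.mono_measure hm, fun φ hφ i => ?_, fun φ hφ => ?_⟩
  · have := h.grad φ (hφ.mono hΩ) i
    rw [← setIntegral_of_tsupport_subset hΩ hφ.subset,
      ← setIntegral_of_tsupport_subset hΩ hφ.subset] at this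
    · exact this
    · intro z hz; simp [image_eq_zero_of_notMem_tsupport hz]
    · intro z hz; simp [dV, fderiv_eq_zero_of_notMem_tsupport hz]
  · have := h.eq φ (hφ.mono hΩ)
    rw [← setIntegral_of_tsupport_subset hΩ hφ.subset,
      ← setIntegral_of_tsupport_subset hΩ hφ.subset] at this
    · exact this
    · intro z hz
      simp [dV, image_eq_zero_of_notMem_tsupport hz, fderiv_eq_zero_of_notMem_tsupport hz]
    · intro z hz; simp [transportDeriv, fderiv_eq_zero_of_notMem_tsupport hz]

/-- A function in `L₂(Ω)` which is orthogonal to all test functions vanishes. -/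
theorem ae_eq_zero_of_forall_isTest {f : Pt d d₁ → ℝ} (hf : MemLp f 2 (vol Ω))
    (h : ∀ φ, IsTest Ω φ → ∫ z in Ω, f z * φ z = 0) : f =ᵐ[vol Ω] 0 := by
  have hl : LocallyIntegrableOn f Ω volume := by
    refine locallyIntegrableOn_of_locallyIntegrable_restrict ?_
    exact hf.locallyIntegrable (by norm_num)
  have := Ω.isOpen.ae_eq_zero_of_integral_contDiff_smul_eq_zero hl fun φ h1 h2 h3 => by
    rw [← h φ ⟨h1, h2, h3⟩, setIntegral_eq_integral_of_forall_compl_eq_zero]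
    · simp [mul_comm]
    · intro z hz
      rw [image_eq_zero_of_notMem_tsupport fun h => hz (h3 h), mul_zero]
  exact (ae_restrict_iff' Ω.isOpen.measurableSet).2 this

theorem IsGradV.ae_unique (hw : IsGradV Ω u w) (hw' : IsGradV Ω u w') : w =ᵐ[vol Ω] w' := by
  have : ∀ i, (fun z => w z i - w' z i) =ᵐ[vol Ω] 0 := fun i => by
    refine ae_eq_zero_of_forall_isTest ((memLp_apply hw.1 i).sub (memLp_apply hw'.1 i))
      fun φ hφ => ?_
    simp only [sub_mul]
    rw [integral_sub
      (integrable_mul_of_compact (memLp_apply hw.1 i) hφ.smooth.continuous hφ.compact)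
      (integrable_mul_of_compact (memLp_apply hw'.1 i) hφ.smooth.continuous hφ.compact)]
    have h1 := hw.2 i ⟨φ, hφ.smooth, hφ.compact, hφ.subset⟩
    have h2 := hw'.2 i ⟨φ, hφ.smooth, hφ.compact, hφ.subset⟩
    simp only [TestFunction.coe_mk] at h1 h2
    linarith
  filter_upwards [ae_all_iff.2 this] with z hz
  ext i
  exact sub_eq_zero.1 (hz i)

/-- The product of a solution with a smooth function `ζ`, tested against `φ`. -/
theorem Kinetic.mul_test (hα : Continuous α) (h : Kinetic Ω α u w F G) {ζ φ : Pt d d₁ → ℝ}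
    (hζ : ContDiff ℝ ∞ ζ) (hφ : ContDiff ℝ ∞ φ) (hφc : HasCompactSupport φ)
    (ht : IsTest Ω fun z => ζ z * φ z) :
    (∀ i, ∫ z in Ω, (ζ z * u z) * dV φ z (EuclideanSpace.single i 1)
      = -∫ z in Ω, (ζ z • w z + u z • gradV ζ z) i * φ z) ∧
    -∫ z in Ω, (ζ z * u z) * transportDeriv α φ z
      = ∫ z in Ω, (-dV φ z (ζ z • F z)
        + (ζ z * G z - dV ζ z (F z) + u z * transportDeriv α ζ z) * φ z) := by
  constructor
  · intro i
    have h1 := h.grad _ ht i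
    set e : EuclideanSpace ℝ (Fin d₁) := EuclideanSpace.single i 1
    have I1 : Integrable (fun z => u z * dV (fun z => ζ z * φ z) z e) (vol Ω) :=
      integrable_mul_of_compact h.u_mem (continuous_dV ht.smooth e)
        (hasCompactSupport_dV ht.compact e)
    have I2 : Integrable (fun z => u z * (dV ζ z e * φ z)) (vol Ω) :=
      integrable_mul_of_compact h.u_mem ((continuous_dV hζ e).mul hφ.continuous) hφc.mul_left
    have I3 : Integrable (fun z => w z i * (ζ z * φ z)) (vol Ω) :=
      integrable_mul_of_compact (memLp_apply h.w_mem i) ht.smooth.continuous ht.compact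
    have e1 : ∀ z, (ζ z * u z) * dV φ z e
        = u z * dV (fun z => ζ z * φ z) z e - u z * (dV ζ z e * φ z) := fun z => by
      rw [dV_mul hζ hφ]; ring
    have e2 : ∀ z, (ζ z • w z + u z • gradV ζ z) i * φ z
        = w z i * (ζ z * φ z) + u z * (dV ζ z e * φ z) := fun z => by
      simp [gradV, e]; ring
    simp only [e1, e2]
    rw [integral_sub I1 I2, integral_add I3 I2, h1]
    ring
  · have h1 := h.eq _ ht
    have I1 : Integrable (fun z => u z * transportDeriv α (fun z => ζ z * φ z) z) (vol Ω) :=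
      integrable_mul_of_compact h.u_mem (continuous_transportDeriv ht.smooth hα)
        (hasCompactSupport_transportDeriv ht.compact)
    have I2 : Integrable (fun z => u z * (transportDeriv α ζ z * φ z)) (vol Ω) :=
      integrable_mul_of_compact h.u_mem
        ((continuous_transportDeriv hζ hα).mul hφ.continuous) hφc.mul_left
    have I3 := integrable_divAdd h.F_mem h.G_mem ht.smooth ht.compact
    have e1 : ∀ z, (ζ z * u z) * transportDeriv α φ z
        = u z * transportDeriv α (fun z => ζ z * φ z) z - u z * (transportDeriv α ζ z * φ z) :=
      fun z => by rw [transportDeriv_mul hζ hφ]; ring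
    have e2 : ∀ z, -dV φ z (ζ z • F z)
          + (ζ z * G z - dV ζ z (F z) + u z * transportDeriv α ζ z) * φ z
        = (-dV (fun z => ζ z * φ z) z (F z) + G z * (ζ z * φ z))
          + u z * (transportDeriv α ζ z * φ z) := fun z => by
      rw [dV_mul hζ hφ, dV_smul]; ring
    simp only [e1, e2]
    rw [integral_sub I1 I2, integral_add I3 I2, ← h1]
    ring

end Kinetic

/-! ### Mollifiers and the commutator with transport. -/

instance isNegInvariant_volume : (volume : Measure (Pt d d₁)).IsNegInvariant :=
  Measure.IsAddHaarMeasure.isNegInvariant_of_regular _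

/-- A smooth even probability density `ρ` supported in the ball of radius `ε`, such that the
commutator of the convolution with `ρ` and of `α(v) · D_x` is of size `ε`. -/
structure IsMollifier (α : EuclideanSpace ℝ (Fin d₁) → EuclideanSpace ℝ (Fin d)) (ε : ℝ)
    (ρ : Pt d d₁ → ℝ) : Prop where
  smooth : ContDiff ℝ ∞ ρ
  compact : HasCompactSupport ρ
  nonneg : ∀ z, 0 ≤ ρ z
  integral_eq : ∫ z, ρ z = 1
  even : ∀ z, ρ (-z) = ρ z
  support_subset : ∀ z, ρ z ≠ 0 → ‖z‖ < ε
  commutator : ∀ v, ∫⁻ s, ‖fderiv ℝ ρ s (0, α v - α (v - s.2.2), 0)‖ₑ ≤ ENNReal.ofReal ε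

theorem exists_radius (K : ℝ) {θ ε : ℝ} (hθ : 0 < θ) (hε : 0 < ε) :
    ∃ h, 0 < h ∧ h ≤ ε ∧ K * h ^ θ ≤ ε := by
  have h1 : Tendsto (fun h : ℝ => K * h ^ θ) (𝓝[>] 0) (𝓝 0) := by
    have := (Real.continuousAt_rpow_const 0 θ (Or.inr hθ.le)).tendsto.const_mul K
    rw [Real.zero_rpow hθ.ne', mul_zero] at this
    exact this.mono_left nhdsWithin_le_nhds
  have h2 : ∀ᶠ h : ℝ in 𝓝[>] 0, K * h ^ θ ≤ ε :=
    (h1.eventually (gt_mem_nhds hε)).mono fun _ h => h.le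
  have h3 : ∀ᶠ h : ℝ in 𝓝[>] 0, h ≤ ε :=
    mem_nhdsWithin_of_mem_nhds (Iic_mem_nhds hε)
  obtain ⟨h, h4, h5, h6⟩ := (h2.and (h3.and self_mem_nhdsWithin)).exists
  exact ⟨h, h6, h5, h4⟩

/-- A product p(t) q(x) m(v) of bumps of radii ε, ε and h works. The x-derivative falls on q alone
and costs C = ∫ |Dq|, fixed once ε is. Where m ≠ 0 the increment of α is at most K h^θ, and h is
chosen last so that C K h^θ ≤ ε. -/
theorem exists_isMollifier {α : EuclideanSpace ℝ (Fin d₁) → EuclideanSpace ℝ (Fin d)} {θ K : ℝ≥0}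
    (hθ : 0 < θ) (hα : HolderWith K θ α) {ε : ℝ} (hε : 0 < ε) : ∃ ρ, IsMollifier α ε ρ := by
  let bp : ContDiffBump (0 : ℝ) := ⟨ε / 2, ε, half_pos hε, half_lt_self hε⟩
  let bq : ContDiffBump (0 : EuclideanSpace ℝ (Fin d)) := ⟨ε / 2, ε, half_pos hε, half_lt_self hε⟩
  set p : ℝ → ℝ := bp.normed volume with hp
  set q : EuclideanSpace ℝ (Fin d) → ℝ := bq.normed volume with hq
  have hqs : ContDiff ℝ ∞ q := bq.contDiff_normed
  have hqd : Differentiable ℝ q := hqs.differentiable (by simp)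
  have hqi : Integrable (fun x => ‖fderiv ℝ q x‖) :=
    ((hqs.continuous_fderiv (by simp)).integrable_of_hasCompactSupport
      (bq.hasCompactSupport_normed.fderiv (𝕜 := ℝ))).norm
  set C : ℝ := ∫ x, ‖fderiv ℝ q x‖ with hC
  have hC0 : 0 ≤ C := integral_nonneg fun x => norm_nonneg _
  obtain ⟨h, h0, hhε, hh⟩ := exists_radius (C * K) (NNReal.coe_pos.2 hθ) hε
  let bm : ContDiffBump (0 : EuclideanSpace ℝ (Fin d₁)) := ⟨h / 2, h, half_pos h0, half_lt_self h0⟩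
  set m : EuclideanSpace ℝ (Fin d₁) → ℝ := bm.normed volume with hm
  have hps : ContDiff ℝ ∞ p := bp.contDiff_normed
  have hms : ContDiff ℝ ∞ m := bm.contDiff_normed
  have hp0 : ∀ t, 0 ≤ p t := bp.nonneg_normed
  have hq0 : ∀ x, 0 ≤ q x := bq.nonneg_normed
  have hm0 : ∀ v, 0 ≤ m v := bm.nonneg_normed
  have hp' : ∀ t, p t ≠ 0 → ‖t‖ < ε := fun t ht => by
    have : t ∈ Function.support (bp.normed volume) := ht
    rw [bp.support_normed_eq] at this
    simpa using this
  have hq' : ∀ t, q t ≠ 0 → ‖t‖ < ε := fun t ht => by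
    have : t ∈ Function.support (bq.normed volume) := ht
    rw [bq.support_normed_eq] at this
    simpa using this
  have hm' : ∀ t, m t ≠ 0 → ‖t‖ < h := fun t ht => by
    have : t ∈ Function.support (bm.normed volume) := ht
    rw [bm.support_normed_eq] at this
    simpa using this
  refine ⟨fun z => p z.1 * (q z.2.1 * m z.2.2), ?_, ?_, ?_, ?_, ?_, ?_, ?_⟩
  · exact (hps.comp contDiff_fst).mul ((hqs.comp (contDiff_fst.comp contDiff_snd)).mul
      (hms.comp (contDiff_snd.comp contDiff_snd)))
  · refine HasCompactSupport.intro (isCompact_closedBall (0 : Pt d d₁) ε) fun z hz => ?_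
    by_contra hne
    simp only [mul_eq_zero, not_or] at hne
    refine hz ?_
    simp only [mem_closedBall_zero_iff, Prod.norm_def, max_le_iff]
    exact ⟨(hp' _ hne.1).le, (hq' _ hne.2.1).le, (hm' _ hne.2.2).le.trans hhε⟩
  · intro z
    exact mul_nonneg (hp0 _) (mul_nonneg (hq0 _) (hm0 _))
  · have e1 := integral_prod_mul (μ := (volume : Measure ℝ)) (ν := (volume : Measure
      (EuclideanSpace ℝ (Fin d) × EuclideanSpace ℝ (Fin d₁)))) p (fun y => q y.1 * m y.2)
    have e2 := integral_prod_mul (μ := (volume : Measure (EuclideanSpace ℝ (Fin d))))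
      (ν := (volume : Measure (EuclideanSpace ℝ (Fin d₁)))) q m
    rw [← Measure.volume_eq_prod] at e1 e2
    rw [e1, e2, hp, hq, hm, bp.integral_normed, bq.integral_normed, bm.integral_normed]
    norm_num
  · intro z
    simp [hp, hq, hm, ContDiffBump.normed_neg]
  · intro z hne
    simp only [ne_eq, mul_eq_zero, not_or] at hne
    simp only [Prod.norm_def, max_lt_iff]
    exact ⟨hp' _ hne.1, hq' _ hne.2.1, (hm' _ hne.2.2).trans_le hhε⟩
  · intro v
    have hd : ∀ (s : Pt d d₁) (y : EuclideanSpace ℝ (Fin d)),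
        fderiv ℝ (fun z : Pt d d₁ => p z.1 * (q z.2.1 * m z.2.2)) s (0, y, 0)
          = p s.1 * (fderiv ℝ q s.2.1 y * m s.2.2) := by
      intro s y
      have d1 : HasFDerivAt (fun z : Pt d d₁ => p z.1) _ s :=
        ((hps.differentiable (by simp)) s.1).hasFDerivAt.comp s hasFDerivAt_fst
      have d2 : HasFDerivAt (fun z : Pt d d₁ => q z.2.1) _ s :=
        (hqd s.2.1).hasFDerivAt.comp (f := fun z : Pt d d₁ => z.2.1) s
          (hasFDerivAt_fst.comp s hasFDerivAt_snd)
      have d3 : HasFDerivAt (fun z : Pt d d₁ => m z.2.2) _ s :=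
        ((hms.differentiable (by simp)) s.2.2).hasFDerivAt.comp (f := fun z : Pt d d₁ => z.2.2) s
          (hasFDerivAt_snd.comp s hasFDerivAt_snd)
      have d4 : HasFDerivAt (fun z : Pt d d₁ => p z.1 * (q z.2.1 * m z.2.2)) _ s :=
        d1.mul (d2.mul d3)
      rw [d4.fderiv]
      simp [mul_comm]
    have e1 := integral_prod_mul (μ := (volume : Measure ℝ)) (ν := (volume : Measure
      (EuclideanSpace ℝ (Fin d) × EuclideanSpace ℝ (Fin d₁)))) p
        (fun y => ‖fderiv ℝ q y.1‖ * (m y.2 * (K * h ^ (θ : ℝ))))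
    have e2 := integral_prod_mul (μ := (volume : Measure (EuclideanSpace ℝ (Fin d))))
      (ν := (volume : Measure (EuclideanSpace ℝ (Fin d₁)))) (fun x => ‖fderiv ℝ q x‖)
        (fun v => m v * (K * h ^ (θ : ℝ)))
    have i1 : Integrable (fun z : Pt d d₁ =>
        p z.1 * (‖fderiv ℝ q z.2.1‖ * (m z.2.2 * (K * h ^ (θ : ℝ))))) := by
      refine Integrable.mul_prod (μ := (volume : Measure ℝ)) (ν := (volume : Measure
        (EuclideanSpace ℝ (Fin d) × EuclideanSpace ℝ (Fin d₁)))) bp.integrable_normed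
        (g := fun y => ‖fderiv ℝ q y.1‖ * (m y.2 * (K * h ^ (θ : ℝ)))) ?_
      exact Integrable.mul_prod (μ := (volume : Measure (EuclideanSpace ℝ (Fin d))))
        (ν := (volume : Measure (EuclideanSpace ℝ (Fin d₁)))) hqi (bm.integrable_normed.mul_const _)
    rw [← Measure.volume_eq_prod] at e1 e2
    calc ∫⁻ s : Pt d d₁, ‖fderiv ℝ (fun z : Pt d d₁ => p z.1 * (q z.2.1 * m z.2.2)) s
            (0, α v - α (v - s.2.2), 0)‖ₑ
        ≤ ∫⁻ z : Pt d d₁, ENNReal.ofReal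
            (p z.1 * (‖fderiv ℝ q z.2.1‖ * (m z.2.2 * (K * h ^ (θ : ℝ))))) := by
          refine lintegral_mono fun s => ?_
          rw [hd, ← ofReal_norm]
          refine ENNReal.ofReal_le_ofReal ?_
          rw [norm_mul, norm_mul, Real.norm_of_nonneg (hp0 _), Real.norm_of_nonneg (hm0 _)]
          refine mul_le_mul_of_nonneg_left ?_ (hp0 _)
          by_cases hs : m s.2.2 = 0
          · simp [hs]
          have h1 : ‖α v - α (v - s.2.2)‖ ≤ K * h ^ (θ : ℝ) := by
            have := hα.dist_le v (v - s.2.2)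
            rw [dist_eq_norm, dist_eq_norm, sub_sub_cancel] at this
            refine this.trans (mul_le_mul_of_nonneg_left ?_ K.2)
            exact Real.rpow_le_rpow (norm_nonneg _) (hm' _ hs).le θ.2
          calc ‖fderiv ℝ q s.2.1 (α v - α (v - s.2.2))‖ * m s.2.2
              ≤ (‖fderiv ℝ q s.2.1‖ * (K * h ^ (θ : ℝ))) * m s.2.2 := by
                refine mul_le_mul_of_nonneg_right ?_ (hm0 _)
                exact (ContinuousLinearMap.le_opNorm _ _).trans
                  (mul_le_mul_of_nonneg_left h1 (norm_nonneg _))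
            _ = _ := by ring
      _ = ENNReal.ofReal (C * K * h ^ (θ : ℝ)) := by
          rw [← ofReal_integral_eq_lintegral_ofReal i1]
          · rw [e1, e2, integral_mul_const, hp, hm, bp.integral_normed, bm.integral_normed]
            congr 1
            ring
          · refine Eventually.of_forall fun z => ?_
            exact mul_nonneg (hp0 _) (mul_nonneg (norm_nonneg _)
              (mul_nonneg (hm0 _) (by positivity)))
      _ ≤ _ := ENNReal.ofReal_le_ofReal hh

theorem integrable_double {f g : Pt d d₁ → ℝ} (hf : Integrable f) (hg : Integrable g)
    {κ : Pt d d₁ × Pt d d₁ → ℝ} (hκ : Continuous κ) {M : ℝ}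
    (hM : ∀ z z', |f z * g z' * κ (z, z')| ≤ M * (|f z| * |g z'|)) :
    Integrable (fun p : Pt d d₁ × Pt d d₁ => f p.1 * g p.2 * κ p) (volume.prod volume) := by
  have h := hf.mul_prod (ν := (volume : Measure (Pt d d₁))) hg
  refine Integrable.mono' (h.norm.const_mul M)
    (h.aestronglyMeasurable.mul hκ.aestronglyMeasurable) (Eventually.of_forall fun p => ?_)
  simpa using hM p.1 p.2

/-- Continuity of translations in `L₂`, in a weak form. -/
theorem tendsto_integral_mul_translate {f g : Pt d d₁ → ℝ} (hf : MemLp f 2 volume)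
    (hg : MemLp g 2 volume) :
    Tendsto (fun s => ∫ z, f z * g (z + s)) (𝓝 0) (𝓝 (∫ z, f z * g z)) := by
  have hτ : ∀ s : Pt d d₁, MeasurePreserving (fun z => z + s) (volume : Measure (Pt d d₁)) volume :=
    fun s => measurePreserving_add_right volume s
  let T : Pt d d₁ → C(Pt d d₁, Pt d d₁) :=
    fun s => ⟨fun z => z + s, continuous_id.add continuous_const⟩
  have hT : Continuous T := ContinuousMap.continuous_of_continuous_uncurry _
    (by simp only [T]; exact continuous_snd.add continuous_fst)
  have h1 := (continuous_const (y := hg.toLp g)).compMeasurePreservingLp hT hτ (by simp)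
  have h2 : ∀ s, inner ℝ (hf.toLp f) (Lp.compMeasurePreserving (T s) (hτ s) (hg.toLp g))
      = ∫ z, f z * g (z + s) := fun s => by
    rw [L2.inner_def]
    refine integral_congr_ae ?_
    have := Lp.coeFn_compMeasurePreserving (hg.toLp g) (hτ s)
    filter_upwards [hf.coeFn_toLp, this,
      (hτ s).quasiMeasurePreserving.ae_eq_comp hg.coeFn_toLp] with z e1 e2 e3
    rw [e1]
    erw [e2]
    rw [e3]
    simp [mul_comm]
  have h3 := ((continuous_const (y := hf.toLp f)).inner (𝕜 := ℝ) h1).tendsto 0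
  simp only [h2, add_zero] at h3
  exact h3

/-- By Fubini and evenness, pairing f with the mollified g averages s ↦ ∫ f(z) g(z + s) against the
probability density ρ, which lives near s = 0. Continuity of translations then suffices. The bound
is uniform over ρ because ρ is picked only after ε. -/
theorem abs_integral_mollify_sub_le {α : EuclideanSpace ℝ (Fin d₁) → EuclideanSpace ℝ (Fin d)}
    {f g : Pt d d₁ → ℝ} (hf : MemLp f 2 volume) (hg : MemLp g 2 volume) (hf1 : Integrable f)
    (hg1 : Integrable g) {η : ℝ} (hη : 0 < η) :
    ∀ᶠ ε in 𝓝[>] (0 : ℝ), ∀ ρ, IsMollifier α ε ρ →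
      |(∫ z, f z * ∫ z', g z' * ρ (z - z')) - ∫ z, f z * g z| ≤ η := by
  have hc := tendsto_integral_mul_translate hf hg
  obtain ⟨r, hr, hball⟩ := Metric.tendsto_nhds_nhds.1 hc η hη
  filter_upwards [Ioo_mem_nhdsGT hr] with ε hε ρ hρ
  obtain ⟨B, hB⟩ := hρ.smooth.continuous.bounded_above_of_compact_support hρ.compact
  have hint : Integrable (fun p : Pt d d₁ × Pt d d₁ => f p.1 * g p.2 * ρ (p.1 - p.2))
      (volume.prod volume) := by
    refine integrable_double hf1 hg1 (κ := fun p => ρ (p.1 - p.2))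
      (hρ.smooth.continuous.comp (by fun_prop)) (M := B) fun z z' => ?_
    rw [abs_mul, abs_mul, mul_comm]
    exact mul_le_mul_of_nonneg_right (hB _) (by positivity)
  -- The shear (z, s) ↦ (z, z + s) preserves the measure and turns ρ(z - z') into ρ(-s) = ρ(s).
  have hint2 : Integrable (fun p : Pt d d₁ × Pt d d₁ => f p.1 * g (p.1 + p.2) * ρ p.2)
      (volume.prod volume) := by
    have := (measurePreserving_prod_add (volume : Measure (Pt d d₁))
      (volume : Measure (Pt d d₁))).integrable_comp_of_integrable hint
    refine this.congr (Eventually.of_forall fun p => ?_)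
    simp [hρ.even]
  have e1 : ∀ z, f z * ∫ z', g z' * ρ (z - z') = ∫ s, f z * g (z + s) * ρ s := fun z => by
    rw [← integral_add_left_eq_self (fun z' => g z' * ρ (z - z')) z, ← integral_const_mul]
    congr 1; ext s
    rw [sub_add_cancel_left, hρ.even, mul_assoc]
  have e2 : ∫ z, f z * ∫ z', g z' * ρ (z - z') = ∫ s, ρ s * ∫ z, f z * g (z + s) := by
    simp only [e1]
    rw [integral_integral_swap hint2]
    simp only [integral_mul_const, mul_comm (ρ _)]
  have hint3 : Integrable (fun s => ρ s * ∫ z, f z * g (z + s)) := by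
    refine hint2.integral_prod_right.congr (Eventually.of_forall fun s => ?_)
    simp only [integral_mul_const, mul_comm (ρ _)]
  have hρi : Integrable ρ := hρ.smooth.continuous.integrable_of_hasCompactSupport hρ.compact
  have e3 : ∫ z, f z * g z = ∫ s, ρ s * ∫ z, f z * g z := by
    rw [integral_mul_const, hρ.integral_eq, one_mul]
  rw [e2, e3, ← integral_sub hint3 (hρi.mul_const _)]
  calc |∫ s, (ρ s * ∫ z, f z * g (z + s)) - ρ s * ∫ z, f z * g z|
      ≤ ∫ s, ρ s * η := by
        rw [← Real.norm_eq_abs]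
        refine norm_integral_le_of_norm_le (hρi.mul_const η) (Eventually.of_forall fun s => ?_)
        rw [← mul_sub, norm_mul, Real.norm_of_nonneg (hρ.nonneg s)]
        by_cases hs : ρ s = 0
        · simp [hs]
        refine mul_le_mul_of_nonneg_left ?_ (hρ.nonneg s)
        have := hball (x := s) (by
          rw [dist_zero_right]; exact (hρ.support_subset s hs).trans hε.2)
        rw [Real.dist_eq] at this
        exact this.le
    _ = η := by rw [integral_mul_const, hρ.integral_eq, one_mul]

theorem fderiv_neg_of_even {ρ : Pt d d₁ → ℝ} (h : ∀ z, ρ (-z) = ρ z) (z e : Pt d d₁) :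
    fderiv ℝ ρ (-z) e = -fderiv ℝ ρ z e := by
  have h1 : fderiv ℝ (fun z => ρ (-z)) z = _ :=
    ((ContinuousLinearEquiv.neg ℝ (M := Pt d d₁)).comp_right_fderiv (f := ρ) (x := z))
  simp only [h] at h1
  rw [h1]
  simp

theorem integrable_of_memLp_of_eq_zero {u : Pt d d₁ → ℝ} (hu : MemLp u 2 volume)
    {Q : Set (Pt d d₁)} (hQ : IsCompact Q) (h : ∀ z ∉ Q, u z = 0) : Integrable u := by
  have : IsFiniteMeasure ((volume : Measure (Pt d d₁)).restrict Q) :=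
    ⟨by simpa using hQ.measure_lt_top⟩
  have h1 : IntegrableOn u Q := (hu.restrict Q).integrable (by norm_num)
  exact (integrableOn_iff_integrable_of_support_subset fun z hz => by
    by_contra h'; exact hz (h z h')).1 h1

/-- The commutator estimate. -/
theorem abs_integral_mul_transport_le
    {α : EuclideanSpace ℝ (Fin d₁) → EuclideanSpace ℝ (Fin d)} (hα : Continuous α)
    {u : Pt d d₁ → ℝ} (hu : MemLp u 2 volume) {Q : Set (Pt d d₁)} (hQ : IsCompact Q)
    (huQ : ∀ z ∉ Q, u z = 0) {ε : ℝ} {ρ : Pt d d₁ → ℝ} (hρ : IsMollifier α ε ρ) (hε : 0 ≤ ε) :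
    |∫ z, u z * ∫ z', u z' * fderiv ℝ ρ (z - z') (1, α z.2.2, 0)| ≤ ε * ∫ z, u z ^ 2 := by
  have hu1 := integrable_of_memLp_of_eq_zero hu hQ huQ
  have hcD := continuous_fderiv_of_smooth hρ.smooth
  obtain ⟨B, hB⟩ := hcD.bounded_above_of_compact_support (hρ.compact.fderiv (𝕜 := ℝ))
  have hcv : Continuous fun z : Pt d d₁ => ((1, α z.2.2, 0) : Pt d d₁) := by fun_prop
  obtain ⟨A, hA⟩ := hQ.exists_bound_of_continuousOn hcv.continuousOn
  let κ : Pt d d₁ × Pt d d₁ → ℝ := fun p => fderiv ℝ ρ (p.1 - p.2) (1, α p.1.2.2, 0)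
  have hκ : Continuous κ :=
    (hcD.comp (continuous_fst.sub continuous_snd)).clm_apply (hcv.comp continuous_fst)
  have hint : Integrable (fun p : Pt d d₁ × Pt d d₁ => u p.1 * u p.2 * κ p)
      (volume.prod volume) := by
    refine integrable_double hu1 hu1 hκ (M := B * A) fun z z' => ?_
    by_cases hz : z ∈ Q
    · rw [abs_mul, abs_mul, mul_comm]
      refine mul_le_mul_of_nonneg_right ?_ (by positivity)
      refine ((fderiv ℝ ρ (z - z')).le_opNorm _).trans ?_
      exact mul_le_mul (hB _) (hA z hz) (norm_nonneg _) ((norm_nonneg _).trans (hB 0))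
    · simp [huQ z hz]
  set I := ∫ z, u z * ∫ z', u z' * fderiv ℝ ρ (z - z') (1, α z.2.2, 0) with hI
  have e1 : I = ∫ z, ∫ z', u z * u z' * κ (z, z') := by
    simp only [hI, κ, ← integral_const_mul, mul_assoc]
  have e2 : I = ∫ z, ∫ z', u z' * u z * κ (z', z) := by
    rw [e1, integral_integral_swap hint]
  -- The symmetrized kernel. As Dρ is odd, κ(z, z') + κ(z', z) keeps only α(v) - α(v'), and the time
  -- components cancel.
  let m : Pt d d₁ → Pt d d₁ → ℝ := fun z z' =>
    fderiv ℝ ρ (z - z') (0, α z.2.2 - α z'.2.2, 0)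
  have e3 : 2 * I = ∫ z, ∫ z', u z * u z' * m z z' := by
    have hs := hint.swap
    have h1 : 2 * I = ∫ z, (∫ z', u z * u z' * κ (z, z')) + ∫ z', u z' * u z * κ (z', z) := by
      rw [integral_add (f := fun z => ∫ z', u z * u z' * κ (z, z'))
        (g := fun z => ∫ z', u z' * u z * κ (z', z)) hint.integral_prod_left hs.integral_prod_left,
        ← e1, ← e2, two_mul]
    rw [h1]
    refine integral_congr_ae ?_
    filter_upwards [hint.prod_right_ae, hs.prod_right_ae] with z h2 h3
    have h3' : Integrable (fun z' => u z' * u z * κ (z', z)) := h3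
    rw [← integral_add h2 h3']
    refine integral_congr_ae (Eventually.of_forall fun z' => ?_)
    have h4 : κ (z', z) = -fderiv ℝ ρ (z - z') (1, α z'.2.2, 0) := by
      simp only [κ]
      rw [← neg_sub z z', fderiv_neg_of_even hρ.even]
    have h5 : m z z' = κ (z, z') + κ (z', z) := by
      rw [h4]
      simp only [m, κ]
      rw [← sub_eq_add_neg, ← map_sub]
      simp
    simp only [h5]
    ring
  -- Schur's test: m is symmetric, and each of its rows has L₁ norm at most ε.
  have hm1 : ∀ z, ∫⁻ z', ‖m z z'‖ₑ ≤ ENNReal.ofReal ε := fun z => by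
    refine le_trans (le_of_eq ?_) (hρ.commutator z.2.2)
    rw [← lintegral_sub_left_eq_self _ z]
    simp [m]
  have hm2 : ∀ z z', ‖m z z'‖ₑ = ‖m z' z‖ₑ := fun z z' => by
    have : m z z' = m z' z := by
      simp only [m]
      rw [← neg_sub z' z, fderiv_neg_of_even hρ.even, ← map_neg]
      simp
    rw [this]
  have hmm : Measurable fun p : Pt d d₁ × Pt d d₁ => ‖m p.1 p.2‖ₑ := by
    have : Continuous fun p : Pt d d₁ × Pt d d₁ => m p.1 p.2 :=
      (hcD.comp (continuous_fst.sub continuous_snd)).clm_apply (by fun_prop)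
    exact this.measurable.enorm
  have hmz : ∀ z, Measurable fun z' => ‖m z z'‖ₑ := fun z => hmm.comp measurable_prodMk_left
  have hum : AEMeasurable (fun z => ‖u z‖ₑ ^ 2) volume := hu.aestronglyMeasurable.enorm.pow_const 2
  have hJ : ∫⁻ z, ∫⁻ z', ‖u z‖ₑ ^ 2 * ‖m z z'‖ₑ ≤ ENNReal.ofReal ε * ∫⁻ z, ‖u z‖ₑ ^ 2 := by
    rw [← lintegral_const_mul'' _ hum]
    refine lintegral_mono fun z => ?_
    rw [lintegral_const_mul _ (hmz z), mul_comm]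
    gcongr
    exact hm1 z
  have hJ' : ∫⁻ z, ∫⁻ z', ‖u z'‖ₑ ^ 2 * ‖m z z'‖ₑ ≤ ENNReal.ofReal ε * ∫⁻ z, ‖u z‖ₑ ^ 2 := by
    rw [lintegral_lintegral_swap]
    · simp only [hm2]
      simpa only [hm2] using hJ
    · exact (hum.comp_quasiMeasurePreserving Measure.quasiMeasurePreserving_snd).mul
        hmm.aemeasurable
  have hfin : ‖2 * I‖ₑ ≤ 2 * (ENNReal.ofReal ε * ∫⁻ z, ‖u z‖ₑ ^ 2) := by
    rw [e3]
    calc ‖∫ z, ∫ z', u z * u z' * m z z'‖ₑ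
        ≤ ∫⁻ z, ∫⁻ z', ‖u z * u z' * m z z'‖ₑ :=
          (enorm_integral_le_lintegral_enorm _).trans
            (lintegral_mono fun z => enorm_integral_le_lintegral_enorm _)
      _ ≤ ∫⁻ z, ∫⁻ z', (‖u z‖ₑ ^ 2 * ‖m z z'‖ₑ + ‖u z'‖ₑ ^ 2 * ‖m z z'‖ₑ) := by
          refine lintegral_mono fun z => lintegral_mono fun z' => ?_
          rw [enorm_mul, enorm_mul, ← add_mul]
          gcongr
          rcases le_total ‖u z‖ₑ ‖u z'‖ₑ with h | h
          · refine le_trans ?_ le_add_self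
            rw [sq]; gcongr
          · refine le_trans ?_ le_self_add
            rw [sq]; gcongr
      _ = (∫⁻ z, ∫⁻ z', ‖u z‖ₑ ^ 2 * ‖m z z'‖ₑ) + ∫⁻ z, ∫⁻ z', ‖u z'‖ₑ ^ 2 * ‖m z z'‖ₑ := by
          rw [← lintegral_add_left']
          · congr 1; ext z
            rw [lintegral_add_left]
            exact (hmz z).const_mul _
          · exact AEMeasurable.lintegral_prod_right'
              (f := fun p : Pt d d₁ × Pt d d₁ => ‖u p.1‖ₑ ^ 2 * ‖m p.1 p.2‖ₑ)
              ((hum.comp_quasiMeasurePreserving Measure.quasiMeasurePreserving_fst).mul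
                hmm.aemeasurable)
      _ ≤ _ := by rw [two_mul]; exact add_le_add hJ hJ'
  have hsq : ∫⁻ z, ‖u z‖ₑ ^ 2 = ENNReal.ofReal (∫ z, u z ^ 2) := by
    rw [ofReal_integral_eq_lintegral_ofReal hu.integrable_sq
      (Eventually.of_forall fun z => sq_nonneg _)]
    congr 1; ext z
    rw [← ofReal_norm, ← ENNReal.ofReal_pow (norm_nonneg _), Real.norm_eq_abs, sq_abs]
  have h2 : ∀ x : ℝ, (2 : ℝ≥0∞) * ENNReal.ofReal x = ENNReal.ofReal (2 * x) := fun x => by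
    rw [ENNReal.ofReal_mul (by norm_num)]; simp
  rw [hsq, ← ENNReal.ofReal_mul hε, ← ofReal_norm,
    h2] at hfin
  have hpos : 0 ≤ ∫ z, u z ^ 2 := integral_nonneg fun z => sq_nonneg _
  have := (ENNReal.ofReal_le_ofReal_iff (by positivity)).1 hfin
  rw [norm_mul, Real.norm_eq_abs I] at this
  norm_num at this
  exact this

/-! ### Mollification and the energy identity for compact support. -/

theorem mollify_eq_convolution {E : Type*} [NormedAddCommGroup E] [MeasurableSpace E]
    {μ : Measure E} (u ρ : E → ℝ) : (fun z => ∫ z', u z' * ρ (z - z') ∂μ)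
      = convolution u ρ (ContinuousLinearMap.lsmul ℝ ℝ) μ := by
    ext z; simp [convolution_def]

theorem contDiff_mollify {E : Type*} [NormedAddCommGroup E] [NormedSpace ℝ E] [MeasurableSpace E]
    [BorelSpace E] {μ : Measure E} [SFinite μ] [μ.IsAddLeftInvariant] {ρ u : E → ℝ}
    (hρ : ContDiff ℝ ∞ ρ) (hρc : HasCompactSupport ρ) (hu : LocallyIntegrable u μ) :
    ContDiff ℝ ∞ (fun z => ∫ z', u z' * ρ (z - z') ∂μ) := by
  rw [mollify_eq_convolution]
  exact hρc.contDiff_convolution_right (n := ⊤) (ContinuousLinearMap.lsmul ℝ ℝ) hu hρ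

theorem hasCompactSupport_mollify {E : Type*} [NormedAddCommGroup E] [NormedSpace ℝ E] [MeasurableSpace E]
    [BorelSpace E] {μ : Measure E} {ρ u : E → ℝ}
    (hρc : HasCompactSupport ρ) (huc : HasCompactSupport u) :
    HasCompactSupport (fun z => ∫ z', u z' * ρ (z - z') ∂μ) := by
  rw [mollify_eq_convolution]
  exact huc.convolution (ContinuousLinearMap.lsmul ℝ ℝ) hρc

theorem fderiv_mollify {E : Type*} [NormedAddCommGroup E] [NormedSpace ℝ E] [MeasurableSpace E]
    [BorelSpace E] {μ : Measure E} [SFinite μ] [μ.IsAddLeftInvariant] {ρ u : E → ℝ}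
    (hρ : ContDiff ℝ ∞ ρ) (hρc : HasCompactSupport ρ) (hu : LocallyIntegrable u μ) (z e : E) :
    fderiv ℝ (fun z => ∫ z', u z' * ρ (z - z') ∂μ) z e
      = ∫ z', u z' * fderiv ℝ ρ (z - z') e ∂μ := by
  have h1 := (hρc.hasFDerivAt_convolution_right (ContinuousLinearMap.lsmul ℝ ℝ) hu
    (hρ.of_le (by simp)) z).fderiv
  have h2 := convolution_precompR_apply (ContinuousLinearMap.lsmul ℝ ℝ) hu
    (hρc.fderiv (𝕜 := ℝ)) (hρ.continuous_fderiv (by simp)) z e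
  rw [mollify_eq_convolution, h1, h2]
  simp [convolution_def]

/-- The energy identity for compactly supported functions on the whole space. -/
theorem energy_identity_of_compact {α : EuclideanSpace ℝ (Fin d₁) → EuclideanSpace ℝ (Fin d)}
    {θ K : ℝ≥0} (hθ : 0 < θ) (hα : HolderWith K θ α) {u G : Pt d d₁ → ℝ}
    {w F : Pt d d₁ → EuclideanSpace ℝ (Fin d₁)} (hu : MemLp u 2 volume) (hw : MemLp w 2 volume)
    (hF : MemLp F 2 volume) (hG : MemLp G 2 volume) {Q : Set (Pt d d₁)} (hQ : IsCompact Q)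
    (huQ : ∀ z ∉ Q, u z = 0) (hwQ : ∀ z ∉ Q, w z = 0) (hFQ : ∀ z ∉ Q, F z = 0)
    (hGQ : ∀ z ∉ Q, G z = 0)
    (hgrad : ∀ φ, ContDiff ℝ ∞ φ → HasCompactSupport φ → ∀ i : Fin d₁,
      ∫ z, u z * dV φ z (EuclideanSpace.single i 1) = -∫ z, w z i * φ z)
    (heq : ∀ φ, ContDiff ℝ ∞ φ → HasCompactSupport φ →
      -∫ z, u z * transportDeriv α φ z = ∫ z, (-dV φ z (F z) + G z * φ z)) :
    ∫ z, (-inner ℝ (F z) (w z) + G z * u z) = 0 := by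
  have hαc : Continuous α := hα.continuous hθ
  have hu1 := integrable_of_memLp_of_eq_zero hu hQ huQ
  have hG1 := integrable_of_memLp_of_eq_zero hG hQ hGQ
  have hw1 := fun i => integrable_of_memLp_of_eq_zero (memLp_apply hw i) hQ
    fun z hz => by simp [hwQ z hz]
  have hF1 := fun i => integrable_of_memLp_of_eq_zero (memLp_apply hF i) hQ
    fun z hz => by simp [hFQ z hz]
  have hFw : ∀ i, Integrable fun z => F z i * w z i := fun i =>
    (memLp_apply hF i).integrable_mul (memLp_apply hw i)
  have hX : ∫ z, (-inner ℝ (F z) (w z) + G z * u z)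
      = -(∑ i, ∫ z, F z i * w z i) + ∫ z, G z * u z := by
    rw [integral_add (f := fun z => -inner ℝ (F z) (w z)) (g := fun z => G z * u z)
      (integrable_inner hF hw).neg (hG.integrable_mul hu), integral_neg]
    congr 2
    rw [← integral_finsetSum _ fun i _ => hFw i]
    simp [PiLp.inner_apply, mul_comm]
  set X := ∫ z, (-inner ℝ (F z) (w z) + G z * u z)
  -- The factor counts errors of size η: one for each of the d₁ components of F·w, one for G u, one
  -- for the commutator.
  have key : ∀ η : ℝ, 0 < η → |X| ≤ (d₁ + 2) * η := by
    intro η hη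
    have h1 : ∀ᶠ ε in 𝓝[>] (0 : ℝ), ∀ i, ∀ ρ, IsMollifier α ε ρ →
        |(∫ z, F z i * ∫ z', w z' i * ρ (z - z')) - ∫ z, F z i * w z i| ≤ η :=
      eventually_all.2 fun i =>
        abs_integral_mollify_sub_le (memLp_apply hF i) (memLp_apply hw i) (hF1 i) (hw1 i) hη
    have h2 := abs_integral_mollify_sub_le (α := α) hG hu hG1 hu1 hη
    have h3 : ∀ᶠ ε in 𝓝[>] (0 : ℝ), ε * ∫ z, u z ^ 2 ≤ η := by
      have : Tendsto (fun ε : ℝ => ε * ∫ z, u z ^ 2) (𝓝 0) (𝓝 (0 * ∫ z, u z ^ 2)) :=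
        tendsto_id.mul_const _
      rw [zero_mul] at this
      exact ((this.mono_left nhdsWithin_le_nhds).eventually (gt_mem_nhds hη)).mono
        fun _ h => le_of_lt h
    obtain ⟨ε, h4, h5, h6, hε⟩ := (h1.and (h2.and (h3.and self_mem_nhdsWithin))).exists
    obtain ⟨ρ, hρ⟩ := exists_isMollifier hθ hα (ε := ε) hε
    have hφs := contDiff_mollify hρ.smooth hρ.compact hu1.locallyIntegrable
    have hφc := hasCompactSupport_mollify (μ := volume) hρ.compact (HasCompactSupport.intro hQ huQ)
    have hφd := fderiv_mollify hρ.smooth hρ.compact hu1.locallyIntegrable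
    -- The mollification of u is the test function; it has compact support since u vanishes off Q.
    set φ : Pt d d₁ → ℝ := fun z => ∫ z', u z' * ρ (z - z') with hφ
    have h7 : |∫ z, u z * transportDeriv α φ z| ≤ η := by
      simp only [transportDeriv, hφd]
      exact (abs_integral_mul_transport_le hαc hu hQ huQ hρ (le_of_lt hε)).trans h6
    -- D_v commutes with mollification: the weak gradient is tested against z' ↦ ρ(z - z').
    have h8 : ∀ z i, dV φ z (EuclideanSpace.single i 1) = ∫ z', w z' i * ρ (z - z') := by
      intro z i
      have hs : ContDiff ℝ ∞ fun z' => ρ (z - z') :=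
        hρ.smooth.comp (contDiff_const.sub contDiff_id)
      have hc : HasCompactSupport fun z' => ρ (z - z') :=
        hρ.compact.comp_homeomorph (Homeomorph.subLeft z)
      have h9 := hgrad _ hs hc i
      have h10 : ∀ z' e, fderiv ℝ (fun z' => ρ (z - z')) z' e = -fderiv ℝ ρ (z - z') e := by
        intro z' e
        have : HasFDerivAt (fun z' => ρ (z - z')) _ z' :=
          (differentiable_of_smooth hρ.smooth (z - z')).hasFDerivAt.comp z'
            ((hasFDerivAt_id z').const_sub z)
        rw [this.fderiv]
        simp
      simp only [dV, h10, mul_neg, integral_neg] at h9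
      rw [← neg_inj.1 h9, dV, hφd]
    have h11 : ∫ z, (-dV φ z (F z) + G z * φ z)
        = -(∑ i, ∫ z, F z i * ∫ z', w z' i * ρ (z - z')) + ∫ z, G z * φ z := by
      rw [integral_add (f := fun z => -dV φ z (F z)) (g := fun z => G z * φ z)
        (integrable_dV hF hφs hφc).neg
        (integrable_mul_of_compact hG hφs.continuous hφc), integral_neg]
      congr 2
      simp only [← h8]
      rw [← integral_finsetSum]
      · simp only [← dV_eq_sum]
      · exact fun i _ => integrable_mul_of_compact (memLp_apply hF i) (continuous_dV hφs _)
          (hasCompactSupport_dV hφc _)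
    have h12 := heq φ hφs hφc
    rw [h11] at h12
    have h13 : X = -(∫ z, u z * transportDeriv α φ z)
        + ∑ i, ((∫ z, F z i * ∫ z', w z' i * ρ (z - z')) - ∫ z, F z i * w z i)
        - ((∫ z, G z * φ z) - ∫ z, G z * u z) := by
      rw [hX, h12, Finset.sum_sub_distrib]
      ring
    have h14 : |∑ i, ((∫ z, F z i * ∫ z', w z' i * ρ (z - z')) - ∫ z, F z i * w z i)|
        ≤ d₁ * η := by
      refine (Finset.abs_sum_le_sum_abs _ _).trans ?_
      refine (Finset.sum_le_sum fun i _ => h4 i ρ hρ).trans ?_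
      simp
    have h15 := h5 ρ hρ
    rw [h13]
    rw [abs_le] at h7 h14 h15 ⊢
    simp only [hφ] at h7 ⊢
    constructor <;> linarith [h7.1, h7.2, h14.1, h14.2, h15.1, h15.2]
  by_contra hne
  have hpos : 0 < |X| := abs_pos.2 hne
  have hd : (0 : ℝ) < d₁ + 2 := by positivity
  have := key (|X| / (2 * (d₁ + 2))) (by positivity)
  have e : (d₁ + 2 : ℝ) * (|X| / (2 * (d₁ + 2))) = |X| / 2 := by field_simp
  linarith

/-! ### Cutoffs and the energy inequality on t < T. -/

theorem mem_slab {S T : EReal} {z : Pt d d₁} :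
    z ∈ (slab d d₁ S T : Set (Pt d d₁)) ↔ S < (z.1 : EReal) ∧ (z.1 : EReal) < T :=
  Iff.rfl

theorem memLp_volume_of_le {E E' : Type*} [NormedAddCommGroup E] [NormedAddCommGroup E']
    {Ω : Opens (Pt d d₁)} {f : Pt d d₁ → E} {h : Pt d d₁ → E'} (hf : MemLp f 2 (vol Ω))
    (hm : AEStronglyMeasurable h (vol Ω)) {C : ℝ} (hle : ∀ z, ‖h z‖ ≤ C * ‖f z‖)
    (h0 : ∀ z ∉ (Ω : Set (Pt d d₁)), h z = 0) : MemLp h 2 volume := by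
  have h1 : MemLp h 2 (vol Ω) := hf.of_le_mul hm (Eventually.of_forall hle)
  rw [← memLp_indicator_iff_restrict Ω.isOpen.measurableSet] at h1
  rwa [indicator_eq_self.2 fun z hz => by by_contra h2; exact hz (h0 z h2)] at h1

/-- The energy identity for the product with a compactly supported smooth function. -/
theorem Kinetic.energy_identity_cutoff
    {α : EuclideanSpace ℝ (Fin d₁) → EuclideanSpace ℝ (Fin d)} {θ K : ℝ≥0} (hθ : 0 < θ)
    (hα : HolderWith K θ α) {Ω : Opens (Pt d d₁)} {u G : Pt d d₁ → ℝ}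
    {w F : Pt d d₁ → EuclideanSpace ℝ (Fin d₁)} (h : Kinetic Ω α u w F G) {ζ : Pt d d₁ → ℝ}
    (hζ : IsTest Ω ζ) :
    ∫ z in Ω, (ζ z ^ 2 * (-inner ℝ (F z) (w z) + G z * u z) - 2 * (ζ z * (u z * dV ζ z (F z)))
      + ζ z * transportDeriv α ζ z * u z ^ 2) = 0 := by
  have hαc : Continuous α := hα.continuous hθ
  obtain ⟨A, hA⟩ := hζ.smooth.continuous.bounded_above_of_compact_support hζ.compact
  obtain ⟨B, hB⟩ := (continuous_gradV hζ.smooth).bounded_above_of_compact_support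
    (hasCompactSupport_gradV hζ.compact)
  have hYc := continuous_transportDeriv hζ.smooth hαc
  obtain ⟨D, hD⟩ := hYc.bounded_above_of_compact_support
    (hasCompactSupport_transportDeriv hζ.compact)
  have z1 : ∀ z ∉ tsupport ζ, ζ z = 0 := fun z hz => image_eq_zero_of_notMem_tsupport hz
  have z2 : ∀ z ∉ tsupport ζ, gradV ζ z = 0 := fun z hz =>
    gradV_eq_zero (fderiv_eq_zero_of_notMem_tsupport hz)
  have z3 : ∀ z ∉ tsupport ζ, transportDeriv α ζ z = 0 := fun z hz =>
    transportDeriv_eq_zero (fderiv_eq_zero_of_notMem_tsupport hz)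
  have z4 : ∀ z ∉ tsupport ζ, dV ζ z (F z) = 0 := fun z hz => by
    rw [dV_eq_inner, z2 z hz, inner_zero_left]
  have hsub : ∀ z ∉ (Ω : Set (Pt d d₁)), z ∉ tsupport ζ := fun z hz h => hz (hζ.subset h)
  have m1 : MemLp (fun z => ζ z * u z) 2 volume :=
    memLp_volume_of_le h.u_mem (hζ.smooth.continuous.aestronglyMeasurable.mul h.u_mem.1)
      (C := A) (fun z => by rw [norm_mul]; gcongr; exact hA z) fun z hz => by simp [z1 z (hsub z hz)]
  have m2 : MemLp (fun z => ζ z • w z) 2 volume :=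
    memLp_volume_of_le h.w_mem (hζ.smooth.continuous.aestronglyMeasurable.smul h.w_mem.1)
      (C := A) (fun z => by rw [norm_smul]; gcongr; exact hA z) fun z hz => by simp [z1 z (hsub z hz)]
  have m3 : MemLp (fun z => u z • gradV ζ z) 2 volume :=
    memLp_volume_of_le h.u_mem (h.u_mem.1.smul (continuous_gradV hζ.smooth).aestronglyMeasurable)
      (C := B) (fun z => by rw [norm_smul, mul_comm]; gcongr; exact hB z)
      fun z hz => by simp [z2 z (hsub z hz)]
  have m4 : MemLp (fun z => ζ z • F z) 2 volume :=
    memLp_volume_of_le h.F_mem (hζ.smooth.continuous.aestronglyMeasurable.smul h.F_mem.1)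
      (C := A) (fun z => by rw [norm_smul]; gcongr; exact hA z) fun z hz => by simp [z1 z (hsub z hz)]
  have m5 : MemLp (fun z => ζ z * G z) 2 volume :=
    memLp_volume_of_le h.G_mem (hζ.smooth.continuous.aestronglyMeasurable.mul h.G_mem.1)
      (C := A) (fun z => by rw [norm_mul]; gcongr; exact hA z) fun z hz => by simp [z1 z (hsub z hz)]
  have m6 : MemLp (fun z => dV ζ z (F z)) 2 volume := by
    refine memLp_volume_of_le h.F_mem ?_ (C := B) (fun z => ?_) fun z hz => z4 z (hsub z hz)
    · simp only [dV_eq_inner]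
      exact (continuous_gradV hζ.smooth).aestronglyMeasurable.inner h.F_mem.1
    · rw [dV_eq_inner]
      exact (norm_inner_le_norm _ _).trans (by gcongr; exact hB z)
  have m7 : MemLp (fun z => u z * transportDeriv α ζ z) 2 volume :=
    memLp_volume_of_le h.u_mem (h.u_mem.1.mul hYc.aestronglyMeasurable)
      (C := D) (fun z => by rw [norm_mul, mul_comm]; gcongr; exact hD z)
      fun z hz => by simp [z3 z (hsub z hz)]
  -- The product ζu solves a kinetic equation on the whole space with gradient ζw + u D_vζ, flux ζF
  -- and source ζG - D_vζ·F + u(∂_t + α·D_x)ζ. The cross term ζu D_vζ·F arises twice, once from the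
  -- gradient and once from the source.
  have key := energy_identity_of_compact hθ hα m1 (m2.add m3) m4 ((m5.sub m6).add m7) hζ.compact
    (fun z hz => by simp [z1 z hz]) (fun z hz => by simp [z1 z hz, z2 z hz])
    (fun z hz => by simp [z1 z hz]) (fun z hz => by simp [z1 z hz, z3 z hz, z4 z hz])
    (fun φ hφ hφc i => ?_) (fun φ hφ hφc => ?_)
  · rw [← key, setIntegral_eq_integral_of_forall_compl_eq_zero]
    · refine integral_congr_ae (Eventually.of_forall fun z => ?_)
      simp only [Pi.add_apply, Pi.sub_apply, inner_add_right, inner_smul_right, inner_smul_left,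
        dV_eq_inner, real_inner_comm (gradV ζ z) (F z), conj_trivial]
      ring
    · intro z hz
      simp [z1 z (hsub z hz)]
  · have ht : IsTest Ω fun z => ζ z * φ z :=
      ⟨hζ.smooth.mul hφ, hφc.mul_left, (tsupport_mul_subset_left).trans hζ.subset⟩
    have := (h.mul_test hαc hζ.smooth hφ hφc ht).1 i
    rw [setIntegral_eq_integral_of_forall_compl_eq_zero,
      setIntegral_eq_integral_of_forall_compl_eq_zero] at this
    · exact this
    · intro z hz; simp [z1 z (hsub z hz), z2 z (hsub z hz)]
    · intro z hz; simp [z1 z (hsub z hz)]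
  · have ht : IsTest Ω fun z => ζ z * φ z :=
      ⟨hζ.smooth.mul hφ, hφc.mul_left, (tsupport_mul_subset_left).trans hζ.subset⟩
    have := (h.mul_test hαc hζ.smooth hφ hφc ht).2
    rw [setIntegral_eq_integral_of_forall_compl_eq_zero,
      setIntegral_eq_integral_of_forall_compl_eq_zero] at this
    · exact this
    · intro z hz; simp [z1 z (hsub z hz), z3 z (hsub z hz), z4 z (hsub z hz)]
    · intro z hz; simp [z1 z (hsub z hz)]

/-- All cutoffs are rescalings of one fixed bump, which is why C does not depend on R. -/
theorem exists_cutoff (E : Type*) [NormedAddCommGroup E] [InnerProductSpace ℝ E]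
    [FiniteDimensional ℝ E] : ∃ C : ℝ, ∀ R : ℝ, 0 < R → ∃ χ : E → ℝ, ContDiff ℝ ∞ χ ∧
      (∀ x, 0 ≤ χ x) ∧ (∀ x, χ x ≤ 1) ∧ (∀ x, ‖x‖ ≤ R → χ x = 1) ∧
      (∀ x, χ x ≠ 0 → ‖x‖ ≤ 2 * R) ∧ ∀ x y, |fderiv ℝ χ x y| ≤ C / R * ‖y‖ := by
  let f : ContDiffBump (0 : E) := ⟨1, 2, one_pos, one_lt_two⟩
  have hf : ContDiff ℝ ∞ f := f.contDiff
  obtain ⟨C, hC⟩ := (hf.continuous_fderiv (by simp)).bounded_above_of_compact_support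
    (f.hasCompactSupport.fderiv (𝕜 := ℝ))
  refine ⟨C, fun R hR => ⟨fun x => f (R⁻¹ • x), hf.comp (contDiff_const_smul _),
    fun x => f.nonneg, fun x => f.le_one, fun x hx => ?_, fun x hx => ?_, fun x y => ?_⟩⟩
  · refine f.one_of_mem_closedBall ?_
    rw [mem_closedBall_zero_iff, norm_smul, Real.norm_of_nonneg (by positivity)]
    change R⁻¹ * ‖x‖ ≤ 1
    rwa [inv_mul_le_iff₀ hR, mul_one]
  · have : R⁻¹ • x ∈ Function.support f := hx
    rw [f.support_eq, mem_ball_zero_iff, norm_smul, Real.norm_of_nonneg (by positivity)] at this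
    change R⁻¹ * ‖x‖ < 2 at this
    rw [inv_mul_lt_iff₀ hR] at this
    linarith
  · have h1 : HasFDerivAt (fun x => f (R⁻¹ • x)) _ x :=
      ((hf.differentiable (by simp)) (R⁻¹ • x)).hasFDerivAt.comp x
        ((hasFDerivAt_id x).const_smul R⁻¹)
    rw [h1.fderiv]
    simp only [ContinuousLinearMap.comp_apply, smul_apply,
      ContinuousLinearMap.id_apply, map_smul, smul_eq_mul, abs_mul, abs_inv, abs_of_pos hR]
    rw [div_eq_inv_mul, mul_assoc]
    exact mul_le_mul_of_nonneg_left (((fderiv ℝ f (R⁻¹ • x)).le_opNorm y).trans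
      (mul_le_mul_of_nonneg_right (hC _) (norm_nonneg _))) (by positivity)

/-- Monotonicity is the point: near a finite T the derivative of the cutoff is large, and only its
sign is under control. The support stays strictly below T, so that multiplication by τ keeps
supports inside the open slab. -/
theorem exists_time_cutoff {T : EReal} (hT : ⊥ < T) : ∃ τ : ℕ → ℝ → ℝ,
    (∀ n, ContDiff ℝ ∞ (τ n)) ∧ (∀ n, Antitone (τ n)) ∧ (∀ n t, 0 ≤ τ n t) ∧ (∀ n t, τ n t ≤ 1) ∧
    (∀ n, ∃ s : ℝ, (s : EReal) < T ∧ ∀ t, τ n t ≠ 0 → t ≤ s) ∧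
    ∀ t : ℝ, (t : EReal) < T → ∀ᶠ n in atTop, τ n t = 1 := by
  induction T with
  | bot => exact absurd hT (lt_irrefl _)
  | top =>
    refine ⟨fun n t => Real.smoothTransition (n - t), fun n =>
      Real.smoothTransition.contDiff.comp (contDiff_const.sub contDiff_id),
      fun n a b hab => Real.smoothTransition.monotone (by linarith),
      fun n t => Real.smoothTransition.nonneg _, fun n t => Real.smoothTransition.le_one _,
      fun n => ⟨n, EReal.coe_lt_top _, fun t ht => ?_⟩, fun t _ => ?_⟩
    · by_contra hlt
      exact ht (Real.smoothTransition.zero_of_nonpos (by linarith))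
    · filter_upwards [eventually_ge_atTop ⌈t + 1⌉₊] with n hn
      have := Nat.le_of_ceil_le hn
      exact Real.smoothTransition.one_of_one_le (by linarith)
  | coe T =>
    refine ⟨fun n t => Real.smoothTransition ((n + 1) * (T - t) - 1), fun n =>
      Real.smoothTransition.contDiff.comp
        ((contDiff_const.mul (contDiff_const.sub contDiff_id)).sub contDiff_const),
      fun n a b hab => Real.smoothTransition.monotone ?_,
      fun n t => Real.smoothTransition.nonneg _, fun n t => Real.smoothTransition.le_one _,
      fun n => ⟨T - 1 / (n + 1), ?_, fun t ht => ?_⟩, fun t ht => ?_⟩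
    · have : (0 : ℝ) ≤ n + 1 := by positivity
      nlinarith
    · rw [EReal.coe_lt_coe_iff]
      have : (0 : ℝ) < 1 / (n + 1) := by positivity
      linarith
    · by_contra hlt
      refine ht (Real.smoothTransition.zero_of_nonpos ?_)
      have h1 : T - t < 1 / (n + 1) := by linarith
      rw [lt_div_iff₀ (by positivity)] at h1
      linarith
    · have ht' : 0 < T - t := by rw [EReal.coe_lt_coe_iff] at ht; linarith
      filter_upwards [eventually_ge_atTop ⌈2 / (T - t)⌉₊] with n hn
      have h1 := Nat.le_of_ceil_le hn
      rw [div_le_iff₀ ht'] at h1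
      refine Real.smoothTransition.one_of_one_le ?_
      linarith

/-- Cutoff functions adapted to the transport operator. -/
theorem exists_cutoff_seq {α : EuclideanSpace ℝ (Fin d₁) → EuclideanSpace ℝ (Fin d)}
    (hα : Continuous α) {T : EReal} (hT : ⊥ < T) : ∃ (ζ : ℕ → Pt d d₁ → ℝ) (c : ℕ → ℝ),
      Tendsto c atTop (𝓝 0) ∧ (∀ n, 0 ≤ c n) ∧ (∀ n, IsTest (slab d d₁ ⊥ T) (ζ n)) ∧ (∀ n z, 0 ≤ ζ n z) ∧
      (∀ n z, ζ n z ≤ 1) ∧ (∀ n z w, |dV (ζ n) z w| ≤ c n * ‖w‖) ∧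
      (∀ n z, transportDeriv α (ζ n) z ≤ c n) ∧
      ∀ z ∈ (slab d d₁ ⊥ T : Set (Pt d d₁)), ∀ᶠ n in atTop, ζ n z = 1 := by
  obtain ⟨τ, τs, τa, τ0, τ1, τz, τe⟩ := exists_time_cutoff hT
  obtain ⟨C₀, h₀⟩ := exists_cutoff ℝ
  obtain ⟨C₁, h₁⟩ := exists_cutoff (EuclideanSpace ℝ (Fin d))
  obtain ⟨C₂, h₂⟩ := exists_cutoff (EuclideanSpace ℝ (Fin d₁))
  -- Since α may be unbounded, the cutoff radius in x is enlarged by a bound for |α| on the support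
  -- of the cutoff in v. Then α·D_xξ is still of order 1/(n + 1).
  have hA : ∀ n : ℕ, ∃ A : ℝ, ∀ v ∈ Metric.closedBall (0 : EuclideanSpace ℝ (Fin d₁))
      (2 * ((n : ℝ) + 1)), ‖α v‖ ≤ A :=
    fun n => (isCompact_closedBall _ _).exists_bound_of_continuousOn hα.continuousOn
  choose A hA using hA
  have hn : ∀ n : ℕ, (0 : ℝ) < n + 1 := fun n => by positivity
  have hA1 : ∀ n, 0 < 1 + |A n| := fun n => by positivity
  choose β βs β0 β1 βe βz βd using fun n : ℕ => h₀ _ (hn n)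
  choose ξ ξs ξ0 ξ1 ξe ξz ξd using fun n : ℕ => h₁ _ (mul_pos (hn n) (hA1 n))
  choose χ χs χ0 χ1 χe χz χd using fun n : ℕ => h₂ _ (hn n)
  let ζ : ℕ → Pt d d₁ → ℝ := fun n z => τ n z.1 * (β n z.1 * (ξ n z.2.1 * χ n z.2.2))
  have hd : ∀ n (z e : Pt d d₁), fderiv ℝ (ζ n) z e
      = fderiv ℝ (τ n) z.1 e.1 * (β n z.1 * (ξ n z.2.1 * χ n z.2.2))
        + τ n z.1 * (fderiv ℝ (β n) z.1 e.1 * (ξ n z.2.1 * χ n z.2.2)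
          + β n z.1 * (fderiv ℝ (ξ n) z.2.1 e.2.1 * χ n z.2.2
            + ξ n z.2.1 * fderiv ℝ (χ n) z.2.2 e.2.2)) := by
    intro n z e
    have d0 : HasFDerivAt (fun z : Pt d d₁ => τ n z.1) _ z :=
      (((τs n).differentiable (by simp)) z.1).hasFDerivAt.comp z hasFDerivAt_fst
    have d1 : HasFDerivAt (fun z : Pt d d₁ => β n z.1) _ z :=
      (((βs n).differentiable (by simp)) z.1).hasFDerivAt.comp z hasFDerivAt_fst
    have d2 : HasFDerivAt (fun z : Pt d d₁ => ξ n z.2.1) _ z :=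
      (((ξs n).differentiable (by simp)) z.2.1).hasFDerivAt.comp (f := fun z : Pt d d₁ => z.2.1) z
        (hasFDerivAt_fst.comp z hasFDerivAt_snd)
    have d3 : HasFDerivAt (fun z : Pt d d₁ => χ n z.2.2) _ z :=
      (((χs n).differentiable (by simp)) z.2.2).hasFDerivAt.comp (f := fun z : Pt d d₁ => z.2.2) z
        (hasFDerivAt_snd.comp z hasFDerivAt_snd)
    have d4 : HasFDerivAt (ζ n) _ z := d0.mul (d1.mul (d2.mul d3))
    rw [d4.fderiv]
    simp only [add_apply, smul_apply,
      ContinuousLinearMap.comp_apply, ContinuousLinearMap.coe_fst', ContinuousLinearMap.coe_snd',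
      smul_eq_mul]
    ring
  have hτ' : ∀ n t, fderiv ℝ (τ n) t 1 ≤ 0 := fun n t => by
    rw [fderiv_apply_one_eq_deriv]
    exact (τa n).deriv_nonpos
  have unit2 : ∀ a b : ℝ, 0 ≤ a → a ≤ 1 → 0 ≤ b → b ≤ 1 → 0 ≤ a * b ∧ a * b ≤ 1 :=
    fun a b ha ha' hb hb' => ⟨mul_nonneg ha hb, mul_le_one₀ ha' hb hb'⟩
  have absle : ∀ a b c : ℝ, 0 ≤ a → a ≤ 1 → |b| ≤ c → |a * b| ≤ c := fun a b c ha ha' hb => by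
    rw [abs_mul, abs_of_nonneg ha]
    exact (mul_le_of_le_one_left (abs_nonneg _) ha').trans hb
  refine ⟨ζ, fun n => (|C₀| + |C₁| + |C₂|) / (n + 1), ?_, fun n => by positivity, fun n => ⟨?_, ?_, ?_⟩, fun n z => ?_,
    fun n z => ?_, fun n z w => ?_, fun n z => ?_, fun z hz => ?_⟩
  · have := (tendsto_one_div_add_atTop_nhds_zero_nat (𝕜 := ℝ)).const_mul (|C₀| + |C₁| + |C₂|)
    simpa [div_eq_mul_inv] using this
  · exact ((τs n).comp contDiff_fst).mul (((βs n).comp contDiff_fst).mul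
      (((ξs n).comp (contDiff_fst.comp contDiff_snd)).mul
      ((χs n).comp (contDiff_snd.comp contDiff_snd))))
  · refine HasCompactSupport.intro (isCompact_closedBall (0 : Pt d d₁)
      (2 * ((n + 1) * (1 + |A n|)))) fun z hz => ?_
    by_contra hne
    simp only [ζ, mul_eq_zero, not_or] at hne
    refine hz ?_
    have h1 : (n + 1 : ℝ) ≤ (n + 1) * (1 + |A n|) :=
      le_mul_of_one_le_right (hn n).le (by linarith [abs_nonneg (A n)])
    simp only [mem_closedBall_zero_iff, Prod.norm_def, max_le_iff]
    exact ⟨(βz n _ hne.2.1).trans (by linarith), ξz n _ hne.2.2.1,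
      (χz n _ hne.2.2.2).trans (by linarith)⟩
  · obtain ⟨s, hs, hs'⟩ := τz n
    have hc : IsClosed {z : Pt d d₁ | z.1 ≤ s} := isClosed_le continuous_fst continuous_const
    refine (closure_minimal (fun z hz => ?_) hc).trans fun z (hz : z.1 ≤ s) => ?_
    · exact hs' _ (left_ne_zero_of_mul hz)
    · exact ⟨EReal.bot_lt_coe _, (EReal.coe_le_coe_iff.2 hz).trans_lt hs⟩
  · exact mul_nonneg (τ0 _ _) (mul_nonneg (β0 _ _) (mul_nonneg (ξ0 _ _) (χ0 _ _)))
  · exact (unit2 _ _ (τ0 _ _) (τ1 _ _) (mul_nonneg (β0 _ _) (mul_nonneg (ξ0 _ _) (χ0 _ _)))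
      (unit2 _ _ (β0 _ _) (β1 _ _) (mul_nonneg (ξ0 _ _) (χ0 _ _))
        (unit2 _ _ (ξ0 _ _) (ξ1 _ _) (χ0 _ _) (χ1 _ _)).2).2).2
  · have h1 : |fderiv ℝ (χ n) z.2.2 w| ≤ (|C₀| + |C₁| + |C₂|) / (n + 1) * ‖w‖ := by
      refine (χd n _ _).trans ?_
      have : C₂ ≤ |C₀| + |C₁| + |C₂| := by
        linarith [le_abs_self C₂, abs_nonneg C₀, abs_nonneg C₁]
      gcongr
    simp only [dV, hd, map_zero, zero_mul, zero_add]
    exact absle _ _ _ (τ0 _ _) (τ1 _ _) (absle _ _ _ (β0 _ _) (β1 _ _)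
      (absle _ _ _ (ξ0 _ _) (ξ1 _ _) h1))
  · simp only [transportDeriv, hd, map_zero, mul_zero, add_zero]
    have a1 : fderiv ℝ (τ n) z.1 1 * (β n z.1 * (ξ n z.2.1 * χ n z.2.2)) ≤ 0 :=
      mul_nonpos_of_nonpos_of_nonneg (hτ' _ _)
        (mul_nonneg (β0 _ _) (mul_nonneg (ξ0 _ _) (χ0 _ _)))
    have a2 : |ξ n z.2.1 * χ n z.2.2 * fderiv ℝ (β n) z.1 1| ≤ |C₀| / (n + 1) := by
      obtain ⟨p, q⟩ := unit2 _ _ (ξ0 n z.2.1) (ξ1 _ _) (χ0 n z.2.2) (χ1 _ _)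
      refine absle _ _ _ p q ((βd n _ _).trans ?_)
      rw [norm_one, mul_one]
      have := hn n
      gcongr
      exact le_abs_self _
    have a3 : |χ n z.2.2 * fderiv ℝ (ξ n) z.2.1 (α z.2.2)| ≤ |C₁| / (n + 1) := by
      by_cases hχ : χ n z.2.2 = 0
      · rw [hχ, zero_mul, abs_zero]
        exact div_nonneg (abs_nonneg _) (hn n).le
      refine absle _ _ _ (χ0 _ _) (χ1 _ _) ((ξd n _ _).trans ?_)
      have h1 : ‖α z.2.2‖ ≤ 1 + |A n| := by
        refine (hA n _ ?_).trans (by linarith [le_abs_self (A n)])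
        exact mem_closedBall_zero_iff.2 (χz n _ hχ)
      calc C₁ / ((n + 1) * (1 + |A n|)) * ‖α z.2.2‖
          ≤ |C₁| / ((n + 1) * (1 + |A n|)) * (1 + |A n|) := by
            have := hn n
            gcongr
            exact le_abs_self _
        _ = |C₁| / (n + 1) := by
            have := (hA1 n).ne'
            field_simp
    have a4 := absle _ _ _ (β0 n z.1) (β1 _ _) a3
    have a5 : τ n z.1 * (fderiv ℝ (β n) z.1 1 * (ξ n z.2.1 * χ n z.2.2)
          + β n z.1 * (fderiv ℝ (ξ n) z.2.1 (α z.2.2) * χ n z.2.2))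
        ≤ |C₀| / (n + 1) + |C₁| / (n + 1) := by
      refine (le_abs_self _).trans (absle _ _ _ (τ0 _ _) (τ1 _ _) ((abs_add_le _ _).trans ?_))
      rw [mul_comm (fderiv ℝ (β n) z.1 1), mul_comm (fderiv ℝ (ξ n) z.2.1 (α z.2.2))]
      exact add_le_add a2 a4
    have a6 : 0 ≤ |C₂| / ((n : ℝ) + 1) := div_nonneg (abs_nonneg _) (hn n).le
    rw [add_div, add_div]
    linarith
  · filter_upwards [τe z.1 hz.2, eventually_ge_atTop ⌈‖z‖⌉₊] with n h1 h2
    have h3 : ‖z‖ ≤ n := Nat.le_of_ceil_le h2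
    have h4 : (n + 1 : ℝ) ≤ (n + 1) * (1 + |A n|) :=
      le_mul_of_one_le_right (hn n).le (by linarith [abs_nonneg (A n)])
    simp only [Prod.norm_def, max_le_iff] at h3
    simp only [ζ]
    rw [h1, βe n _ (by linarith [h3.1]), ξe n _ (by linarith [h3.2.1]),
      χe n _ (by linarith [h3.2.2])]
    norm_num

/-- The energy inequality. -/
theorem Kinetic.energy_inequality {α : EuclideanSpace ℝ (Fin d₁) → EuclideanSpace ℝ (Fin d)}
    {θ K : ℝ≥0} (hθ : 0 < θ) (hα : HolderWith K θ α) {T : EReal} (hT : ⊥ < T)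
    {u G : Pt d d₁ → ℝ} {w F : Pt d d₁ → EuclideanSpace ℝ (Fin d₁)}
    (h : Kinetic (slab d d₁ ⊥ T) α u w F G) :
    0 ≤ ∫ z in slab d d₁ ⊥ T, (-inner ℝ (F z) (w z) + G z * u z) := by
  have hαc : Continuous α := hα.continuous hθ
  obtain ⟨ζ, c, hc, hc0, ht, h0, h1, hV, hY, he⟩ := exists_cutoff_seq (d := d) hαc hT
  set Ω := slab d d₁ ⊥ T
  have hAi : Integrable (fun z => -inner ℝ (F z) (w z) + G z * u z) (vol Ω) :=
    (integrable_inner h.F_mem h.w_mem).neg.add (h.G_mem.integrable_mul h.u_mem)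
  have hlim : Tendsto (fun n => ∫ z in Ω, ζ n z ^ 2 * (-inner ℝ (F z) (w z) + G z * u z)) atTop
      (𝓝 (∫ z in Ω, (-inner ℝ (F z) (w z) + G z * u z))) := by
    refine tendsto_integral_of_dominated_convergence _
      (fun n => ((ht n).smooth.continuous.pow 2).aestronglyMeasurable.mul hAi.1) hAi.norm
      (fun n => Eventually.of_forall fun z => ?_) ?_
    · rw [norm_mul, norm_pow, Real.norm_of_nonneg (h0 n z)]
      exact mul_le_of_le_one_left (norm_nonneg _) (pow_le_one₀ (h0 n z) (h1 n z))
    · filter_upwards [ae_restrict_mem Ω.isOpen.measurableSet] with z hz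
      refine tendsto_const_nhds.congr' ?_
      filter_upwards [he z hz] with n hn
      rw [hn]; simp
  have huF : Integrable (fun z => ‖u z‖ * ‖F z‖) (vol Ω) := h.u_mem.norm.integrable_mul h.F_mem.norm
  -- The term with (∂_t + α·D_x)ζ is bounded from one side only. The discarded part stands for ½ ∫
  -- u² at t = T, hence an inequality in the limit and not an identity.
  have hlow : ∀ n, -(c n * (2 * (∫ z in Ω, ‖u z‖ * ‖F z‖) + ∫ z in Ω, u z ^ 2))
      ≤ ∫ z in Ω, ζ n z ^ 2 * (-inner ℝ (F z) (w z) + G z * u z) := by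
    intro n
    have hid := h.energy_identity_cutoff hθ hα (ht n)
    have I1 : Integrable (fun z => ζ n z ^ 2 * (-inner ℝ (F z) (w z) + G z * u z)) (vol Ω) := by
      refine hAi.norm.mono' (((ht n).smooth.continuous.pow 2).aestronglyMeasurable.mul hAi.1)
        (Eventually.of_forall fun z => ?_)
      rw [norm_mul, norm_pow, Real.norm_of_nonneg (h0 n z)]
      exact mul_le_of_le_one_left (norm_nonneg _) (pow_le_one₀ (h0 n z) (h1 n z))
    have I2 : Integrable (fun z => 2 * (ζ n z * (u z * dV (ζ n) z (F z)))) (vol Ω) := by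
      refine Integrable.const_mul ?_ 2
      have hm : AEStronglyMeasurable (fun z => dV (ζ n) z (F z)) (vol Ω) := by
        simp only [dV_eq_inner]
        exact (continuous_gradV (ht n).smooth).aestronglyMeasurable.inner h.F_mem.1
      refine (huF.const_mul (c n)).mono'
        ((ht n).smooth.continuous.aestronglyMeasurable.mul (h.u_mem.1.mul hm))
        (Eventually.of_forall fun z => ?_)
      rw [norm_mul, Real.norm_of_nonneg (h0 n z), norm_mul]
      refine (mul_le_of_le_one_left (by positivity) (h1 n z)).trans ?_
      refine (mul_le_mul_of_nonneg_left (hV n z (F z)) (norm_nonneg _)).trans (le_of_eq ?_)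
      ring
    have I3 : Integrable (fun z => ζ n z * transportDeriv α (ζ n) z * u z ^ 2) (vol Ω) := by
      have hYc := (ht n).smooth.continuous.mul (continuous_transportDeriv (ht n).smooth hαc)
      obtain ⟨D, hD⟩ := hYc.bounded_above_of_compact_support (ht n).compact.mul_right
      exact h.u_mem.integrable_sq.bdd_mul hYc.aestronglyMeasurable (Eventually.of_forall hD)
    have e : ∫ z in Ω, ζ n z ^ 2 * (-inner ℝ (F z) (w z) + G z * u z)
        = ∫ z in Ω, (2 * (ζ n z * (u z * dV (ζ n) z (F z)))
          - ζ n z * transportDeriv α (ζ n) z * u z ^ 2) := by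
      rw [integral_sub I2 I3]
      rw [integral_add (f := fun z => ζ n z ^ 2 * (-inner ℝ (F z) (w z) + G z * u z)
        - 2 * (ζ n z * (u z * dV (ζ n) z (F z)))) (I1.sub I2) I3, integral_sub I1 I2] at hid
      linarith
    have e' : -(c n * (2 * (∫ z in Ω, ‖u z‖ * ‖F z‖) + ∫ z in Ω, u z ^ 2))
        = ∫ z in Ω, -(c n * (2 * (‖u z‖ * ‖F z‖) + u z ^ 2)) := by
      rw [integral_neg, integral_const_mul, integral_add (huF.const_mul 2) h.u_mem.integrable_sq,
        integral_const_mul]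
    rw [e, e']
    refine integral_mono
      (((huF.const_mul 2).add h.u_mem.integrable_sq).const_mul (c n)).neg (I2.sub I3) fun z => ?_
    have b1 : |ζ n z * (u z * dV (ζ n) z (F z))| ≤ c n * (‖u z‖ * ‖F z‖) := by
      rw [abs_mul, abs_of_nonneg (h0 n z), abs_mul]
      refine (mul_le_of_le_one_left (by positivity) (h1 n z)).trans ?_
      refine (mul_le_mul_of_nonneg_left (hV n z (F z)) (abs_nonneg _)).trans (le_of_eq ?_)
      rw [Real.norm_eq_abs]; ring
    have b2 : ζ n z * transportDeriv α (ζ n) z * u z ^ 2 ≤ c n * u z ^ 2 := by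
      refine mul_le_mul_of_nonneg_right ?_ (sq_nonneg _)
      exact (mul_le_mul_of_nonneg_left (hY n z) (h0 n z)).trans
        (mul_le_of_le_one_left (hc0 n) (h1 n z))
    have := (abs_le.1 b1).1
    simp only
    linarith
  have hlim2 : Tendsto (fun n => -(c n * (2 * (∫ z in Ω, ‖u z‖ * ‖F z‖) + ∫ z in Ω, u z ^ 2)))
      atTop (𝓝 0) := by
    simpa using (hc.mul_const (2 * (∫ z in Ω, ‖u z‖ * ‖F z‖) + ∫ z in Ω, u z ^ 2)).neg
  exact le_of_tendsto_of_tendsto' hlim2 hlim hlow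

/-! ### Tools for existence: Lions' theorem and skew-symmetry of transport. -/

/-- Lions' projection theorem. -/
theorem exists_weak_solution {Φ H : Type*} [AddCommGroup Φ] [Module ℝ Φ] [NormedAddCommGroup H]
    [InnerProductSpace ℝ H] [CompleteSpace H] (ι A : Φ →ₗ[ℝ] H) {c : ℝ} (hc : 0 < c)
    (hcoer : ∀ φ, c * ‖ι φ‖ ^ 2 ≤ inner ℝ (ι φ) (A φ)) (X : H) :
    ∃ U ∈ (LinearMap.range ι).topologicalClosure, ∀ φ, inner ℝ U (A φ) = inner ℝ X (ι φ) := by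
  set V := (LinearMap.range ι).topologicalClosure with hV
  have : CompleteSpace V := (Submodule.isClosed_topologicalClosure _).completeSpace_coe
  -- Projecting A onto V leaves ⟨ιφ, Aφ⟩ unchanged, and lets the solution be taken in V.
  let A' : Φ →ₗ[ℝ] H := V.starProjection.toLinearMap ∘ₗ A
  have hmem : ∀ φ, ι φ ∈ V := fun φ =>
    Submodule.le_topologicalClosure _ (LinearMap.mem_range_self ι φ)
  have hbd : ∀ φ, c * ‖ι φ‖ ≤ ‖A' φ‖ := fun φ => by
    have h1 : inner ℝ (ι φ) (A φ) = inner ℝ (ι φ) (A' φ) := by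
      change _ = inner ℝ (ι φ) (V.starProjection (A φ))
      rw [← Submodule.inner_starProjection_left_eq_right,
        Submodule.starProjection_eq_self_iff.2 (hmem φ)]
    have h2 := (hcoer φ).trans (h1.le.trans (real_inner_le_norm _ _))
    rcases (norm_nonneg (ι φ)).eq_or_lt with h3 | h3
    · rw [← h3, mul_zero]; exact norm_nonneg _
    · nlinarith
  -- A linear choice s of preimages defines the functional A'φ ↦ ⟨X, ιφ⟩. It is bounded by ‖X‖ / c,
  -- extends by Hahn–Banach and is represented by Riesz.
  obtain ⟨s, hs⟩ := LinearMap.exists_rightInverse_of_surjective A'.rangeRestrict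
    (LinearMap.range_eq_top.2 A'.surjective_rangeRestrict)
  have hs' : ∀ y : LinearMap.range A', A' (s y) = y := fun y =>
    congrArg Subtype.val (LinearMap.congr_fun hs y)
  let ℓ : Φ →ₗ[ℝ] ℝ := (innerSL ℝ X).toLinearMap ∘ₗ ι
  let g : LinearMap.range A' →L[ℝ] ℝ := LinearMap.mkContinuous (ℓ ∘ₗ s) (‖X‖ / c) fun y => by
    have h1 := hbd (s y)
    rw [hs'] at h1
    have h2 : ‖ℓ (s y)‖ ≤ ‖X‖ * ‖ι (s y)‖ := abs_real_inner_le_norm X (ι (s y))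
    refine h2.trans ?_
    rw [div_mul_eq_mul_div, le_div_iff₀ hc, mul_assoc, mul_comm _ c]
    exact mul_le_mul_of_nonneg_left h1 (norm_nonneg _)
  obtain ⟨g', hg', -⟩ := exists_extension_norm_eq (LinearMap.range A') g
  let U₀ := (InnerProductSpace.toDual ℝ H).symm g'
  refine ⟨V.starProjection U₀, Submodule.starProjection_apply_mem _ _, fun φ => ?_⟩
  rw [Submodule.inner_starProjection_left_eq_right]
  change inner ℝ U₀ (A' φ) = _
  rw [InnerProductSpace.toDual_symm_apply]
  have h3 := hg' (A'.rangeRestrict φ)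
  change g' (A' φ) = inner ℝ X (ι (s (A'.rangeRestrict φ))) at h3
  rw [h3]
  -- The choice of preimage is immaterial: by the lower bound on A', two preimages have the same
  -- image under ι.
  have h4 := hbd (s (A'.rangeRestrict φ) - φ)
  rw [map_sub A', hs', show (A'.rangeRestrict φ : H) = A' φ from rfl, sub_self, norm_zero] at h4
  have h5 : ι (s (A'.rangeRestrict φ) - φ) = 0 := by
    rw [← norm_le_zero_iff]
    by_contra h6
    exact absurd h4 (not_le.2 (mul_pos hc (not_le.1 h6)))
  rw [map_sub, sub_eq_zero] at h5
  rw [h5]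

/-- The integrand is ½ m ∂_e(φ²) and m is constant along e. Integrating by parts with line
derivatives requires no differentiability of m in other directions, which matters because the
components of α are merely Hölder. -/
theorem integral_mul_mul_fderiv_eq_zero {φ m : Pt d d₁ → ℝ} (hφ : ContDiff ℝ ∞ φ)
    (hφc : HasCompactSupport φ) (hm : Continuous m) (e : Pt d d₁)
    (he : ∀ z (t : ℝ), m (z + t • e) = m z) : ∫ z, m z * φ z * fderiv ℝ φ z e = 0 := by
  have hc : Continuous fun z => fderiv ℝ φ z e :=
    (continuous_fderiv_of_smooth hφ).clm_apply continuous_const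
  have hline : ∀ z, HasLineDerivAt ℝ φ (fderiv ℝ φ z e) z e := fun z =>
    (differentiable_of_smooth hφ z).hasFDerivAt.hasLineDerivAt e
  have h := integral_bilinear_hasLineDerivAt_right_eq_neg_left_of_integrable
    (μ := (volume : Measure (Pt d d₁))) (f := fun z => m z * φ z)
    (f' := fun z => m z * fderiv ℝ φ z e) (g := φ) (g' := fun z => fderiv ℝ φ z e) (v := e)
    (B := ContinuousLinearMap.mul ℝ ℝ)
    (((hm.mul hc).mul hφ.continuous).integrable_of_hasCompactSupport hφc.mul_left)
    (((hm.mul hφ.continuous).mul hc).integrable_of_hasCompactSupport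
      (hφc.mul_left.mul_right))
    (((hm.mul hφ.continuous).mul hφ.continuous).integrable_of_hasCompactSupport hφc.mul_left)
    (fun z _ => by
      have := (hline z).const_mul (m z)
      unfold HasLineDerivAt at this ⊢
      simpa only [he] using this)
    (fun z _ => hline z)
  simp only [ContinuousLinearMap.mul_apply'] at h
  have e1 : ∀ z, m z * fderiv ℝ φ z e * φ z = m z * φ z * fderiv ℝ φ z e := fun z => by ring
  simp only [e1] at h
  linarith

/-- The transport operator is skew-symmetric. -/
theorem integral_mul_transportDeriv_eq_zero
    {α : EuclideanSpace ℝ (Fin d₁) → EuclideanSpace ℝ (Fin d)} (hα : Continuous α)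
    {Ω : Opens (Pt d d₁)} {φ : Pt d d₁ → ℝ} (hφ : IsTest Ω φ) :
    ∫ z in Ω, φ z * transportDeriv α φ z = 0 := by
  rw [setIntegral_eq_integral_of_forall_compl_eq_zero fun z hz => by
    rw [image_eq_zero_of_notMem_tsupport fun h => hz (hφ.subset h), zero_mul]]
  have hs := hφ.smooth
  have hc := hφ.compact
  have hcf : ∀ e : Pt d d₁, Continuous fun z => fderiv ℝ φ z e := fun e =>
    (continuous_fderiv_of_smooth hs).clm_apply continuous_const
  -- Each coefficient α_k(v) is constant along the direction x_k that it multiplies.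
  have hdec : ∀ z, φ z * transportDeriv α φ z = 1 * φ z * fderiv ℝ φ z (1, 0, 0)
      + ∑ k, α z.2.2 k * φ z * fderiv ℝ φ z (0, EuclideanSpace.single k 1, 0) := by
    intro z
    have h1 : ((1, α z.2.2, 0) : Pt d d₁) = (1, 0, 0)
        + ∑ k, α z.2.2 k • ((0, EuclideanSpace.single k 1, 0) : Pt d d₁) := by
      have h2 := (EuclideanSpace.basisFun (Fin d) ℝ).sum_repr (α z.2.2)
      simp only [EuclideanSpace.basisFun_repr, EuclideanSpace.basisFun_apply] at h2
      ext1
      · simp [Prod.fst_sum]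
      · ext1
        · simp [Prod.fst_sum, Prod.snd_sum, h2]
        · simp [Prod.snd_sum]
    rw [transportDeriv, h1, map_add, map_sum, mul_add, Finset.mul_sum, one_mul]
    congr 1
    refine Finset.sum_congr rfl fun k _ => ?_
    rw [map_smul, smul_eq_mul]
    ring
  have hαk : ∀ k, Continuous fun z : Pt d d₁ => α z.2.2 k := fun k =>
    (EuclideanSpace.proj (𝕜 := ℝ) k).continuous.comp (hα.comp (by fun_prop))
  simp only [hdec]
  rw [integral_add, integral_finsetSum]
  · rw [integral_mul_mul_fderiv_eq_zero hs hc continuous_const _ fun _ _ => rfl, zero_add]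
    refine Finset.sum_eq_zero fun k _ => ?_
    exact integral_mul_mul_fderiv_eq_zero (m := fun z => α z.2.2 k) hs hc (hαk k) _
      fun z t => by simp
  · exact fun k _ => (((hαk k).mul hs.continuous).mul (hcf _)).integrable_of_hasCompactSupport
      hc.mul_left.mul_right
  · exact ((continuous_const.mul hs.continuous).mul (hcf _)).integrable_of_hasCompactSupport
      hc.mul_left.mul_right
  · exact integrable_finsetSum _ fun k _ =>
      (((hαk k).mul hs.continuous).mul (hcf _)).integrable_of_hasCompactSupport hc.mul_left.mul_right

theorem integral_mul_dV {Ω : Opens (Pt d d₁)} {ψ φ : Pt d d₁ → ℝ} (hψ : IsTest Ω ψ)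
    (hφ : IsTest Ω φ) (e : EuclideanSpace ℝ (Fin d₁)) :
    ∫ z in Ω, ψ z * dV φ z e = -∫ z in Ω, dV ψ z e * φ z := by
  rw [setIntegral_eq_integral_of_forall_compl_eq_zero fun z hz => by
      rw [image_eq_zero_of_notMem_tsupport fun h => hz (hψ.subset h), zero_mul],
    setIntegral_eq_integral_of_forall_compl_eq_zero fun z hz => by
      rw [image_eq_zero_of_notMem_tsupport fun h => hz (hφ.subset h), mul_zero]]
  have c1 := continuous_dV hψ.smooth e
  have c2 := continuous_dV hφ.smooth e
  exact integral_mul_fderiv_eq_neg_fderiv_mul_of_integrable (𝕜 := ℝ) (v := ((0, 0, e) : Pt d d₁))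
    ((c1.mul hφ.smooth.continuous).integrable_of_hasCompactSupport hφ.compact.mul_left)
    ((hψ.smooth.continuous.mul c2).integrable_of_hasCompactSupport hψ.compact.mul_right)
    ((hψ.smooth.continuous.mul hφ.smooth.continuous).integrable_of_hasCompactSupport
      hφ.compact.mul_left)
    (fun z _ => differentiable_of_smooth hψ.smooth z)
    (fun z _ => differentiable_of_smooth hφ.smooth z)

/-! ### Coefficients, reduction to kinetic form, coercivity. -/

/-- The product of a matrix and a Euclidean vector. -/
def matMul (M : Matrix (Fin d₁) (Fin d₁) ℝ) (w : EuclideanSpace ℝ (Fin d₁)) :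
    EuclideanSpace ℝ (Fin d₁) :=
  ∑ i, ∑ j, (M i j * w j) • EuclideanSpace.single i 1

theorem inner_matMul (M : Matrix (Fin d₁) (Fin d₁) ℝ) (w p : EuclideanSpace ℝ (Fin d₁)) :
    inner ℝ p (matMul M w) = ∑ i, ∑ j, M i j * w j * p i := by
  simp only [matMul, inner_sum, inner_smul_right, EuclideanSpace.inner_single_right]
  simp

theorem inner_matMul_transpose (M : Matrix (Fin d₁) (Fin d₁) ℝ)
    (w p : EuclideanSpace ℝ (Fin d₁)) :
    inner ℝ w (matMul M.transpose p) = inner ℝ p (matMul M w) := by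
  rw [inner_matMul, inner_matMul, Finset.sum_comm]
  refine Finset.sum_congr rfl fun i _ => Finset.sum_congr rfl fun j _ => ?_
  rw [Matrix.transpose_apply]
  ring

theorem matMul_add (M : Matrix (Fin d₁) (Fin d₁) ℝ) (w p : EuclideanSpace ℝ (Fin d₁)) :
    matMul M (w + p) = matMul M w + matMul M p := by
  simp only [matMul, PiLp.add_apply, mul_add, add_smul, Finset.sum_add_distrib]

theorem matMul_smul (M : Matrix (Fin d₁) (Fin d₁) ℝ) (c : ℝ) (w : EuclideanSpace ℝ (Fin d₁)) :
    matMul M (c • w) = c • matMul M w := by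
  simp only [matMul, PiLp.smul_apply, smul_eq_mul, Finset.smul_sum, smul_smul]
  refine Finset.sum_congr rfl fun i _ => Finset.sum_congr rfl fun j _ => ?_
  congr 1
  ring

section Coefficients

variable {C : Coeffs d d₁} {δ L : ℝ} {Ω : Opens (Pt d d₁)}

theorem Coeffs.Admissible.continuous (hC : C.Admissible δ L) : Continuous C.α := by
  obtain ⟨θ, K, hθ, -, h⟩ := hC.holder
  exact h.continuous hθ

theorem memLp_matMul {M : Pt d d₁ → Matrix (Fin d₁) (Fin d₁) ℝ} {B : ℝ}
    (hM : ∀ i j, AEMeasurable (fun z => M z i j) volume) (hB : ∀ z i j, |M z i j| ≤ B)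
    {w : Pt d d₁ → EuclideanSpace ℝ (Fin d₁)} (hw : MemLp w 2 (vol Ω)) :
    MemLp (fun z => matMul (M z) (w z)) 2 (vol Ω) := by
  unfold matMul
  refine memLp_finsetSum _ fun i _ => memLp_finsetSum _ fun j _ => ?_
  have h1 : MemLp (fun z => M z i j * w z j) 2 (vol Ω) := by
    refine (memLp_apply hw j).of_le_mul (c := B)
      ((hM i j).restrict.aestronglyMeasurable.mul (memLp_apply hw j).1)
      (Eventually.of_forall fun z => ?_)
    rw [norm_mul]
    exact mul_le_mul_of_nonneg_right (hB z i j) (norm_nonneg _)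
  exact (ContinuousLinearMap.smulRight (ContinuousLinearMap.id ℝ ℝ)
    (EuclideanSpace.single i (1 : ℝ))).comp_memLp' h1

theorem memLp_smul_of_bounded {E : Type*} [NormedAddCommGroup E] [NormedSpace ℝ E]
    {μ : Measure (Pt d d₁)} {u : Pt d d₁ → ℝ} {b : Pt d d₁ → E} {B : ℝ} (hu : MemLp u 2 μ)
    (hb : AEStronglyMeasurable b μ) (hB : ∀ z, ‖b z‖ ≤ B) : MemLp (fun z => u z • b z) 2 μ := by
  refine hu.of_le_mul (c := B) (hu.1.smul hb) (Eventually.of_forall fun z => ?_)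
  rw [norm_smul, mul_comm]
  exact mul_le_mul_of_nonneg_right (hB z) (norm_nonneg _)

theorem memLp_inner_of_bounded {μ : Measure (Pt d d₁)}
    {w b : Pt d d₁ → EuclideanSpace ℝ (Fin d₁)} {B : ℝ} (hw : MemLp w 2 μ)
    (hb : AEStronglyMeasurable b μ) (hB : ∀ z, ‖b z‖ ≤ B) :
    MemLp (fun z => inner ℝ (b z) (w z)) 2 μ := by
  refine hw.of_le_mul (c := B) (hb.inner hw.1) (Eventually.of_forall fun z => ?_)
  exact (norm_inner_le_norm _ _).trans (mul_le_mul_of_nonneg_right (hB z) (norm_nonneg _))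

theorem Coeffs.Admissible.b_le (hC : C.Admissible δ L) (z : Pt d d₁) : ‖C.b z‖ ≤ L := by
  linarith [hC.lower_bdd z, norm_nonneg (C.bbar z), abs_nonneg (C.c z)]

theorem Coeffs.Admissible.bbar_le (hC : C.Admissible δ L) (z : Pt d d₁) : ‖C.bbar z‖ ≤ L := by
  linarith [hC.lower_bdd z, norm_nonneg (C.b z), abs_nonneg (C.c z)]

theorem Coeffs.Admissible.c_le (hC : C.Admissible δ L) (z : Pt d d₁) : |C.c z| ≤ L := by
  linarith [hC.lower_bdd z, norm_nonneg (C.b z), norm_nonneg (C.bbar z)]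

theorem Coeffs.Admissible.c_add_le (hC : C.Admissible δ L) (lam : ℝ) (z : Pt d d₁) :
    ‖C.c z + lam‖ ≤ L + |lam| :=
  (abs_add_le _ _).trans (by linarith [hC.c_le z])

/-- The vector field `f + a w - b̄ u`. -/
def Coeffs.flux (C : Coeffs d d₁) (f : Pt d d₁ → EuclideanSpace ℝ (Fin d₁)) (u : Pt d d₁ → ℝ)
    (w : Pt d d₁ → EuclideanSpace ℝ (Fin d₁)) (z : Pt d d₁) : EuclideanSpace ℝ (Fin d₁) :=
  f z + matMul (C.a z) (w z) - u z • C.bbar z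

/-- The function `g - b · w - (c + lam) u`. -/
def Coeffs.source (C : Coeffs d d₁) (lam : ℝ) (g u : Pt d d₁ → ℝ)
    (w : Pt d d₁ → EuclideanSpace ℝ (Fin d₁)) (z : Pt d d₁) : ℝ :=
  g z - inner ℝ (C.b z) (w z) - u z • (C.c z + lam)

variable {f w : Pt d d₁ → EuclideanSpace ℝ (Fin d₁)} {g u : Pt d d₁ → ℝ} {lam : ℝ}

theorem Coeffs.Admissible.memLp_flux (hC : C.Admissible δ L) (hf : MemLp f 2 (vol Ω))
    (hu : MemLp u 2 (vol Ω)) (hw : MemLp w 2 (vol Ω)) : MemLp (C.flux f u w) 2 (vol Ω) :=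
  (hf.add (memLp_matMul hC.a_meas hC.a_bdd hw)).sub
    (memLp_smul_of_bounded hu hC.bbar_meas.restrict.aestronglyMeasurable hC.bbar_le)

theorem Coeffs.Admissible.memLp_source (hC : C.Admissible δ L) (lam : ℝ) (hg : MemLp g 2 (vol Ω))
    (hu : MemLp u 2 (vol Ω)) (hw : MemLp w 2 (vol Ω)) : MemLp (C.source lam g u w) 2 (vol Ω) :=
  (hg.sub (memLp_inner_of_bounded hw hC.b_meas.restrict.aestronglyMeasurable hC.b_le)).sub
    (memLp_smul_of_bounded hu (hC.c_meas.restrict.aestronglyMeasurable.add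
      aestronglyMeasurable_const) (hC.c_add_le lam))

/-- Everything except transport is moved to the right-hand side, so that the energy inequality
applies with F the flux and G the source. -/
theorem Coeffs.Admissible.operator_eq_iff (hC : C.Admissible δ L) (hf : MemLp f 2 (vol Ω))
    (hg : MemLp g 2 (vol Ω)) (hu : MemLp u 2 (vol Ω)) (hw : MemLp w 2 (vol Ω)) (φ : 𝓓(Ω, ℝ)) :
    operator Ω C lam u w φ = divAdd Ω f g φ ↔
      -∫ z in Ω, u z * transportDeriv C.α φ z
        = ∫ z in Ω, (-dV φ z (C.flux f u w z) + C.source lam g u w z * φ z) := by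
  have hφ := isTest_coe φ
  have I1 := integrable_divAdd hf hg hφ.smooth hφ.compact
  have I2 := integrable_divAdd (hC.memLp_flux hf hu hw) (hC.memLp_source lam hg hu hw)
    hφ.smooth hφ.compact
  have e : ∫ z in Ω, ((∑ i, ∑ j, C.a z i j * w z j * dV φ z (EuclideanSpace.single i 1))
      - u z * dV φ z (C.bbar z) + (∑ i, C.b z i * w z i) * φ z + (C.c z + lam) * u z * φ z)
      = (∫ z in Ω, (-dV φ z (f z) + g z * φ z))
        - ∫ z in Ω, (-dV φ z (C.flux f u w z) + C.source lam g u w z * φ z) := by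
    rw [← integral_sub I1 I2]
    refine integral_congr_ae (Eventually.of_forall fun z => ?_)
    have h1 : dV φ z (matMul (C.a z) (w z))
        = ∑ i, ∑ j, C.a z i j * w z j * dV φ z (EuclideanSpace.single i 1) := by
      rw [dV_eq_inner, inner_matMul]
      rfl
    have h2 : inner ℝ (C.b z) (w z) = ∑ i, C.b z i * w z i := by
      simp [PiLp.inner_apply, mul_comm]
    simp only [Coeffs.flux, Coeffs.source, dV_sub, dV_add, dV_smul, h1, h2, smul_eq_mul]
    ring
  rw [operator, divAdd, transport, e]
  constructor <;> intro h <;> linarith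

theorem Coeffs.Admissible.isSolution_iff (hC : C.Admissible δ L) (hf : MemLp f 2 (vol Ω))
    (hg : MemLp g 2 (vol Ω)) : IsSolution Ω C lam f g u ↔
      ∃ w, Kinetic Ω C.α u w (C.flux f u w) (C.source lam g u w) := by
  constructor
  · rintro ⟨⟨hu, -⟩, w, ⟨hw, hw'⟩, h⟩
    refine ⟨w, hu, hw, hC.memLp_flux hf hu hw, hC.memLp_source lam hg hu hw,
      fun φ hφ i => hw' i ⟨φ, hφ.smooth, hφ.compact, hφ.subset⟩, fun φ hφ => ?_⟩
    exact (hC.operator_eq_iff hf hg hu hw ⟨φ, hφ.smooth, hφ.compact, hφ.subset⟩).1 (h _)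
  · rintro ⟨w, h⟩
    exact ⟨h.memS2, w, h.isGradV, fun φ =>
      (hC.operator_eq_iff hf hg h.u_mem h.w_mem φ).2 (h.eq φ (isTest_coe φ))⟩

/-- Coercivity of the elliptic part. -/
theorem Coeffs.Admissible.coercive (hC : C.Admissible δ L) (hδ : 0 < δ) (hL : 0 < L)
    (hlam : 1 + 2 * L + L ^ 2 / δ ≤ lam) (z : Pt d d₁) (s : ℝ) (p : EuclideanSpace ℝ (Fin d₁)) :
    δ / 2 * ‖p‖ ^ 2 + lam / 2 * s ^ 2 ≤ inner ℝ p (matMul (C.a z) p) - s * inner ℝ p (C.bbar z)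
      + inner ℝ (C.b z) p * s + (C.c z + lam) * s ^ 2 := by
  have h1 : δ * ‖p‖ ^ 2 ≤ inner ℝ p (matMul (C.a z) p) := by
    rw [inner_matMul]
    refine (hC.a_elliptic z p).trans (le_of_eq ?_)
    refine Finset.sum_congr rfl fun i _ => Finset.sum_congr rfl fun j _ => ?_
    ring
  have h2 : s * inner ℝ p (C.bbar z) ≤ |s| * (‖p‖ * ‖C.bbar z‖) := by
    refine (le_abs_self _).trans ?_
    rw [abs_mul]
    exact mul_le_mul_of_nonneg_left (abs_real_inner_le_norm _ _) (abs_nonneg _)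
  have h3 : -(|s| * (‖C.b z‖ * ‖p‖)) ≤ inner ℝ (C.b z) p * s := by
    refine neg_le_of_abs_le ?_
    rw [abs_mul, mul_comm]
    exact mul_le_mul_of_nonneg_left (abs_real_inner_le_norm _ _) (abs_nonneg _)
  have h4 : -(|C.c z| * s ^ 2) ≤ C.c z * s ^ 2 := by
    have := neg_abs_le (C.c z)
    nlinarith [sq_nonneg s]
  have h5 := hC.lower_bdd z
  have h6 : |s| * ‖p‖ * (‖C.b z‖ + ‖C.bbar z‖) ≤ |s| * ‖p‖ * L :=
    mul_le_mul_of_nonneg_left (by linarith [abs_nonneg (C.c z)]) (by positivity)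
  have h7 : |C.c z| * s ^ 2 ≤ L * s ^ 2 := mul_le_mul_of_nonneg_right (hC.c_le z) (sq_nonneg _)
  -- Young's inequality, from (δ|p| - L|s|)² ≥ 0. The coefficient left for s² is λ - L - L²/(2δ),
  -- which is at least λ/2 exactly when λ ≥ 2L + L²/δ. The additional 1 in the threshold serves to
  -- have λ ≥ 1 elsewhere.
  have h8 : |s| * ‖p‖ * L ≤ δ / 2 * ‖p‖ ^ 2 + L ^ 2 / (2 * δ) * s ^ 2 := by
    have : 0 ≤ (δ * ‖p‖ - L * |s|) ^ 2 / (2 * δ) := by positivity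
    have e : (δ * ‖p‖ - L * |s|) ^ 2 / (2 * δ)
        = δ / 2 * ‖p‖ ^ 2 + L ^ 2 / (2 * δ) * s ^ 2 - |s| * ‖p‖ * L := by
      rw [← sq_abs s]
      field_simp
      ring
    linarith
  have h9 : (1 + 2 * L + L ^ 2 / δ) * s ^ 2 ≤ lam * s ^ 2 :=
    mul_le_mul_of_nonneg_right hlam (sq_nonneg _)
  have e : L ^ 2 / (2 * δ) = L ^ 2 / δ / 2 := by field_simp
  rw [e] at h8
  nlinarith [sq_nonneg s]

end Coefficients

/-! ### Existence by duality. -/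

/-- The Hilbert space of pairs of a square integrable function and a square integrable
vector field. -/
abbrev PairSpace (Ω : Opens (Pt d d₁)) : Type :=
  WithLp 2 (Lp ℝ 2 (vol Ω) × Lp (EuclideanSpace ℝ (Fin d₁)) 2 (vol Ω))

section Pair

variable {Ω : Opens (Pt d d₁)} {p p₁ p₂ : Pt d d₁ → ℝ}
  {q q₁ q₂ : Pt d d₁ → EuclideanSpace ℝ (Fin d₁)}

/-- The class of a pair of functions. -/
def pairLp (hp : MemLp p 2 (vol Ω)) (hq : MemLp q 2 (vol Ω)) : PairSpace Ω :=
  WithLp.toLp 2 (hp.toLp p, hq.toLp q)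

theorem pairLp_eq_add (hp : MemLp p 2 (vol Ω)) (hq : MemLp q 2 (vol Ω))
    (hp₁ : MemLp p₁ 2 (vol Ω)) (hq₁ : MemLp q₁ 2 (vol Ω)) (hp₂ : MemLp p₂ 2 (vol Ω))
    (hq₂ : MemLp q₂ 2 (vol Ω)) (h : ∀ z, p z = p₁ z + p₂ z) (h' : ∀ z, q z = q₁ z + q₂ z) :
    pairLp hp hq = pairLp hp₁ hq₁ + pairLp hp₂ hq₂ := by
  obtain rfl : p = p₁ + p₂ := funext h
  obtain rfl : q = q₁ + q₂ := funext h'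
  rfl

theorem pairLp_eq_smul (hp : MemLp p 2 (vol Ω)) (hq : MemLp q 2 (vol Ω))
    (hp₁ : MemLp p₁ 2 (vol Ω)) (hq₁ : MemLp q₁ 2 (vol Ω)) (c : ℝ) (h : ∀ z, p z = c * p₁ z)
    (h' : ∀ z, q z = c • q₁ z) : pairLp hp hq = c • pairLp hp₁ hq₁ := by
  obtain rfl : p = c • p₁ := funext h
  obtain rfl : q = c • q₁ := funext h'
  rfl

theorem inner_pairLp (U : PairSpace Ω) (hp : MemLp p 2 (vol Ω)) (hq : MemLp q 2 (vol Ω)) :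
    inner ℝ U (pairLp hp hq) = ∫ z in Ω, (U.fst z * p z + inner ℝ (U.snd z) (q z)) := by
  rw [integral_add (f := fun z => U.fst z * p z) (g := fun z => inner ℝ (U.snd z) (q z))
    ((Lp.memLp U.fst).integrable_mul hp) (integrable_inner (Lp.memLp U.snd) hq),
    WithLp.prod_inner_apply, L2.inner_def, L2.inner_def]
  congr 1
  · refine integral_congr_ae ?_
    filter_upwards [hp.coeFn_toLp] with z hz
    simp [pairLp, hz, mul_comm]
  · refine integral_congr_ae ?_
    filter_upwards [hq.coeFn_toLp] with z hz
    simp [pairLp, hz]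

theorem inner_pairLp_pairLp (hp₁ : MemLp p₁ 2 (vol Ω)) (hq₁ : MemLp q₁ 2 (vol Ω))
    (hp : MemLp p 2 (vol Ω)) (hq : MemLp q 2 (vol Ω)) :
    inner ℝ (pairLp hp₁ hq₁) (pairLp hp hq) = ∫ z in Ω, (p₁ z * p z + inner ℝ (q₁ z) (q z)) := by
  rw [inner_pairLp]
  refine integral_congr_ae ?_
  filter_upwards [hp₁.coeFn_toLp, hq₁.coeFn_toLp] with z h1 h2
  simp [pairLp, h1, h2]

end Pair

section Test

variable {Ω : Opens (Pt d d₁)}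

theorem fderiv_testFunction_add (φ ψ : 𝓓(Ω, ℝ)) (z : Pt d d₁) :
    fderiv ℝ (φ + ψ : 𝓓(Ω, ℝ)) z = fderiv ℝ φ z + fderiv ℝ ψ z :=
  fderiv_add (differentiable_of_smooth φ.contDiff z) (differentiable_of_smooth ψ.contDiff z)

theorem fderiv_testFunction_smul (c : ℝ) (φ : 𝓓(Ω, ℝ)) (z : Pt d d₁) :
    fderiv ℝ (c • φ : 𝓓(Ω, ℝ)) z = c • fderiv ℝ φ z :=
  fderiv_const_smul (differentiable_of_smooth φ.contDiff z) c

theorem gradV_testFunction_add (φ ψ : 𝓓(Ω, ℝ)) (z : Pt d d₁) :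
    gradV (φ + ψ : 𝓓(Ω, ℝ)) z = gradV φ z + gradV ψ z := by
  ext i
  simp only [gradV, dV, fderiv_testFunction_add, PiLp.add_apply, add_apply]

theorem gradV_testFunction_smul (c : ℝ) (φ : 𝓓(Ω, ℝ)) (z : Pt d d₁) :
    gradV (c • φ : 𝓓(Ω, ℝ)) z = c • gradV φ z := by
  ext i
  simp only [gradV, dV, fderiv_testFunction_smul, PiLp.smul_apply, smul_apply]

theorem memLp_testFunction (φ : 𝓓(Ω, ℝ)) : MemLp φ 2 (vol Ω) :=
  φ.continuous.memLp_of_hasCompactSupport φ.hasCompactSupport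

theorem memLp_gradV (φ : 𝓓(Ω, ℝ)) : MemLp (gradV φ) 2 (vol Ω) :=
  (continuous_gradV φ.contDiff).memLp_of_hasCompactSupport
    (hasCompactSupport_gradV φ.hasCompactSupport)

variable (Ω) in
/-- The embedding `φ ↦ (φ, D_v φ)` of the test functions. -/
def testEmbedding : 𝓓(Ω, ℝ) →ₗ[ℝ] PairSpace Ω where
  toFun φ := pairLp (memLp_testFunction φ) (memLp_gradV φ)
  map_add' φ ψ := pairLp_eq_add _ _ _ _ _ _ (fun _ => rfl) (gradV_testFunction_add φ ψ)
  map_smul' c φ := pairLp_eq_smul _ _ _ _ c (fun _ => rfl) (gradV_testFunction_smul c φ)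

variable {C : Coeffs d d₁} {δ L lam : ℝ}

/-- The formal adjoint of the operator, lower order part. -/
def adjointLower (C : Coeffs d d₁) (lam : ℝ) (φ : Pt d d₁ → ℝ) (z : Pt d d₁) : ℝ :=
  φ z • (C.c z + lam) - transportDeriv C.α φ z - inner ℝ (C.bbar z) (gradV φ z)

/-- The formal adjoint of the operator, flux part. -/
def adjointFlux (C : Coeffs d d₁) (φ : Pt d d₁ → ℝ) (z : Pt d d₁) : EuclideanSpace ℝ (Fin d₁) :=
  matMul (C.a z).transpose (gradV φ z) + φ z • C.b z

theorem Coeffs.Admissible.memLp_adjointLower (hC : C.Admissible δ L) (lam : ℝ) (φ : 𝓓(Ω, ℝ)) :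
    MemLp (adjointLower C lam φ) 2 (vol Ω) :=
  ((memLp_smul_of_bounded (memLp_testFunction φ) (hC.c_meas.restrict.aestronglyMeasurable.add
      aestronglyMeasurable_const) (hC.c_add_le lam)).sub
    ((continuous_transportDeriv φ.contDiff hC.continuous).memLp_of_hasCompactSupport
      (hasCompactSupport_transportDeriv φ.hasCompactSupport))).sub
    (memLp_inner_of_bounded (memLp_gradV φ) hC.bbar_meas.restrict.aestronglyMeasurable hC.bbar_le)

theorem Coeffs.Admissible.memLp_adjointFlux (hC : C.Admissible δ L) (φ : 𝓓(Ω, ℝ)) :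
    MemLp (adjointFlux C φ) 2 (vol Ω) :=
  (memLp_matMul (M := fun z => (C.a z).transpose) (fun i j => hC.a_meas j i)
    (fun z i j => hC.a_bdd z j i) (memLp_gradV φ)).add
    (memLp_smul_of_bounded (memLp_testFunction φ) hC.b_meas.restrict.aestronglyMeasurable hC.b_le)

/-- The formal adjoint of the operator. -/
def Coeffs.Admissible.adjointMap (hC : C.Admissible δ L) (Ω : Opens (Pt d d₁)) (lam : ℝ) :
    𝓓(Ω, ℝ) →ₗ[ℝ] PairSpace Ω where
  toFun φ := pairLp (hC.memLp_adjointLower lam φ) (hC.memLp_adjointFlux φ)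
  map_add' φ ψ := by
    refine pairLp_eq_add _ _ _ _ _ _ (fun z => ?_) (fun z => ?_)
    · simp only [adjointLower, transportDeriv, fderiv_testFunction_add, gradV_testFunction_add,
        inner_add_right, add_apply, smul_eq_mul]
      ring
    · simp only [adjointFlux, gradV_testFunction_add, matMul_add, add_apply, add_smul]
      abel
  map_smul' c φ := by
    refine pairLp_eq_smul _ _ _ _ c (fun z => ?_) (fun z => ?_)
    · simp only [adjointLower, transportDeriv, fderiv_testFunction_smul, gradV_testFunction_smul,
        inner_smul_right, smul_apply, smul_eq_mul]
      ring
    · simp only [adjointFlux, gradV_testFunction_smul, matMul_smul, smul_apply,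
        smul_add, smul_smul, smul_eq_mul]

/-- Adding φ (∂_t + α·D_x)φ costs nothing, as it integrates to zero, and it cancels the transport in
the adjoint. On the diagonal the adjoint form equals the original one, so the pointwise coercivity
applies. Here λ ≥ 1 > δ permits a common constant δ/2 for both components. -/
theorem Coeffs.Admissible.adjointMap_coercive (hC : C.Admissible δ L) (hδ : 0 < δ) (hδ' : δ < 1)
    (hL : 0 < L) (hlam : 1 + 2 * L + L ^ 2 / δ ≤ lam) (φ : 𝓓(Ω, ℝ)) :
    δ / 2 * ‖testEmbedding Ω φ‖ ^ 2
      ≤ inner ℝ (testEmbedding Ω φ) (hC.adjointMap Ω lam φ) := by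
  have hφ := isTest_coe φ
  have h1 : ‖testEmbedding Ω φ‖ ^ 2
      = ∫ z in Ω, (φ z * φ z + inner ℝ (gradV φ z) (gradV φ z)) := by
    rw [← real_inner_self_eq_norm_sq]
    exact inner_pairLp_pairLp _ _ _ _
  have h2 : inner ℝ (testEmbedding Ω φ) (hC.adjointMap Ω lam φ)
      = ∫ z in Ω, (φ z * adjointLower C lam φ z + inner ℝ (gradV φ z) (adjointFlux C φ z)) :=
    inner_pairLp_pairLp _ _ _ _
  have I0 : Integrable (fun z => φ z * transportDeriv C.α φ z) (vol Ω) :=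
    integrable_mul_of_compact (memLp_testFunction φ)
      (continuous_transportDeriv φ.contDiff hC.continuous)
      (hasCompactSupport_transportDeriv φ.hasCompactSupport)
  have I1 : Integrable (fun z => φ z * adjointLower C lam φ z
      + inner ℝ (gradV φ z) (adjointFlux C φ z)) (vol Ω) :=
    ((memLp_testFunction φ).integrable_mul (hC.memLp_adjointLower lam φ)).add
      (integrable_inner (memLp_gradV φ) (hC.memLp_adjointFlux φ))
  have I2 : Integrable (fun z => φ z * φ z + inner ℝ (gradV φ z) (gradV φ z)) (vol Ω) :=
    ((memLp_testFunction φ).integrable_mul (memLp_testFunction φ)).add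
      (integrable_inner (memLp_gradV φ) (memLp_gradV φ))
  have h3 : ∫ z in Ω, (φ z * adjointLower C lam φ z + inner ℝ (gradV φ z) (adjointFlux C φ z))
      = ∫ z in Ω, (φ z * adjointLower C lam φ z + inner ℝ (gradV φ z) (adjointFlux C φ z)
        + φ z * transportDeriv C.α φ z) := by
    rw [integral_add I1 I0, integral_mul_transportDeriv_eq_zero hC.continuous hφ, add_zero]
  rw [h1, h2, h3, ← integral_const_mul]
  refine integral_mono (I2.const_mul _) (I1.add I0) fun z => ?_
  have h4 := hC.coercive hδ hL hlam z (φ z) (gradV φ z)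
  simp only [adjointLower, adjointFlux, inner_add_right, inner_smul_right, inner_matMul_transpose,
    real_inner_self_eq_norm_sq, smul_eq_mul, real_inner_comm (C.bbar z) (gradV φ z),
    real_inner_comm (C.b z) (gradV φ z)] at h4 ⊢
  have h5 : δ / 2 * φ z ^ 2 ≤ lam / 2 * φ z ^ 2 := by
    refine mul_le_mul_of_nonneg_right ?_ (sq_nonneg _)
    have : 0 ≤ L ^ 2 / δ := by positivity
    linarith
  nlinarith

variable {f : Pt d d₁ → EuclideanSpace ℝ (Fin d₁)} {g : Pt d d₁ → ℝ}

/-- Lions' theorem for the functional (g, -f) gives a pair U = (u, w) whose pairing with the adjoint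
is the weak equation. That U lies in the closure of the pairs (φ, D_v φ) makes w the weak gradient
of u. The argument works on every open Ω. -/
theorem Coeffs.Admissible.exists_kinetic (hC : C.Admissible δ L) (hδ : 0 < δ) (hδ' : δ < 1)
    (hL : 0 < L) (hlam : 1 + 2 * L + L ^ 2 / δ ≤ lam) (hf : MemLp f 2 (vol Ω))
    (hg : MemLp g 2 (vol Ω)) :
    ∃ u w, Kinetic Ω C.α u w (C.flux f u w) (C.source lam g u w) := by
  obtain ⟨U, hU, hsol⟩ := exists_weak_solution (testEmbedding Ω) (hC.adjointMap Ω lam)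
    (half_pos hδ) (hC.adjointMap_coercive hδ hδ' hL hlam) (pairLp hg hf.neg)
  have hu := Lp.memLp U.fst
  have hw := Lp.memLp U.snd
  refine ⟨U.fst, U.snd, hu, hw, hC.memLp_flux hf hu hw, hC.memLp_source lam hg hu hw,
    fun φ hφ i => ?_, fun φ hφ => ?_⟩
  · set e : EuclideanSpace ℝ (Fin d₁) := EuclideanSpace.single i 1
    have c1 := continuous_dV hφ.smooth e
    have s1 := hasCompactSupport_dV hφ.compact e
    have c2 : Continuous fun z => φ z • e := hφ.smooth.continuous.smul continuous_const
    have s2 : HasCompactSupport fun z => φ z • e := hφ.compact.smul_right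
    let Y : PairSpace Ω := pairLp (c1.memLp_of_hasCompactSupport s1)
      (c2.memLp_of_hasCompactSupport s2)
    -- By parts, (∂_e φ, φ e) is orthogonal to every (ψ, D_v ψ), hence to the closure of these
    -- pairs.
    have horth : inner ℝ U Y = 0 := by
      have hcl : IsClosed {V : PairSpace Ω | inner ℝ V Y = 0} :=
        isClosed_eq (continuous_id.inner continuous_const) continuous_const
      refine closure_minimal (s := (LinearMap.range (testEmbedding Ω) : Set (PairSpace Ω))) ?_ hcl
        hU
      rintro _ ⟨ψ, rfl⟩
      have hψ := isTest_coe ψ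
      change inner ℝ (pairLp (memLp_testFunction ψ) (memLp_gradV ψ)) Y = 0
      rw [inner_pairLp_pairLp]
      have h1 := integral_mul_dV hψ hφ e
      rw [integral_add (f := fun z => ψ z * dV φ z e) (g := fun z => inner ℝ (gradV ψ z) (φ z • e))
        (integrable_mul_of_compact (memLp_testFunction ψ) c1 s1)
        (integrable_inner (memLp_gradV ψ) (c2.memLp_of_hasCompactSupport s2)), h1]
      simp only [inner_smul_right, ← dV_eq_inner]
      simp only [mul_comm (φ _), neg_add_cancel]
    have h2 : inner ℝ U Y = _ := inner_pairLp U _ _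
    rw [horth, integral_add (f := fun z => U.fst z * dV φ z e)
      (g := fun z => inner ℝ (U.snd z) (φ z • e)) (integrable_mul_of_compact hu c1 s1)
      (integrable_inner hw (c2.memLp_of_hasCompactSupport s2))] at h2
    have h3 : ∀ z, inner ℝ (U.snd z) (φ z • e) = U.snd z i * φ z := fun z => by
      simp [e, inner_smul_right, EuclideanSpace.inner_single_right, mul_comm]
    simp only [h3] at h2
    linarith
  · let ψ : 𝓓(Ω, ℝ) := ⟨φ, hφ.smooth, hφ.compact, hφ.subset⟩
    have h1 := hsol ψ
    have h2 : inner ℝ U (hC.adjointMap Ω lam ψ) = _ :=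
      inner_pairLp U (hC.memLp_adjointLower lam ψ) (hC.memLp_adjointFlux ψ)
    have h3 : inner ℝ (pairLp hg hf.neg) (testEmbedding Ω ψ) = _ :=
      inner_pairLp_pairLp hg hf.neg (memLp_testFunction ψ) (memLp_gradV ψ)
    rw [h2, h3] at h1
    have I1 := integrable_divAdd hf hg hφ.smooth hφ.compact
    have I2 := integrable_divAdd (hC.memLp_flux hf hu hw) (hC.memLp_source lam hg hu hw)
      hφ.smooth hφ.compact
    have I3 : Integrable (fun z => U.fst z * transportDeriv C.α φ z) (vol Ω) :=
      integrable_mul_of_compact hu (continuous_transportDeriv hφ.smooth hC.continuous)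
        (hasCompactSupport_transportDeriv hφ.compact)
    have e1 : ∀ z, g z * ψ z + inner ℝ ((-f) z) (gradV ψ z) = -dV φ z (f z) + g z * φ z :=
      fun z => by
        rw [dV_eq_inner, real_inner_comm, Pi.neg_apply, inner_neg_right]
        change g z * φ z + -inner ℝ (gradV φ z) (f z) = _
        ring
    have e2 : ∀ z, U.fst z * adjointLower C lam ψ z + inner ℝ (U.snd z) (adjointFlux C ψ z)
        = (-dV φ z (f z) + g z * φ z) - (-dV φ z (C.flux f U.fst U.snd z)
          + C.source lam g U.fst U.snd z * φ z) - U.fst z * transportDeriv C.α φ z := fun z => by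
      change U.fst z * adjointLower C lam φ z + inner ℝ (U.snd z) (adjointFlux C φ z) = _
      simp only [adjointLower, adjointFlux, Coeffs.flux, Coeffs.source, dV_eq_inner,
        inner_add_right, inner_sub_right, inner_smul_right, inner_matMul_transpose, smul_eq_mul,
        real_inner_comm (C.bbar z) (gradV φ z), real_inner_comm (C.b z) (U.snd z)]
      ring
    simp only [e1, e2] at h1
    have h4 := integral_sub (I1.sub I2) I3
    simp only [Pi.sub_apply] at h4
    rw [h4, integral_sub I1 I2] at h1
    linarith

end Test

/-! ### The a priori estimate and uniqueness on t < T. -/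

section LpNorm

variable {X E E' : Type*} [MeasurableSpace X] {μ : Measure X} [NormedAddCommGroup E]
  [NormedAddCommGroup E']

theorem lpNorm_congr_of_ae {f g : X → E} (h : f =ᵐ[μ] g) : lpNorm f 2 μ = lpNorm g 2 μ := by
  by_cases hg : AEStronglyMeasurable g μ
  · rw [← toReal_eLpNorm hg, ← toReal_eLpNorm (hg.congr h.symm), eLpNorm_congr_ae h]
  -- Without measurability `lpNorm` takes its default value 0, and neither function is measurable
  -- here.
  · rw [lpNorm_of_not_aestronglyMeasurable hg,
      lpNorm_of_not_aestronglyMeasurable fun hf => hg (hf.congr h)]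

theorem lpNorm_sq_eq_integral {f : X → E} (hf : AEStronglyMeasurable f μ) :
    lpNorm f 2 μ ^ 2 = ∫ x, ‖f x‖ ^ 2 ∂μ := by
  rw [lpNorm_eq_integral_norm_rpow_toReal (by norm_num) (by norm_num) hf]
  simp only [ENNReal.toReal_ofNat, Real.rpow_ofNat]
  rw [← Real.rpow_natCast, ← Real.rpow_mul (integral_nonneg fun x => by positivity)]
  norm_num

theorem integral_norm_mul_norm_le {f : X → E} {g : X → E'} (hf : MemLp f 2 μ) (hg : MemLp g 2 μ) :
    ∫ x, ‖f x‖ * ‖g x‖ ∂μ ≤ lpNorm f 2 μ * lpNorm g 2 μ := by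
  have h := integral_mul_norm_le_Lp_mul_Lq (μ := μ) (p := 2) (q := 2) Real.HolderConjugate.two_two
    (f := fun x => ‖f x‖) (g := fun x => ‖g x‖) (by simpa using hf.norm) (by simpa using hg.norm)
  rw [lpNorm_eq_integral_norm_rpow_toReal (by norm_num) (by norm_num) hf.1,
    lpNorm_eq_integral_norm_rpow_toReal (by norm_num) (by norm_num) hg.1]
  simpa using h

end LpNorm

/-- With Y = sX and b = s b', since δ < 1 the hypothesis gives δ(Y² + W²)/2 ≤ (a + b')(Y + W). Since
(Y + W)² ≤ 2(Y² + W²), dividing by Y + W yields the constant 4/δ. -/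
theorem add_le_of_energy {δ s X W a b : ℝ} (hδ : 0 < δ) (hδ' : δ < 1) (hs : 0 < s) (hX : 0 ≤ X)
    (hW : 0 ≤ W) (ha : 0 ≤ a) (hb : 0 ≤ b)
    (h : δ / 2 * W ^ 2 + s ^ 2 / 2 * X ^ 2 ≤ a * W + b * X) :
    s * X + W ≤ 4 / δ * a + 4 / δ * s⁻¹ * b := by
  obtain ⟨b', rfl⟩ : ∃ b', b = s * b' := ⟨b / s, by field_simp⟩
  have hb' : 0 ≤ b' := nonneg_of_mul_nonneg_right hb hs
  have e : 4 / δ * a + 4 / δ * s⁻¹ * (s * b') = 4 / δ * (a + b') := by field_simp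
  rw [e]
  obtain ⟨Y, hY⟩ : ∃ Y, Y = s * X := ⟨_, rfl⟩
  have hY0 : 0 ≤ Y := hY ▸ mul_nonneg hs.le hX
  have h1 : δ / 2 * W ^ 2 + Y ^ 2 / 2 ≤ a * W + b' * Y := by
    rw [hY]; nlinarith
  rw [← hY]
  have h2 : δ * (Y + W) ^ 2 ≤ 4 * ((a + b') * (Y + W)) := by
    nlinarith [sq_nonneg (Y - W), mul_nonneg ha hY0, mul_nonneg hb' hW, sq_nonneg Y,
      mul_nonneg hδ.le (sq_nonneg (Y - W)), mul_nonneg (sub_nonneg.2 hδ'.le) (sq_nonneg Y)]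
  rw [div_mul_eq_mul_div, le_div_iff₀ hδ]
  rcases (add_nonneg hY0 hW).eq_or_lt with h3 | h3
  · rw [← h3]; nlinarith
  · nlinarith

section Estimate

variable {C : Coeffs d d₁} {δ L lam : ℝ} {T : EReal}
  {f w : Pt d d₁ → EuclideanSpace ℝ (Fin d₁)} {g u : Pt d d₁ → ℝ}

/-- The a priori estimate. -/
theorem Coeffs.Admissible.apriori (hC : C.Admissible δ L) (hδ : 0 < δ) (hδ' : δ < 1) (hL : 0 < L)
    (hlam : 1 + 2 * L + L ^ 2 / δ ≤ lam) (hT : ⊥ < T) (hf : MemLp f 2 (vol (slab d d₁ ⊥ T)))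
    (hg : MemLp g 2 (vol (slab d d₁ ⊥ T)))
    (h : Kinetic (slab d d₁ ⊥ T) C.α u w (C.flux f u w) (C.source lam g u w)) :
    √lam * lpNorm u 2 (vol (slab d d₁ ⊥ T)) + lpNorm w 2 (vol (slab d d₁ ⊥ T))
      ≤ 4 / δ * lpNorm f 2 (vol (slab d d₁ ⊥ T))
        + 4 / δ * (√lam)⁻¹ * lpNorm g 2 (vol (slab d d₁ ⊥ T)) := by
  obtain ⟨θ, K, hθ, -, hα⟩ := hC.holder
  have hE := h.energy_inequality hθ hα hT
  set Ω := slab d d₁ ⊥ T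
  have hlam0 : 0 < lam := by
    have : 0 ≤ L ^ 2 / δ := by positivity
    linarith
  refine add_le_of_energy hδ hδ' (Real.sqrt_pos.2 hlam0) lpNorm_nonneg lpNorm_nonneg lpNorm_nonneg
    lpNorm_nonneg ?_
  rw [Real.sq_sqrt hlam0.le, lpNorm_sq_eq_integral h.u_mem.1, lpNorm_sq_eq_integral h.w_mem.1]
  refine le_trans ?_ (add_le_add (integral_norm_mul_norm_le hf h.w_mem)
    (integral_norm_mul_norm_le hg h.u_mem))
  have I1 : Integrable (fun z => ‖f z‖ * ‖w z‖) (vol Ω) := hf.norm.integrable_mul h.w_mem.norm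
  have I2 : Integrable (fun z => ‖g z‖ * ‖u z‖) (vol Ω) := hg.norm.integrable_mul h.u_mem.norm
  have I3 : Integrable (fun z => ‖w z‖ ^ 2) (vol Ω) := by
    simpa using h.w_mem.norm.integrable_sq
  have I4 : Integrable (fun z => ‖u z‖ ^ 2) (vol Ω) := by
    simpa using h.u_mem.norm.integrable_sq
  have I5 : Integrable (fun z => -inner ℝ (C.flux f u w z) (w z) + C.source lam g u w z * u z)
      (vol Ω) :=
    (integrable_inner h.F_mem h.w_mem).neg.add (h.G_mem.integrable_mul h.u_mem)
  -- Pointwise this is coercivity plus Cauchy–Schwarz for the data. The first bracket has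
  -- nonnegative integral by the energy inequality and can be dropped.
  have key : ∫ z in Ω, ((-inner ℝ (C.flux f u w z) (w z) + C.source lam g u w z * u z)
        + (δ / 2 * ‖w z‖ ^ 2 + lam / 2 * ‖u z‖ ^ 2))
      ≤ ∫ z in Ω, (‖f z‖ * ‖w z‖ + ‖g z‖ * ‖u z‖) := by
    refine integral_mono (I5.add ((I3.const_mul _).add (I4.const_mul _))) (I1.add I2) fun z => ?_
    have h1 := hC.coercive hδ hL hlam z (u z) (w z)
    have h2 : -(‖f z‖ * ‖w z‖) ≤ inner ℝ (f z) (w z) :=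
      neg_le_of_abs_le (abs_real_inner_le_norm _ _)
    have h3 : g z * u z ≤ ‖g z‖ * ‖u z‖ := by
      rw [← norm_mul]; exact le_abs_self _
    simp only [Coeffs.flux, Coeffs.source, inner_add_left, inner_sub_left, inner_smul_left,
      conj_trivial, Real.norm_eq_abs (u z), sq_abs, smul_eq_mul] at h3 ⊢
    rw [real_inner_comm (w z) (matMul (C.a z) (w z)), real_inner_comm (w z) (C.bbar z)]
    nlinarith
  rw [integral_add (g := fun z => δ / 2 * ‖w z‖ ^ 2 + lam / 2 * ‖u z‖ ^ 2) I5
      ((I3.const_mul _).add (I4.const_mul _)),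
    integral_add (I3.const_mul _) (I4.const_mul _), integral_const_mul, integral_const_mul,
    integral_add I1 I2] at key
  linarith

/-- The data need vanish only almost everywhere on the slab. This allows restricting a solution on t
< T to t < S, where its data are zero, to see that it has not started before S. -/
theorem Coeffs.Admissible.ae_eq_zero (hC : C.Admissible δ L) (hδ : 0 < δ) (hδ' : δ < 1)
    (hL : 0 < L) (hlam : 1 + 2 * L + L ^ 2 / δ ≤ lam) (hT : ⊥ < T)
    (hf : f =ᵐ[vol (slab d d₁ ⊥ T)] 0) (hg : g =ᵐ[vol (slab d d₁ ⊥ T)] 0)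
    (h : Kinetic (slab d d₁ ⊥ T) C.α u w (C.flux f u w) (C.source lam g u w)) :
    u =ᵐ[vol (slab d d₁ ⊥ T)] 0 ∧ w =ᵐ[vol (slab d d₁ ⊥ T)] 0 := by
  have h1 := hC.apriori hδ hδ' hL hlam hT (MemLp.zero.ae_eq hf.symm) (MemLp.zero.ae_eq hg.symm) h
  rw [lpNorm_congr_of_ae hf, lpNorm_congr_of_ae hg, lpNorm_zero, lpNorm_zero, mul_zero, mul_zero,
    add_zero] at h1
  have hlam0 : 0 < lam := by
    have : 0 ≤ L ^ 2 / δ := by positivity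
    linarith
  have hs := Real.sqrt_pos.2 hlam0
  have h2 : 0 ≤ lpNorm u 2 (vol (slab d d₁ ⊥ T)) := lpNorm_nonneg
  have h3 : 0 ≤ lpNorm w 2 (vol (slab d d₁ ⊥ T)) := lpNorm_nonneg
  have h4 := mul_nonneg hs.le h2
  constructor
  · refine (lpNorm_eq_zero h.u_mem (by norm_num)).1 (le_antisymm ?_ h2)
    by_contra h5
    have := mul_pos hs (not_le.1 h5)
    linarith
  · exact (lpNorm_eq_zero h.w_mem (by norm_num)).1 (by linarith)

variable {Ω : Opens (Pt d d₁)}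

theorem Coeffs.flux_congr {μ : Measure (Pt d d₁)} {f' w' : Pt d d₁ → EuclideanSpace ℝ (Fin d₁)}
    {u' : Pt d d₁ → ℝ} (hf : f =ᵐ[μ] f') (hu : u =ᵐ[μ] u') (hw : w =ᵐ[μ] w') :
    C.flux f u w =ᵐ[μ] C.flux f' u' w' := by
  filter_upwards [hf, hu, hw] with z h1 h2 h3
  simp only [Coeffs.flux, h1, h2, h3]

theorem Coeffs.source_congr {μ : Measure (Pt d d₁)} {w' : Pt d d₁ → EuclideanSpace ℝ (Fin d₁)}
    {g' u' : Pt d d₁ → ℝ} (hg : g =ᵐ[μ] g') (hu : u =ᵐ[μ] u') (hw : w =ᵐ[μ] w') :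
    C.source lam g u w =ᵐ[μ] C.source lam g' u' w' := by
  filter_upwards [hg, hu, hw] with z h1 h2 h3
  simp only [Coeffs.source, h1, h2, h3]

/-- Weak gradients are unique almost everywhere, so the equation holds with any prescribed version w
and not only with the one contained in `IsSolution`. -/
theorem Coeffs.Admissible.kinetic_of_isSolution (hC : C.Admissible δ L) (hf : MemLp f 2 (vol Ω))
    (hg : MemLp g 2 (vol Ω)) (h : IsSolution Ω C lam f g u) (hw : IsGradV Ω u w) :
    Kinetic Ω C.α u w (C.flux f u w) (C.source lam g u w) := by
  obtain ⟨w', h'⟩ := (hC.isSolution_iff hf hg).1 h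
  have hww := h'.isGradV.ae_unique hw
  exact h'.congr EventuallyEq.rfl hww (Coeffs.flux_congr .rfl .rfl hww)
    (Coeffs.source_congr .rfl .rfl hww)

theorem Coeffs.Admissible.sub_kinetic (hC : C.Admissible δ L) {u' : Pt d d₁ → ℝ}
    {w' : Pt d d₁ → EuclideanSpace ℝ (Fin d₁)}
    (h : Kinetic Ω C.α u w (C.flux f u w) (C.source lam g u w))
    (h' : Kinetic Ω C.α u' w' (C.flux f u' w') (C.source lam g u' w')) :
    Kinetic Ω C.α (fun z => u z - u' z) (fun z => w z - w' z)
      (C.flux 0 (fun z => u z - u' z) (fun z => w z - w' z))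
      (C.source lam 0 (fun z => u z - u' z) (fun z => w z - w' z)) := by
  refine (h.sub hC.continuous h').congr EventuallyEq.rfl EventuallyEq.rfl
    (Eventually.of_forall fun z => ?_) (Eventually.of_forall fun z => ?_)
  · have e : matMul (C.a z) (w z - w' z) = matMul (C.a z) (w z) - matMul (C.a z) (w' z) := by
      rw [sub_eq_add_neg, matMul_add, ← neg_one_smul ℝ, matMul_smul, neg_one_smul, sub_eq_add_neg]
    simp only [Coeffs.flux, e, sub_smul, Pi.zero_apply]
    abel
  · simp only [Coeffs.source, inner_sub_right, Pi.zero_apply, smul_eq_mul]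
    ring

/-- Uniqueness on `ℝ^{1+d+d₁}_T`. -/
theorem Coeffs.Admissible.ae_unique (hC : C.Admissible δ L) (hδ : 0 < δ) (hδ' : δ < 1)
    (hL : 0 < L) (hlam : 1 + 2 * L + L ^ 2 / δ ≤ lam) (hT : ⊥ < T) {u' : Pt d d₁ → ℝ}
    {w' : Pt d d₁ → EuclideanSpace ℝ (Fin d₁)}
    (h : Kinetic (slab d d₁ ⊥ T) C.α u w (C.flux f u w) (C.source lam g u w))
    (h' : Kinetic (slab d d₁ ⊥ T) C.α u' w' (C.flux f u' w') (C.source lam g u' w')) :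
    u =ᵐ[vol (slab d d₁ ⊥ T)] u' := by
  have := (hC.ae_eq_zero hδ hδ' hL hlam hT EventuallyEq.rfl EventuallyEq.rfl
    (hC.sub_kinetic h h')).1
  filter_upwards [this] with z hz
  exact sub_eq_zero.1 hz

end Estimate

/-! ### Slabs and extension by zero in time. -/

section Slabs

variable {S T : ℝ}

theorem slab_mono_right (hST : S ≤ T) : slab d d₁ ⊥ S ≤ slab d d₁ ⊥ T := fun _ hz =>
  ⟨hz.1, lt_of_lt_of_le hz.2 (EReal.coe_le_coe_iff.2 hST)⟩

theorem slab_mono_left : slab d d₁ S T ≤ slab d d₁ ⊥ T := fun _ hz =>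
  ⟨EReal.bot_lt_coe _, hz.2⟩

theorem mem_slab_coe {z : Pt d d₁} :
    z ∈ (slab d d₁ S T : Set (Pt d d₁)) ↔ S < z.1 ∧ z.1 < T := by
  rw [mem_slab, EReal.coe_lt_coe_iff, EReal.coe_lt_coe_iff]

theorem mem_slab_bot {z : Pt d d₁} :
    z ∈ (slab d d₁ ⊥ T : Set (Pt d d₁)) ↔ z.1 < T := by
  rw [mem_slab, EReal.coe_lt_coe_iff]
  exact and_iff_right (EReal.bot_lt_coe _)

theorem ae_time_ne (S : ℝ) : ∀ᵐ z : Pt d d₁, z.1 ≠ S := by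
  have h : {z : Pt d d₁ | ¬z.1 ≠ S} = {S} ×ˢ univ := by ext z; simp
  rw [ae_iff, h, Measure.volume_eq_prod, Measure.prod_prod]
  simp

theorem ae_slab_of_ae {P : Pt d d₁ → Prop} (h₁ : ∀ᵐ z ∂vol (slab d d₁ ⊥ S), P z)
    (h₂ : ∀ᵐ z ∂vol (slab d d₁ S T), P z) : ∀ᵐ z ∂vol (slab d d₁ ⊥ T), P z := by
  have h₁' := (ae_restrict_iff' (slab d d₁ ⊥ (S : EReal)).isOpen.measurableSet).1 h₁
  have h₂' := (ae_restrict_iff' (slab d d₁ (S : EReal) T).isOpen.measurableSet).1 h₂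
  refine (ae_restrict_iff' (slab d d₁ ⊥ (T : EReal)).isOpen.measurableSet).2 ?_
  filter_upwards [h₁', h₂', ae_time_ne S] with z a b c hz
  rw [mem_slab_bot] at a hz
  rw [mem_slab_coe] at b
  rcases lt_or_gt_of_ne c with h | h
  · exact a h
  · exact b ⟨h, hz⟩

theorem measurableSet_after (S : ℝ) : MeasurableSet {z : Pt d d₁ | S < z.1} :=
  (isOpen_lt continuous_const continuous_fst).measurableSet

theorem vol_restrict_after :
    (vol (slab d d₁ ⊥ T)).restrict {z : Pt d d₁ | S < z.1} = vol (slab d d₁ S T) := by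
  rw [Measure.restrict_restrict (measurableSet_after S)]
  congr 1
  ext z
  rw [mem_inter_iff, mem_slab_bot, mem_slab_coe]
  rfl

/-- The function equal to `h` for `t > S` and to zero for `t ≤ S`. -/
def extendZero {E : Type*} [Zero E] (S : ℝ) (h : Pt d d₁ → E) : Pt d d₁ → E :=
  {z : Pt d d₁ | S < z.1}.indicator h

variable {E : Type*} [NormedAddCommGroup E] {h : Pt d d₁ → E}

theorem extendZero_of_lt {z : Pt d d₁} (hz : S < z.1) : extendZero S h z = h z :=
  indicator_of_mem (s := {z : Pt d d₁ | S < z.1}) hz h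

theorem extendZero_of_le {z : Pt d d₁} (hz : z.1 ≤ S) : extendZero S h z = 0 :=
  indicator_of_notMem (s := {z : Pt d d₁ | S < z.1}) (fun h => not_lt.2 hz h) h

theorem extendZero_ae_eq : extendZero S h =ᵐ[vol (slab d d₁ S T)] h := by
  filter_upwards [ae_restrict_mem (slab d d₁ (S : EReal) T).isOpen.measurableSet] with z hz
  exact extendZero_of_lt (mem_slab_coe.1 hz).1

theorem extendZero_ae_eq_zero : extendZero S h =ᵐ[vol (slab d d₁ ⊥ S)] 0 := by
  filter_upwards [ae_restrict_mem (slab d d₁ ⊥ (S : EReal)).isOpen.measurableSet] with z hz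
  exact extendZero_of_le (mem_slab_bot.1 hz).le

theorem memLp_extendZero (hh : MemLp h 2 (vol (slab d d₁ S T))) :
    MemLp (extendZero S h) 2 (vol (slab d d₁ ⊥ T)) := by
  rw [extendZero, memLp_indicator_iff_restrict (measurableSet_after S), vol_restrict_after]
  exact hh

theorem lpNorm_extendZero (hh : MemLp h 2 (vol (slab d d₁ S T))) :
    lpNorm (extendZero S h) 2 (vol (slab d d₁ ⊥ T)) = lpNorm h 2 (vol (slab d d₁ S T)) := by
  rw [← toReal_eLpNorm (memLp_extendZero hh).1, ← toReal_eLpNorm hh.1, extendZero,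
    eLpNorm_indicator_eq_eLpNorm_restrict (measurableSet_after S), vol_restrict_after]

end Slabs

theorem lpNorm_le_mul_lpNorm {X E E' : Type*} [MeasurableSpace X] {μ : Measure X}
    [NormedAddCommGroup E] [NormedAddCommGroup E'] {f : X → E} {g : X → E'} {c : ℝ} (hc : 0 ≤ c)
    (hf : AEStronglyMeasurable f μ) (hg : MemLp g 2 μ) (h : ∀ᵐ x ∂μ, ‖f x‖ ≤ c * ‖g x‖) :
    lpNorm f 2 μ ≤ c * lpNorm g 2 μ := by
  rw [← toReal_eLpNorm hf, ← toReal_eLpNorm hg.1, ← ENNReal.toReal_ofReal hc,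
    ← ENNReal.toReal_mul]
  exact ENNReal.toReal_mono (ENNReal.mul_ne_top ENNReal.ofReal_ne_top hg.2.ne)
    (eLpNorm_le_mul_eLpNorm_of_ae_le_mul h 2)

/-! ### Multiplication by functions of time, and gluing across t = S. -/

section TimeMultiplier

variable {ρ : ℝ → ℝ} {α : EuclideanSpace ℝ (Fin d₁) → EuclideanSpace ℝ (Fin d)}

theorem fderiv_time (hρ : ContDiff ℝ ∞ ρ) (z e : Pt d d₁) :
    fderiv ℝ (fun z : Pt d d₁ => ρ z.1) z e = e.1 * deriv ρ z.1 := by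
  have h : HasFDerivAt (fun z : Pt d d₁ => ρ z.1) _ z :=
    (hρ.differentiable (by simp) z.1).hasDerivAt.hasFDerivAt.comp z hasFDerivAt_fst
  rw [h.fderiv]
  simp

theorem dV_time (hρ : ContDiff ℝ ∞ ρ) (z : Pt d d₁) (w : EuclideanSpace ℝ (Fin d₁)) :
    dV (fun z : Pt d d₁ => ρ z.1) z w = 0 := by
  rw [dV, fderiv_time hρ, zero_mul]

theorem gradV_time (hρ : ContDiff ℝ ∞ ρ) (z : Pt d d₁) :
    gradV (fun z : Pt d d₁ => ρ z.1) z = 0 := by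
  ext i
  simp [gradV, dV_time hρ]

theorem transportDeriv_time (hρ : ContDiff ℝ ∞ ρ) (z : Pt d d₁) :
    transportDeriv α (fun z : Pt d d₁ => ρ z.1) z = deriv ρ z.1 := by
  rw [transportDeriv, fderiv_time hρ, one_mul]

theorem contDiff_time (hρ : ContDiff ℝ ∞ ρ) : ContDiff ℝ ∞ fun z : Pt d d₁ => ρ z.1 :=
  hρ.comp contDiff_fst

theorem IsTest.mul_time {Ω Ω' : Opens (Pt d d₁)} {φ : Pt d d₁ → ℝ} (hφ : IsTest Ω φ)
    (hρ : ContDiff ℝ ∞ ρ) {I : Set ℝ} (hI : IsClosed I) (hρI : ∀ t, ρ t ≠ 0 → t ∈ I)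
    (hΩ : ∀ z ∈ (Ω : Set (Pt d d₁)), z.1 ∈ I → z ∈ (Ω' : Set (Pt d d₁))) :
    IsTest Ω' fun z => ρ z.1 * φ z := by
  refine ⟨(contDiff_time hρ).mul hφ.smooth, hφ.compact.mul_left, fun z hz => ?_⟩
  refine hΩ z (hφ.subset (tsupport_mul_subset_right hz)) ?_
  exact closure_minimal (s := Function.support fun z => ρ z.1 * φ z)
    (t := {z : Pt d d₁ | z.1 ∈ I}) (fun z hz => hρI _ (left_ne_zero_of_mul hz))
    (hI.preimage continuous_fst) hz

variable {Ω : Opens (Pt d d₁)} {u G : Pt d d₁ → ℝ} {w F : Pt d d₁ → EuclideanSpace ℝ (Fin d₁)}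

/-- A function of t alone has no gradient in v, so only ρ' u is added to the source. Integrability
of the products is assumed because exponential weights are unbounded on t < T. -/
theorem Kinetic.mul_time (hα : Continuous α) (h : Kinetic Ω α u w F G) (hρ : ContDiff ℝ ∞ ρ)
    (hu : MemLp (fun z => ρ z.1 * u z) 2 (vol Ω)) (hw : MemLp (fun z => ρ z.1 • w z) 2 (vol Ω))
    (hF : MemLp (fun z => ρ z.1 • F z) 2 (vol Ω))
    (hG : MemLp (fun z => ρ z.1 * G z + deriv ρ z.1 * u z) 2 (vol Ω)) :
    Kinetic Ω α (fun z => ρ z.1 * u z) (fun z => ρ z.1 • w z) (fun z => ρ z.1 • F z)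
      (fun z => ρ z.1 * G z + deriv ρ z.1 * u z) := by
  have ht : ∀ φ, IsTest Ω φ → IsTest Ω fun z => ρ z.1 * φ z := fun φ hφ =>
    hφ.mul_time hρ isClosed_univ (fun _ _ => mem_univ _) fun _ hz _ => hz
  refine ⟨hu, hw, hF, hG, fun φ hφ i => ?_, fun φ hφ => ?_⟩
  · have := (h.mul_test hα (contDiff_time hρ) hφ.smooth hφ.compact (ht φ hφ)).1 i
    simpa only [gradV_time hρ, smul_zero, add_zero] using this
  · have := (h.mul_test hα (contDiff_time hρ) hφ.smooth hφ.compact (ht φ hφ)).2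
    simpa only [dV_time hρ, transportDeriv_time hρ, sub_zero, mul_comm (u _) (deriv ρ _)] using this

/-- Solutions on both sides of `t = S` can be glued if there is no singular part on `t = S`. -/
theorem Kinetic.glue {S T : ℝ} (hST : S < T) {F₁ : Pt d d₁ → EuclideanSpace ℝ (Fin d₁)}
    {G₁ : Pt d d₁ → ℝ} (h : Kinetic (slab d d₁ ⊥ T) α u w F₁ G₁)
    (hS : Kinetic (slab d d₁ ⊥ S) α u w F G) (hT : Kinetic (slab d d₁ S T) α u w F G)
    (hF : MemLp F 2 (vol (slab d d₁ ⊥ T))) (hG : MemLp G 2 (vol (slab d d₁ ⊥ T))) :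
    Kinetic (slab d d₁ ⊥ T) α u w F G := by
  refine ⟨h.u_mem, h.w_mem, hF, hG, h.grad, fun φ hφ => ?_⟩
  rw [h.eq φ hφ]
  set Ω := slab d d₁ ⊥ (T : EReal)
  -- Both right-hand sides represent the same transport term on either side of S. Their difference
  -- involves no time derivative of φ, so replacing φ by ρ(t)φ just multiplies D by ρ, with no ρ' to
  -- blow up near S.
  let D : Pt d d₁ → ℝ := fun z => (-dV φ z (F₁ z) + G₁ z * φ z) - (-dV φ z (F z) + G z * φ z)
  have I1 := integrable_divAdd h.F_mem h.G_mem hφ.smooth hφ.compact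
  have I2 := integrable_divAdd hF hG hφ.smooth hφ.compact
  have hD : Integrable D (vol Ω) := I1.sub I2
  have hvan : ∀ (Ω' : Opens (Pt d d₁)), Ω' ≤ Ω → Kinetic Ω' α u w F G → ∀ ρ : ℝ → ℝ,
      ContDiff ℝ ∞ ρ → IsTest Ω' (fun z => ρ z.1 * φ z) → ∫ z in Ω, ρ z.1 * D z = 0 := by
    intro Ω' hΩ' hK ρ hρ ht
    have e1 := (h.mono hΩ').eq _ ht
    rw [hK.eq _ ht] at e1
    have J1 := integrable_divAdd (h.mono hΩ').F_mem (h.mono hΩ').G_mem ht.smooth ht.compact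
    have J2 := integrable_divAdd hK.F_mem hK.G_mem ht.smooth ht.compact
    have e2 : ∫ z in Ω', ρ z.1 * D z = 0 := by
      rw [← sub_eq_zero.2 e1.symm, ← integral_sub J1 J2]
      refine integral_congr_ae (Eventually.of_forall fun z => ?_)
      simp only [D, dV_mul (contDiff_time hρ) hφ.smooth, dV_time hρ]
      ring
    rw [← e2]
    refine (setIntegral_of_tsupport_subset hΩ' ht.subset fun z hz => ?_).symm
    have h1 := image_eq_zero_of_notMem_tsupport hz
    have h2 := fderiv_eq_zero_of_notMem_tsupport hz
    have h3 : ∀ p, ρ z.1 * dV φ z p = 0 := fun p => by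
      have := dV_mul (contDiff_time hρ) hφ.smooth z p
      rw [dV_time hρ, mul_zero, add_zero] at this
      rw [← this, dV, h2]
      rfl
    simp only [D]
    linear_combination -h3 (F₁ z) + h3 (F z) + (G₁ z - G z) * h1
  -- These cutoffs live after and before S respectively and vanish near S. Their sum tends to 1 off
  -- t = S, a null set.
  let a : ℕ → ℝ → ℝ := fun n t => Real.smoothTransition (n * (t - S) - 1)
  let b : ℕ → ℝ → ℝ := fun n t => Real.smoothTransition (n * (S - t) - 1)
  have ha : ∀ n, ContDiff ℝ ∞ (a n) := fun n => Real.smoothTransition.contDiff.comp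
    ((contDiff_const.mul (contDiff_id.sub contDiff_const)).sub contDiff_const)
  have hb : ∀ n, ContDiff ℝ ∞ (b n) := fun n => Real.smoothTransition.contDiff.comp
    ((contDiff_const.mul (contDiff_const.sub contDiff_id)).sub contDiff_const)
  have h1 : ∀ n, ∫ z in Ω, a n z.1 * D z = 0 := fun n => by
    refine hvan _ slab_mono_left hT _ (ha n) (hφ.mul_time (ha n)
      (I := {t | 1 ≤ n * (t - S)}) (isClosed_le continuous_const (by fun_prop)) (fun t ht => ?_)
      fun z hz hz' => ?_)
    · by_contra hlt
      exact ht (Real.smoothTransition.zero_of_nonpos (by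
        have : n * (t - S) < 1 := not_le.1 hlt
        linarith))
    · refine mem_slab_coe.2 ⟨?_, mem_slab_bot.1 hz⟩
      have h3 : 1 ≤ n * (z.1 - S) := hz'
      by_contra h4
      have : (n : ℝ) * (z.1 - S) ≤ 0 :=
        mul_nonpos_of_nonneg_of_nonpos (Nat.cast_nonneg n) (by linarith)
      linarith
  have h2 : ∀ n, ∫ z in Ω, b n z.1 * D z = 0 := fun n => by
    refine hvan _ (slab_mono_right hST.le) hS _ (hb n) (hφ.mul_time (hb n)
      (I := {t | 1 ≤ n * (S - t)}) (isClosed_le continuous_const (by fun_prop)) (fun t ht => ?_)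
      fun z hz hz' => ?_)
    · by_contra hlt
      exact ht (Real.smoothTransition.zero_of_nonpos (by
        have : n * (S - t) < 1 := not_le.1 hlt
        linarith))
    · refine mem_slab_bot.2 ?_
      have h3 : 1 ≤ n * (S - z.1) := hz'
      by_contra h4
      have : (n : ℝ) * (S - z.1) ≤ 0 :=
        mul_nonpos_of_nonneg_of_nonpos (Nat.cast_nonneg n) (by linarith)
      linarith
  have hm : ∀ ρ : ℝ → ℝ, ContDiff ℝ ∞ ρ → AEStronglyMeasurable (fun z => ρ z.1 * D z) (vol Ω) :=
    fun ρ hρ => (contDiff_time hρ).continuous.aestronglyMeasurable.mul hD.1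
  have hle : ∀ (s : ℝ) z, ‖Real.smoothTransition s * D z‖ ≤ ‖D z‖ := fun s z => by
    rw [norm_mul, Real.norm_of_nonneg (Real.smoothTransition.nonneg _)]
    exact mul_le_of_le_one_left (norm_nonneg _) (Real.smoothTransition.le_one _)
  have h3 : ∀ n, ∫ z in Ω, (a n z.1 * D z + b n z.1 * D z) = 0 := fun n => by
    rw [integral_add, h1, h2, add_zero]
    · exact hD.norm.mono' (hm _ (ha n)) (Eventually.of_forall fun z => hle _ z)
    · exact hD.norm.mono' (hm _ (hb n)) (Eventually.of_forall fun z => hle _ z)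
  have hlim : Tendsto (fun n => ∫ z in Ω, (a n z.1 * D z + b n z.1 * D z)) atTop
      (𝓝 (∫ z in Ω, D z)) := by
    refine tendsto_integral_of_dominated_convergence (fun z => ‖D z‖ + ‖D z‖)
      (fun n => (hm _ (ha n)).add (hm _ (hb n))) (hD.norm.add hD.norm)
      (fun n => Eventually.of_forall fun z => (norm_add_le _ _).trans
        (add_le_add (hle _ z) (hle _ z))) ?_
    filter_upwards [ae_restrict_of_ae (ae_time_ne S)] with z hz
    refine tendsto_const_nhds.congr' ?_
    have hpos : 0 < |z.1 - S| := abs_pos.2 (sub_ne_zero.2 hz)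
    filter_upwards [eventually_ge_atTop ⌈2 / |z.1 - S|⌉₊] with n hn
    have h4 := Nat.le_of_ceil_le hn
    rw [div_le_iff₀ hpos] at h4
    simp only [a, b]
    rcases lt_or_gt_of_ne hz with h5 | h5
    · rw [abs_of_neg (by linarith)] at h4
      rw [Real.smoothTransition.one_of_one_le (x := n * (S - z.1) - 1) (by linarith),
        Real.smoothTransition.zero_of_nonpos (by linarith)]
      ring
    · rw [abs_of_pos (by linarith)] at h4
      rw [Real.smoothTransition.one_of_one_le (x := n * (z.1 - S) - 1) (by linarith),
        Real.smoothTransition.zero_of_nonpos (by linarith)]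
      ring
  simp only [h3] at hlim
  have h4 : ∫ z in Ω, D z = 0 := tendsto_nhds_unique hlim tendsto_const_nhds
  have h5 : ∫ z in Ω, D z = _ := integral_sub I1 I2
  linarith

end TimeMultiplier

theorem kinetic_zero (Ω : Opens (Pt d d₁))
    (α : EuclideanSpace ℝ (Fin d₁) → EuclideanSpace ℝ (Fin d)) : Kinetic Ω α 0 0 0 0 := by
  refine ⟨MemLp.zero, MemLp.zero, MemLp.zero, MemLp.zero, fun φ _ i => ?_, fun φ _ => ?_⟩ <;> simp

/-! ### Exponential weights in time. -/

section TimeWeight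

variable {E : Type*} [NormedAddCommGroup E] [NormedSpace ℝ E] {Ω : Opens (Pt d d₁)}
  {κ S T B : ℝ} {h : Pt d d₁ → E}

/-- The function `exp (κ (t - S)) h`. -/
def timeWeight (κ S : ℝ) (h : Pt d d₁ → E) (z : Pt d d₁) : E :=
  Real.exp (κ * (z.1 - S)) • h z

/-- The alternative covers both uses: for κ ≥ 0 the weight is bounded on t < T, while for κ < 0 it
is unbounded as t → -∞ but multiplies functions that vanish for t ≤ S. -/
theorem norm_timeWeight_le {z : Pt d d₁} (hB : Real.exp (κ * (z.1 - S)) ≤ B ∨ h z = 0) :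
    ‖timeWeight κ S h z‖ ≤ B * ‖h z‖ := by
  rw [timeWeight, norm_smul, Real.norm_of_nonneg (Real.exp_pos _).le]
  rcases hB with hB | hB
  · exact mul_le_mul_of_nonneg_right hB (norm_nonneg _)
  · simp [hB]

theorem memLp_timeWeight (hh : MemLp h 2 (vol Ω))
    (hB : ∀ᵐ z ∂vol Ω, Real.exp (κ * (z.1 - S)) ≤ B ∨ h z = 0) :
    MemLp (timeWeight κ S h) 2 (vol Ω) := by
  refine hh.of_le_mul (c := B) ?_ (hB.mono fun z hz => norm_timeWeight_le hz)
  exact AEStronglyMeasurable.smul (Continuous.aestronglyMeasurable (by fun_prop)) hh.1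

theorem lpNorm_timeWeight_le (hB0 : 0 ≤ B) (hh : MemLp h 2 (vol Ω))
    (hB : ∀ᵐ z ∂vol Ω, Real.exp (κ * (z.1 - S)) ≤ B ∨ h z = 0) :
    lpNorm (timeWeight κ S h) 2 (vol Ω) ≤ B * lpNorm h 2 (vol Ω) :=
  lpNorm_le_mul_lpNorm hB0 (memLp_timeWeight hh hB).1 hh (hB.mono fun _ hz => norm_timeWeight_le hz)

theorem timeWeight_neg_timeWeight : timeWeight κ S (timeWeight (-κ) S h) = h := by
  ext z
  rw [timeWeight, timeWeight, smul_smul, ← Real.exp_add, neg_mul, add_neg_cancel, Real.exp_zero,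
    one_smul]

theorem timeWeight_ae_eq_zero {μ : Measure (Pt d d₁)} (hh : h =ᵐ[μ] 0) :
    timeWeight κ S h =ᵐ[μ] 0 := by
  filter_upwards [hh] with z hz
  simp [timeWeight, hz]

theorem exp_le_one_or_extendZero_eq_zero {F : Type*} [NormedAddCommGroup F] {p : Pt d d₁ → F}
    (hκ : 0 ≤ κ) (z : Pt d d₁) : Real.exp (-κ * (z.1 - S)) ≤ 1 ∨ extendZero S p z = 0 := by
  rcases lt_or_ge S z.1 with hz | hz
  · left
    rw [Real.exp_le_one_iff]
    nlinarith
  · exact Or.inr (extendZero_of_le hz)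

theorem ae_exp_le (hκ : 0 ≤ κ) :
    ∀ᵐ z ∂vol (slab d d₁ ⊥ T), Real.exp (κ * (z.1 - S)) ≤ Real.exp (κ * (T - S)) := by
  filter_upwards [ae_restrict_mem (slab d d₁ ⊥ (T : EReal)).isOpen.measurableSet] with z hz
  have := mem_slab_bot.1 hz
  gcongr

end TimeWeight

/-! ### The Cauchy problem. -/

section Cauchy

variable {C : Coeffs d d₁} {δ L lam κ S T B : ℝ} {Ω : Opens (Pt d d₁)}
  {f w : Pt d d₁ → EuclideanSpace ℝ (Fin d₁)} {g u : Pt d d₁ → ℝ}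

/-- Multiplication by `exp (κ (t - S))` shifts the parameter of the equation by `κ`. -/
theorem Coeffs.Admissible.kinetic_timeWeight (hC : C.Admissible δ L) (hf : MemLp f 2 (vol Ω))
    (hg : MemLp g 2 (vol Ω)) (h : Kinetic Ω C.α u w (C.flux f u w) (C.source lam g u w))
    (hB : ∀ᵐ z ∂vol Ω,
      Real.exp (κ * (z.1 - S)) ≤ B ∨ (f z = 0 ∧ g z = 0 ∧ u z = 0 ∧ w z = 0)) :
    Kinetic Ω C.α (timeWeight κ S u) (timeWeight κ S w)
      (C.flux (timeWeight κ S f) (timeWeight κ S u) (timeWeight κ S w))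
      (C.source (lam - κ) (timeWeight κ S g) (timeWeight κ S u) (timeWeight κ S w)) := by
  have hρ : ContDiff ℝ ∞ fun t => Real.exp (κ * (t - S)) :=
    Real.contDiff_exp.comp (contDiff_const.mul (contDiff_id.sub contDiff_const))
  have hd : ∀ t, deriv (fun t => Real.exp (κ * (t - S))) t = κ * Real.exp (κ * (t - S)) :=
    fun t => by
      have := (((hasDerivAt_id t).sub_const S).const_mul κ).exp.deriv
      simpa [mul_comm] using this
  have hf' := memLp_timeWeight hf (hB.mono fun z hz => hz.imp_right fun h => h.1)
  have hg' := memLp_timeWeight hg (hB.mono fun z hz => hz.imp_right fun h => h.2.1)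
  have hu' := memLp_timeWeight h.u_mem (hB.mono fun z hz => hz.imp_right fun h => h.2.2.1)
  have hw' := memLp_timeWeight h.w_mem (hB.mono fun z hz => hz.imp_right fun h => h.2.2.2)
  have e1 : (fun z : Pt d d₁ => Real.exp (κ * (z.1 - S)) • C.flux f u w z)
      = C.flux (timeWeight κ S f) (timeWeight κ S u) (timeWeight κ S w) := by
    ext1 z
    simp only [Coeffs.flux, timeWeight, matMul_smul, smul_sub, smul_add, smul_smul, smul_eq_mul]
  -- The derivative of the weight adds κ times the weighted u to the source, which lowers the
  -- parameter to `lam - κ`.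
  have e2 : (fun z : Pt d d₁ => Real.exp (κ * (z.1 - S)) * C.source lam g u w z
        + deriv (fun t => Real.exp (κ * (t - S))) z.1 * u z)
      = C.source (lam - κ) (timeWeight κ S g) (timeWeight κ S u) (timeWeight κ S w) := by
    ext1 z
    simp only [Coeffs.source, timeWeight, hd, inner_smul_right, smul_eq_mul]
    ring
  have := h.mul_time hC.continuous hρ hu' hw' (by rw [e1]; exact hC.memLp_flux hf' hu' hw')
    (by rw [e2]; exact hC.memLp_source _ hg' hu' hw')
  rw [e1, e2] at this
  exact this

/-- The extension by zero of a solution of the Cauchy problem solves the equation on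
`ℝ^{1+d+d₁}_T`. -/
theorem Coeffs.Admissible.kinetic_extendZero (hC : C.Admissible δ L) (hST : S < T)
    (hf : MemLp f 2 (vol (slab d d₁ S T))) (hg : MemLp g 2 (vol (slab d d₁ S T)))
    (h : IsCauchySolution S T C f g u) (hw : IsGradV (slab d d₁ S T) u w) :
    Kinetic (slab d d₁ ⊥ T) C.α (extendZero S u) (extendZero S w)
      (C.flux (extendZero S f) (extendZero S u) (extendZero S w))
      (C.source 0 (extendZero S g) (extendZero S u) (extendZero S w)) := by
  have hK := hC.kinetic_of_isSolution hf hg h.1 hw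
  obtain ⟨-, U, hU, hUu, hU0⟩ := h
  obtain ⟨W, F, G, hKU⟩ := hU.exists_kinetic
  -- The extension U and its gradient are identified on each side of S by uniqueness of weak
  -- gradients. That U is in 𝔖₂ across t = S supplies the L₂ right-hand side which gluing requires.
  have hW0 : W =ᵐ[vol (slab d d₁ ⊥ S)] 0 :=
    ((hKU.mono (slab_mono_right hST.le)).congr hU0 .rfl .rfl .rfl).isGradV.ae_unique
      (kinetic_zero _ C.α).isGradV
  have hWw : W =ᵐ[vol (slab d d₁ S T)] w :=
    ((hKU.mono slab_mono_left).congr hUu .rfl .rfl .rfl).isGradV.ae_unique hw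
  have eU : U =ᵐ[vol (slab d d₁ ⊥ T)] extendZero S u :=
    ae_slab_of_ae (hU0.trans extendZero_ae_eq_zero.symm) (hUu.trans extendZero_ae_eq.symm)
  have eW : W =ᵐ[vol (slab d d₁ ⊥ T)] extendZero S w :=
    ae_slab_of_ae (hW0.trans extendZero_ae_eq_zero.symm) (hWw.trans extendZero_ae_eq.symm)
  have hK' := hKU.congr eU eW .rfl .rfl
  refine hK'.glue hST ((kinetic_zero _ C.α).congr extendZero_ae_eq_zero.symm
    extendZero_ae_eq_zero.symm ?_ ?_) (hK.congr extendZero_ae_eq.symm extendZero_ae_eq.symm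
    (Coeffs.flux_congr extendZero_ae_eq.symm extendZero_ae_eq.symm extendZero_ae_eq.symm)
    (Coeffs.source_congr extendZero_ae_eq.symm extendZero_ae_eq.symm extendZero_ae_eq.symm))
    (hC.memLp_flux (memLp_extendZero hf) hK'.u_mem hK'.w_mem)
    (hC.memLp_source _ (memLp_extendZero hg) hK'.u_mem hK'.w_mem)
  · refine .trans (Eventually.of_forall fun z => ?_) (Coeffs.flux_congr extendZero_ae_eq_zero.symm
      extendZero_ae_eq_zero.symm extendZero_ae_eq_zero.symm)
    have e : matMul (C.a z) (0 : EuclideanSpace ℝ (Fin d₁)) = 0 := by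
      simpa using matMul_smul (C.a z) 0 (0 : EuclideanSpace ℝ (Fin d₁))
    simp [Coeffs.flux, e]
  · refine .trans (Eventually.of_forall fun z => ?_) (Coeffs.source_congr
      extendZero_ae_eq_zero.symm extendZero_ae_eq_zero.symm extendZero_ae_eq_zero.symm)
    simp [Coeffs.source]

/-- The function `exp (-lam (t - S)) u`, extended by zero, solves the equation with parameter `lam`
on `ℝ^{1+d+d₁}_T`. -/
theorem Coeffs.Admissible.kinetic_timeWeight_extendZero (hC : C.Admissible δ L) (hST : S < T)
    (hlam : 0 ≤ lam) (hf : MemLp f 2 (vol (slab d d₁ S T)))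
    (hg : MemLp g 2 (vol (slab d d₁ S T))) (h : IsCauchySolution S T C f g u)
    (hw : IsGradV (slab d d₁ S T) u w) :
    Kinetic (slab d d₁ ⊥ T) C.α (timeWeight (-lam) S (extendZero S u))
      (timeWeight (-lam) S (extendZero S w))
      (C.flux (timeWeight (-lam) S (extendZero S f)) (timeWeight (-lam) S (extendZero S u))
        (timeWeight (-lam) S (extendZero S w)))
      (C.source lam (timeWeight (-lam) S (extendZero S g)) (timeWeight (-lam) S (extendZero S u))
        (timeWeight (-lam) S (extendZero S w))) := by
  have := hC.kinetic_timeWeight (κ := -lam) (S := S) (B := 1) (memLp_extendZero hf)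
    (memLp_extendZero hg) (hC.kinetic_extendZero hST hf hg h hw)
    (Eventually.of_forall fun z => by
      rcases lt_or_ge S z.1 with hz | hz
      · left
        rw [Real.exp_le_one_iff]
        nlinarith
      · exact Or.inr ⟨extendZero_of_le hz, extendZero_of_le hz, extendZero_of_le hz,
          extendZero_of_le hz⟩)
  rwa [zero_sub, neg_neg] at this

/-- The a priori estimate is applied to exp(-λ(t - S)) u extended by zero. The weight is at most 1
on the data, and removing it from u costs exp(λ(T - S)). Since λ ≥ 1, the factors √λ can be dropped.
-/
theorem Coeffs.Admissible.cauchy_estimate (hC : C.Admissible δ L) (hδ : 0 < δ) (hδ' : δ < 1)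
    (hL : 0 < L) (hlam : 1 + 2 * L + L ^ 2 / δ ≤ lam) (hST : S < T)
    (hf : MemLp f 2 (vol (slab d d₁ S T))) (hg : MemLp g 2 (vol (slab d d₁ S T)))
    (h : IsCauchySolution S T C f g u) (hw : IsGradV (slab d d₁ S T) u w) :
    lpNorm u 2 (vol (slab d d₁ S T)) + lpNorm w 2 (vol (slab d d₁ S T))
      ≤ Real.exp (lam * (T - S)) * (4 / δ) * lpNorm f 2 (vol (slab d d₁ S T))
        + Real.exp (lam * (T - S)) * (4 / δ) * lpNorm g 2 (vol (slab d d₁ S T)) := by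
  have hlam1 : 1 ≤ lam := by
    have : 0 ≤ L ^ 2 / δ := by positivity
    linarith
  have hlam0 : 0 ≤ lam := zero_le_one.trans hlam1
  have hs : 1 ≤ √lam := Real.one_le_sqrt.2 hlam1
  have hK := hC.kinetic_timeWeight_extendZero hST hlam0 hf hg h hw
  have h1 : ∀ {E : Type} [NormedAddCommGroup E] (p : Pt d d₁ → E),
      ∀ᵐ z ∂vol (slab d d₁ ⊥ T), Real.exp (-lam * (z.1 - S)) ≤ 1 ∨ extendZero S p z = 0 :=
    fun p => Eventually.of_forall fun z => exp_le_one_or_extendZero_eq_zero hlam0 z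
  have h2 := hC.apriori hδ hδ' hL hlam (EReal.bot_lt_coe T)
    (memLp_timeWeight (memLp_extendZero hf) (h1 f)) (memLp_timeWeight (memLp_extendZero hg) (h1 g))
    hK
  have hf2 := lpNorm_timeWeight_le zero_le_one (memLp_extendZero hf) (h1 f)
  have hg2 := lpNorm_timeWeight_le zero_le_one (memLp_extendZero hg) (h1 g)
  have hB : ∀ᵐ z ∂vol (slab d d₁ ⊥ T), Real.exp (lam * (z.1 - S)) ≤ Real.exp (lam * (T - S)) :=
    ae_exp_le hlam0
  have hu2 := lpNorm_timeWeight_le (Real.exp_pos _).le hK.u_mem (hB.mono fun _ => Or.inl)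
  have hw2 := lpNorm_timeWeight_le (Real.exp_pos _).le hK.w_mem (hB.mono fun _ => Or.inl)
  rw [timeWeight_neg_timeWeight, lpNorm_extendZero h.1.1.1] at hu2
  rw [timeWeight_neg_timeWeight, lpNorm_extendZero hw.1] at hw2
  rw [one_mul, lpNorm_extendZero hf] at hf2
  rw [one_mul, lpNorm_extendZero hg] at hg2
  have hE := Real.exp_pos (lam * (T - S))
  have hu0 : 0 ≤ lpNorm (timeWeight (-lam) S (extendZero S u)) 2 (vol (slab d d₁ ⊥ T)) :=
    lpNorm_nonneg
  have hg0 : 0 ≤ lpNorm (timeWeight (-lam) S (extendZero S g)) 2 (vol (slab d d₁ ⊥ T)) :=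
    lpNorm_nonneg
  have hN : 0 ≤ 4 / δ := by positivity
  have h3 := le_mul_of_one_le_left hu0 hs
  have h4 : 4 / δ * (√lam)⁻¹ * lpNorm (timeWeight (-lam) S (extendZero S g)) 2
      (vol (slab d d₁ ⊥ T)) ≤ 4 / δ * lpNorm g 2 (vol (slab d d₁ S T)) := by
    refine mul_le_mul (mul_le_of_le_one_right hN (inv_le_one_of_one_le₀ hs)) hg2 hg0 hN
  have h5 := mul_le_mul_of_nonneg_left hf2 hN
  calc _ ≤ _ := add_le_add hu2 hw2
    _ = Real.exp (lam * (T - S)) * (lpNorm (timeWeight (-lam) S (extendZero S u)) 2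
          (vol (slab d d₁ ⊥ T)) + lpNorm (timeWeight (-lam) S (extendZero S w)) 2
          (vol (slab d d₁ ⊥ T))) := by ring
    _ ≤ Real.exp (lam * (T - S)) * (4 / δ * lpNorm f 2 (vol (slab d d₁ S T))
          + 4 / δ * lpNorm g 2 (vol (slab d d₁ S T))) :=
        mul_le_mul_of_nonneg_left (by linarith) hE.le
    _ = _ := by ring

theorem Coeffs.Admissible.cauchy_unique (hC : C.Admissible δ L) (hδ : 0 < δ) (hδ' : δ < 1)
    (hL : 0 < L) (hST : S < T) (hf : MemLp f 2 (vol (slab d d₁ S T)))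
    (hg : MemLp g 2 (vol (slab d d₁ S T))) {u' : Pt d d₁ → ℝ} (h : IsCauchySolution S T C f g u)
    (h' : IsCauchySolution S T C f g u') : u =ᵐ[vol (slab d d₁ S T)] u' := by
  obtain ⟨w, hw, -⟩ := h.1.2
  obtain ⟨w', hw', -⟩ := h'.1.2
  have hlam : 0 ≤ 1 + 2 * L + L ^ 2 / δ := by positivity
  have e := hC.ae_unique hδ hδ' hL le_rfl (EReal.bot_lt_coe T)
    (hC.kinetic_timeWeight_extendZero hST hlam hf hg h hw)
    (hC.kinetic_timeWeight_extendZero hST hlam hf hg h' hw')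
  have e' := ae_restrict_of_ae_restrict_of_subset (slab_mono_left (d := d) (d₁ := d₁) (S := S)) e
  filter_upwards [e', extendZero_ae_eq (S := S) (T := T) (h := u),
    extendZero_ae_eq (S := S) (T := T) (h := u')] with z h1 h2 h3
  rw [← h2, ← h3]
  exact smul_right_injective ℝ (Real.exp_pos _).ne' h1

/-- The equation with large λ is solved on t < T for the weighted data extended by zero. Uniqueness
on t < S makes the solution vanish there, and removing the weight, bounded on t < T, returns to the
parameter 0. -/
theorem Coeffs.Admissible.cauchy_exists (hC : C.Admissible δ L) (hδ : 0 < δ) (hδ' : δ < 1)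
    (hL : 0 < L) (hST : S < T) (hf : MemLp f 2 (vol (slab d d₁ S T)))
    (hg : MemLp g 2 (vol (slab d d₁ S T))) : ∃ u, IsCauchySolution S T C f g u := by
  obtain ⟨lam, hlam⟩ : ∃ lam, lam = 1 + 2 * L + L ^ 2 / δ := ⟨_, rfl⟩
  have hlam0 : 0 ≤ lam := by rw [hlam]; positivity
  have hf' := memLp_timeWeight (κ := -lam) (memLp_extendZero hf)
    (Eventually.of_forall fun z => exp_le_one_or_extendZero_eq_zero hlam0 z)
  have hg' := memLp_timeWeight (κ := -lam) (memLp_extendZero hg)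
    (Eventually.of_forall fun z => exp_le_one_or_extendZero_eq_zero hlam0 z)
  obtain ⟨u, w, hK⟩ := hC.exists_kinetic hδ hδ' hL hlam.ge hf' hg'
  have hu0 : u =ᵐ[vol (slab d d₁ ⊥ S)] 0 :=
    (hC.ae_eq_zero hδ hδ' hL hlam.ge (EReal.bot_lt_coe S)
      (timeWeight_ae_eq_zero extendZero_ae_eq_zero) (timeWeight_ae_eq_zero extendZero_ae_eq_zero)
      (hK.mono (slab_mono_right hST.le))).1
  have hK' := hC.kinetic_timeWeight (κ := lam) (S := S) hf' hg' hK
    ((ae_exp_le hlam0).mono fun _ => Or.inl)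
  rw [timeWeight_neg_timeWeight, timeWeight_neg_timeWeight, sub_self] at hK'
  refine ⟨timeWeight lam S u, (hC.isSolution_iff hf hg).2 ⟨timeWeight lam S w, ?_⟩,
    timeWeight lam S u, hK'.memS2, .rfl, timeWeight_ae_eq_zero hu0⟩
  exact (hK'.mono slab_mono_left).congr .rfl .rfl (Coeffs.flux_congr extendZero_ae_eq .rfl .rfl)
    (Coeffs.source_congr extendZero_ae_eq .rfl .rfl)

end Cauchy

end KineticL2

end

end

theorem theorem1p10 (d d₁ : ℕ) (hd : 1 ≤ d) (hd₁ : 1 ≤ d₁) (δ : ℝ) (hδ : 0 < δ) (hδ' : δ < 1) :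
    -- the constant `N = N(d, d₁, δ)` of the first estimate
    ∃ N : ℝ, 0 < N ∧ ∀ L : ℝ, 0 < L →
      -- (i)
      (∃ lam₀ : ℝ, 0 < lam₀ ∧
        ∀ (T : EReal), ⊥ < T → ∀ C : KineticL2.Coeffs d d₁, C.Admissible δ L →
        ∀ lam : ℝ, lam₀ ≤ lam →
        ∀ (f : KineticL2.Pt d d₁ → EuclideanSpace ℝ (Fin d₁)) (g : KineticL2.Pt d d₁ → ℝ),
          MemLp f 2 (KineticL2.vol (KineticL2.slab d d₁ ⊥ T)) →
          MemLp g 2 (KineticL2.vol (KineticL2.slab d d₁ ⊥ T)) →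
          -- the a priori estimate
          (∀ u w, KineticL2.IsSolution (KineticL2.slab d d₁ ⊥ T) C lam f g u →
            KineticL2.IsGradV (KineticL2.slab d d₁ ⊥ T) u w →
            √lam * lpNorm u 2 (KineticL2.vol (KineticL2.slab d d₁ ⊥ T))
                + lpNorm w 2 (KineticL2.vol (KineticL2.slab d d₁ ⊥ T))
              ≤ N * lpNorm f 2 (KineticL2.vol (KineticL2.slab d d₁ ⊥ T))
                + N * (√lam)⁻¹ * lpNorm g 2 (KineticL2.vol (KineticL2.slab d d₁ ⊥ T))) ∧
          -- existence and uniqueness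
          (∃ u, KineticL2.IsSolution (KineticL2.slab d d₁ ⊥ T) C lam f g u ∧
            ∀ u', KineticL2.IsSolution (KineticL2.slab d d₁ ⊥ T) C lam f g u' →
              u' =ᵐ[KineticL2.vol (KineticL2.slab d d₁ ⊥ T)] u)) ∧
      -- (ii), where the constant `N' = N'(d, d₁, δ, L, T - S)`
      (∀ τ : ℝ, 0 < τ → ∃ N' : ℝ, 0 < N' ∧
        ∀ (S T : ℝ), T - S = τ → ∀ C : KineticL2.Coeffs d d₁, C.Admissible δ L →
        ∀ (f : KineticL2.Pt d d₁ → EuclideanSpace ℝ (Fin d₁)) (g : KineticL2.Pt d d₁ → ℝ),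
          MemLp f 2 (KineticL2.vol (KineticL2.slab d d₁ S T)) →
          MemLp g 2 (KineticL2.vol (KineticL2.slab d d₁ S T)) →
          -- the estimate
          (∀ u w, KineticL2.IsCauchySolution S T C f g u →
            KineticL2.IsGradV (KineticL2.slab d d₁ S T) u w →
            lpNorm u 2 (KineticL2.vol (KineticL2.slab d d₁ S T))
                + lpNorm w 2 (KineticL2.vol (KineticL2.slab d d₁ S T))
              ≤ N' * lpNorm f 2 (KineticL2.vol (KineticL2.slab d d₁ S T))
                + N' * lpNorm g 2 (KineticL2.vol (KineticL2.slab d d₁ S T))) ∧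
          -- existence and uniqueness
          (∃ u, KineticL2.IsCauchySolution S T C f g u ∧
            ∀ u', KineticL2.IsCauchySolution S T C f g u' →
              u' =ᵐ[KineticL2.vol (KineticL2.slab d d₁ S T)] u)) := by
  -- The constant 4/δ is free of L because the lower order terms are absorbed by λ₀ = 1 + 2L + L²/δ.
  -- In (ii) the same λ₀ enters through the weight.
  refine ⟨4 / δ, by positivity, fun L hL => ⟨⟨1 + 2 * L + L ^ 2 / δ, by positivity,
    fun T hT C hC lam hlam f g hf hg => ⟨fun u w hu hw => ?_, ?_⟩⟩, fun τ hτ =>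
    ⟨Real.exp ((1 + 2 * L + L ^ 2 / δ) * τ) * (4 / δ), by positivity, ?_⟩⟩⟩
  · exact hC.apriori hδ hδ' hL hlam hT hf hg (hC.kinetic_of_isSolution hf hg hu hw)
  · obtain ⟨u, w, h⟩ := hC.exists_kinetic hδ hδ' hL hlam hf hg
    refine ⟨u, (hC.isSolution_iff hf hg).2 ⟨w, h⟩, fun u' hu' => ?_⟩
    obtain ⟨w', h'⟩ := (hC.isSolution_iff hf hg).1 hu'
    exact hC.ae_unique hδ hδ' hL hlam hT h' h
  · rintro S T rfl C hC f g hf hg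
    have hST : S < T := sub_pos.1 hτ
    refine ⟨fun u w hu hw => hC.cauchy_estimate hδ hδ' hL le_rfl hST hf hg hu hw, ?_⟩
    obtain ⟨u, hu⟩ := hC.cauchy_exists hδ hδ' hL hST hf hg
    exact ⟨u, hu, fun u' hu' => hC.cauchy_unique hδ hδ' hL hST hf hg hu' hu⟩
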